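/- **Setting.** Fix $\mu>0$. For $N$ data streams observed at times $t=1,2,\dots$, let $\mathcal N\subset\{1,\dots,N\}$ be a random subset containing each stream independently with probability $p$, and, given $\mathcal N$, let $X_{nt}$ be independent $N(\mu\mathbf 1_{\{t\ge\nu,\,n\in\mathcal N\}},1)$. $P_\nu,E_\nu$ denote probability and expectation when the change-point is $\nu\in\{1,2,\dots\}\cup\{\infty\}$ ($\nu=\infty$: no change). For an assumed shift $\mu_0>0$ the CUSUM scores are $R_{n0}=0$, $R_{nt}=(R_{n,t-1}+\mu_0X_{nt}-\mu_0^2/2)^+$. For $\lambda_M>0$, $0<p_0\le1$ and a threshold $b\in\mathbb R$ let $$g_M(x)=\log[1+p_0(\lambda_Me^{x/2}-1)],\qquad T_{\rm Mei}(p_0)=\inf\Big\{t\ge1:\ \sum_{n=1}^N g_M(R_{nt})\ge b\Big\},$$ and for a stopping rule $T$ let ${\rm ARL}(T)=E_\infty T$ and $D_{N,k}(T)=\sup_{k\le\nu<\infty}E_\nu(T-\nu+1\mid T\ge\nu)$. For $0<\zeta<1$ let $$\rho(\beta,\zeta)=\begin{cases}\beta-\frac{1-\zeta}2&\text{if }\frac{1-\zeta}2<\beta\le\frac{3(1-\zeta)}4,\\(\sqrt{1-\zeta}-\sqrt{1-\zeta-\beta})^2&\text{if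 }\frac{3(1-\zeta)}4<\beta<1-\zeta.\end{cases}$$ **Theorem.** For every $\mu_0>0$ the limit $\xi=\lim_{t\to\infty}E_\infty e^{R_{nt}/2}$ exists, is finite, and does not depend on $n$, $N$. Let $u=\log[1+p_0(\lambda_M\xi-1)]$. For all $\lambda_M>0$, $0<p_0\le1$: if ${\rm ARL}(T_{\rm Mei}(p_0))=\gamma$, then $b\le Nu+\log(4\gamma)$. In addition, let $\lambda_M>0$ and $c>0$ be fixed and let, as $N\to\infty$, $\gamma=\gamma_N\ge 1$ satisfy $\log\gamma\sim N^\zeta$ with $0<\zeta<1$, let $p=p_N\sim N^{-\beta}$, $p_0=c[(\log\gamma)/N]^{1/2}$, and let $b=b_N$ be such that ${\rm ARL}(T_{\rm Mei}(p_0))=\gamma$ (all for $N$ large). (a) If $\frac{1-\zeta}2<\beta\le\frac{3(1-\zeta)}4$ and $\mu_0=2\mu$, then $$\frac{D_{N,K_N}(T_{\rm Mei}(p_0))}{\log N}\to2\mu^{-2}\rho(\beta,\zeta)\qquad(*)$$ for $K_N=2\mu^{-2}(1-\zeta-\beta)\log N$. (b) If $\frac{3(1-\zeta)}4<\beta<1-\zeta$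 and $\mu_0=\mu\sqrt{\frac{1-\zeta}{\rho(\beta,\zeta)}}$, then $(*)$ holds for $K_N=2\mu^{-2}\rho(\beta,\zeta)\log N$. -/

import Mathlib

open MeasureTheory ProbabilityTheory Filter Topology Asymptotics
open scoped ENNReal

noncomputable section

namespace MultiStream

/-- The observations `X n t` of `N` data streams: stream `n ∈ S` has its mean shifted by `μ` from
time `ν` on, all other means are zero; `ε n t` is the noise. Observation times are `t = 1, 2, …`;
the coordinate `t = 0` is never used. `ν = ⊤` means that there is no change. -/
def observe {N : ℕ} (μ : ℝ) (ν : ℕ∞) (S : Set (Fin N)) (ε : Fin N → ℕ → ℝ) : Fin N → ℕ → ℝ :=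
  open Classical in fun n t => ε n t + if ν ≤ (t : ℕ∞) ∧ n ∈ S then μ else 0

/-- Joint law of the random set of affected streams (each stream belongs to it independently with
probability `p`) and of an independent array of i.i.d. standard normal noise variables. -/
def baseLaw (N : ℕ) (p : unitInterval) : Measure (Set (Fin N) × (Fin N → ℕ → ℝ)) :=
  (setBernoulli Set.univ p).prod
    (Measure.pi fun _ : Fin N => Measure.infinitePi fun _ : ℕ => gaussianReal 0 1)

/-- `P_ν`: the law of the observations when the change occurs at time `ν`
(`ν = ⊤`: no change). -/
def law (N : ℕ) (μ : ℝ) (p : unitInterval) (ν : ℕ∞) : Measure (Fin N → ℕ → ℝ) :=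
  (baseLaw N p).map fun ω => observe μ ν ω.1 ω.2

theorem measurable_observe (N : ℕ) (μ : ℝ) (ν : ℕ∞) :
    Measurable fun ω : Set (Fin N) × (Fin N → ℕ → ℝ) => observe μ ν ω.1 ω.2 := by
  classical
  refine measurable_pi_lambda _ fun n => measurable_pi_lambda _ fun t => ?_
  have h1 : Measurable fun ω : Set (Fin N) × (Fin N → ℕ → ℝ) => ω.2 n t :=
    (measurable_pi_apply t).comp ((measurable_pi_apply n).comp measurable_snd)
  have h2 : Measurable fun S : Set (Fin N) =>
      if ν ≤ (t : ℕ∞) ∧ n ∈ S then μ else 0 := .of_discrete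
  unfold observe
  refine h1.add ?_
  convert h2.comp measurable_fst using 2
  rfl

instance (N : ℕ) (p : unitInterval) : IsProbabilityMeasure (baseLaw N p) := by
  unfold baseLaw; infer_instance

instance (N : ℕ) (μ : ℝ) (p : unitInterval) (ν : ℕ∞) : IsProbabilityMeasure (law N μ p ν) :=
  Measure.isProbabilityMeasure_map (measurable_observe N μ ν).aemeasurable

/-- CUSUM score at time `t` of the data stream `x 1, x 2, …`, with assumed mean shift `μ₀`. -/
def cusum (μ₀ : ℝ) (x : ℕ → ℝ) : ℕ → ℝ
  | 0 => 0
  | t + 1 => max (cusum μ₀ x t + μ₀ * x (t + 1) - μ₀ ^ 2 / 2) 0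

/-- The detectability score transformation
`g_M(x) = log (1 + p₀ (lam * exp (x / 2) - 1))`. -/
def gM (p₀ lam x : ℝ) : ℝ := Real.log (1 + p₀ * (lam * Real.exp (x / 2) - 1))

/-- The extended Mei stopping rule: the first time `t ≥ 1` at which the sum of the transformed CUSUM
scores of the streams is at least `b` (`⊤` if there is none). -/
def meiTime {N : ℕ} (μ₀ lam p₀ b : ℝ) (x : Fin N → ℕ → ℝ) : ℕ∞ :=
  ⨅ (t : ℕ) (_ : 1 ≤ t ∧ b ≤ ∑ n, gM p₀ lam (cusum μ₀ (x n) t)), (t : ℕ∞)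

/-- The limit as `t → ∞` of `E[exp (R_t / 2)]`, where `R_t` is the CUSUM score of a stream of
i.i.d. standard normal observations. -/
def xi (μ₀ : ℝ) : ℝ :=
  limUnder atTop fun t : ℕ =>
    ∫ x, Real.exp (cusum μ₀ x t / 2) ∂(Measure.infinitePi fun _ : ℕ => gaussianReal 0 1)

/-- Average run length `E_∞ T` of a stopping rule `T`. The law for `ν = ⊤` does not depend on the
shift and the probability, which are set to zero. -/
def ARL {N : ℕ} (T : (Fin N → ℕ → ℝ) → ℕ∞) : ℝ≥0∞ :=
  ∫⁻ x, (T x : ℝ≥0∞) ∂(law N 0 0 ⊤)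

/-- Expected detection delay over the change-points `ν ≥ k`:
the supremum over `k ≤ ν < ∞`, `1 ≤ ν`, of `E_ν (T - ν + 1 | T ≥ ν)`. -/
def delay {N : ℕ} (μ : ℝ) (p : unitInterval) (k : ℝ) (T : (Fin N → ℕ → ℝ) → ℕ∞) : ℝ≥0∞ :=
  ⨆ (ν : ℕ) (_ : 1 ≤ ν ∧ k ≤ (ν : ℝ)),
    ∫⁻ x, ((T x : ℝ≥0∞) - (ν : ℝ≥0∞) + 1) ∂((law N μ p ν)[|{x | (ν : ℕ∞) ≤ T x}])

/-- The detection boundary constant `ρ(β, ζ)` (used for `(1 - ζ) / 2 < β < 1 - ζ`). -/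
def rho (β ζ : ℝ) : ℝ :=
  if β ≤ 3 * (1 - ζ) / 4 then β - (1 - ζ) / 2
  else (Real.sqrt (1 - ζ) - Real.sqrt (1 - ζ - β)) ^ 2

end MultiStream

end

/-! Write h(s) = P_∞(T > s), so that ARL(T) = ∑ h(s). Two facts about the CUSUM recursion carry the
proof. Restarting the scores from zero can only lower them (`cusum_splice`), and g_M is increasing,
so h is submultiplicative. For 0 < θ < 1 the underlying walk S has E exp(θ S_1) = `shrink` < 1.
Hence E exp(θ R_t) is bounded in t, and E exp(R_t/2) increases to ξ with a geometric error.

Threshold (`threshold_le`). The exponential of the statistic is a product of N independent factors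
of mean at most e^u. Markov's inequality and a union bound give P_∞(T ≤ s) ≤ s e^{Nu-b}. So h ≥ 1/2
up to a time of order e^{b-Nu}, and ∑ h(s) = γ bounds b.

Upper bound for the delay (`delay_le`). Restart the scores k steps before the last pre-change
observation. If they have not crossed m steps into the change, the remaining wait is on average at
most another ARL. The delay is therefore at most m + 2γ · P(statistic < b), the probability being
that of the restarted process after k pre-change and m post-change observations. The factor 2 is the
cost of replacing survival up to the restart by survival up to the change: h(s) ≤ 2h(s+k). It comes
from Harris' inequality and from the smallness of one-time crossing probabilities, which the value
of the ARL implies (`noises_noCross_le_two_mul`). The remaining probability is estimated by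
Chernoff's bound with exp(-∑ g_M) (`law_score_lt_le`). The unaffected streams cancel the term Nu of
the threshold up to N p₀ · `shrink`^(k+m), and the condition ν ≥ K_N makes this error negligible. An
affected stream reaches y log N with Gaussian probability about N^{-v}, and the gain has order N · p
· N^{-v} · p₀ e^{(y log N)/2}. The delay is at most m + 1 once this power of N beats log γ.

Lower bound for the delay (`le_delay`). Since ∑ h(s) = γ, some late window of m steps has
conditional crossing probability below q = γ^{-3/4} (`exists_small_hazard`). Let the change start
with that window. The likelihood ratio is a product over streams of mixtures 1 + p(Z - 1); it is at
most C plus a truncation error controlled by its α-th moment (`law_sdiff_le`). That moment is at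
most exp(2N p^α e^{α(α-1)μ²m/2}). With m about M log N and C = γ^{1/2}, it is harmless when 1 - αβ +
α(α-1)μ²M/2 < ζ.

Both critical values of M equal 2ρ/μ². In the moderate range the choices are α = 2 and y = 4ρ. In
the sparse range put A² = 1 - ζ and B² = 1 - ζ - β; then ρ = (A - B)², α = A/(A - B), y = A² and v
is close to B². -/

noncomputable section

namespace MultiStream

/-! ### White noise and splicing -/

/-- The law of a stream of independent standard normal variables. -/
def noise : Measure (ℕ → ℝ) := Measure.infinitePi fun _ : ℕ => gaussianReal 0 1

/-- The law of `N` independent streams of independent standard normal variables. -/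
def noises (N : ℕ) : Measure (Fin N → ℕ → ℝ) := Measure.pi fun _ : Fin N => noise

instance : IsProbabilityMeasure noise := by unfold noise; infer_instance

instance (N : ℕ) : IsProbabilityMeasure (noises N) := by unfold noises; infer_instance

/-- Follow `x` up to time `s` and `y` afterwards. -/
def splice (s : ℕ) (x y : ℕ → ℝ) : ℕ → ℝ := fun t => if t ≤ s then x t else y (t - s)

theorem splice_of_le {s t : ℕ} (h : t ≤ s) (x y : ℕ → ℝ) : splice s x y t = x t := by
  simp [splice, h]

theorem splice_add {s j : ℕ} (h : 1 ≤ j) (x y : ℕ → ℝ) : splice s x y (s + j) = y j := by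
  simp [splice, show ¬ (s + j ≤ s) by omega]

theorem measurable_splice (s : ℕ) :
    Measurable fun z : (ℕ → ℝ) × (ℕ → ℝ) => splice s z.1 z.2 := by
  refine measurable_pi_lambda _ fun t => ?_
  unfold splice
  split_ifs <;> fun_prop

/-- This is the Markov property in product form. A cylinder pulls back to a rectangle: constraints
at times up to s fall on the first stream, later ones on the second after translation by s. -/
theorem measurePreserving_splice (s : ℕ) :
    MeasurePreserving (fun z : (ℕ → ℝ) × (ℕ → ℝ) => splice s z.1 z.2)
      (noise.prod noise) noise := by
  classical
  refine ⟨measurable_splice s, Measure.eq_infinitePi _ fun J B hB => ?_⟩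
  rw [Measure.map_apply (measurable_splice s) (.pi J.countable_toSet fun _ _ => hB _)]
  have h : (fun z : (ℕ → ℝ) × (ℕ → ℝ) => splice s z.1 z.2) ⁻¹' ((J : Set ℕ).pi B) =
      (((J.filter (· ≤ s) : Finset ℕ) : Set ℕ).pi B) ×ˢ
        ((((J.filter (¬ · ≤ s)).image (· - s) : Finset ℕ) : Set ℕ).pi fun i => B (i + s)) := by
    ext ⟨x, y⟩
    simp only [Set.mem_preimage, Set.mem_pi, Finset.mem_coe, Set.mem_prod, Finset.mem_filter,
      Finset.mem_image, splice]
    constructor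
    · intro h
      refine ⟨fun i hi => by simpa [hi.2] using h i hi.1, ?_⟩
      rintro _ ⟨i, hi, rfl⟩
      have := h i hi.1
      rw [if_neg hi.2] at this
      rwa [Nat.sub_add_cancel (by omega)]
    · rintro ⟨h1, h2⟩ i hi
      split_ifs with his
      · exact h1 i ⟨hi, his⟩
      · have := h2 (i - s) ⟨i, ⟨hi, his⟩, rfl⟩
        rwa [Nat.sub_add_cancel (by omega)] at this
  rw [h, Measure.prod_prod, noise, Measure.infinitePi_pi _ fun i _ => hB i,
    Measure.infinitePi_pi _ fun i _ => hB (i + s), Finset.prod_image, ← Finset.prod_filter_mul_prod_filter_not J (· ≤ s)]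
  · congr 1
    refine Finset.prod_congr rfl fun i hi => ?_
    rw [Nat.sub_add_cancel]
    have := (Finset.mem_filter.1 hi).2
    omega
  · intro i hi j hj hij
    have := (Finset.mem_filter.1 hi).2
    have := (Finset.mem_filter.1 hj).2
    simp only at hij
    omega

/-- Splice all streams at the same time. -/
def spliceN {N : ℕ} (s : ℕ) (x y : Fin N → ℕ → ℝ) : Fin N → ℕ → ℝ :=
  fun n => splice s (x n) (y n)

theorem measurePreserving_spliceN (N s : ℕ) :
    MeasurePreserving (fun z : (Fin N → ℕ → ℝ) × (Fin N → ℕ → ℝ) => spliceN s z.1 z.2)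
      ((noises N).prod (noises N)) (noises N) := by
  have h1 := (measurePreserving_arrowProdEquivProdArrow (ℕ → ℝ) (ℕ → ℝ) (Fin N)
    (fun _ => noise) (fun _ => noise)).symm
  have h2 := measurePreserving_pi (fun _ : Fin N => noise.prod noise) (fun _ : Fin N => noise)
    (fun _ => measurePreserving_splice s)
  exact h2.comp h1

theorem lintegral_splice (s : ℕ) {F : (ℕ → ℝ) → ℝ≥0∞} (hF : Measurable F) :
    ∫⁻ x, F x ∂noise = ∫⁻ x, ∫⁻ y, F (splice s x y) ∂noise ∂noise := by
  rw [← (measurePreserving_splice s).lintegral_comp hF, lintegral_prod]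
  exact (hF.comp (measurable_splice s)).aemeasurable

theorem lintegral_spliceN {N : ℕ} (s : ℕ) {F : (Fin N → ℕ → ℝ) → ℝ≥0∞} (hF : Measurable F) :
    ∫⁻ x, F x ∂(noises N) = ∫⁻ x, ∫⁻ y, F (spliceN s x y) ∂(noises N) ∂(noises N) := by
  rw [← (measurePreserving_spliceN N s).lintegral_comp hF, lintegral_prod]
  exact (hF.comp (measurePreserving_spliceN N s).measurable).aemeasurable

theorem lintegral_noise_eval (t : ℕ) {f : ℝ → ℝ≥0∞} (hf : Measurable f) :
    ∫⁻ x, f (x t) ∂noise = ∫⁻ a, f a ∂(gaussianReal 0 1) :=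
  (measurePreserving_eval_infinitePi (fun _ : ℕ => gaussianReal 0 1) t).lintegral_comp hf

theorem lintegral_noises_eval {N : ℕ} (n : Fin N) {f : (ℕ → ℝ) → ℝ≥0∞} (hf : Measurable f) :
    ∫⁻ x, f (x n) ∂(noises N) = ∫⁻ a, f a ∂noise :=
  (measurePreserving_eval (fun _ : Fin N => noise) n).lintegral_comp hf

theorem iIndepFun_noise : iIndepFun (fun (t : ℕ) (x : ℕ → ℝ) => x t) noise :=
  iIndepFun_infinitePi (X := fun _ a => a) fun _ => measurable_id

theorem lintegral_noise_prod (J : Finset ℕ) {f : ℕ → ℝ → ℝ≥0∞} (hf : ∀ t, Measurable (f t)) :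
    ∫⁻ x, ∏ t ∈ J, f t (x t) ∂noise = ∏ t ∈ J, ∫⁻ a, f t a ∂(gaussianReal 0 1) := by
  rw [lintegral_prod_eq_prod_lintegral_of_indepFun J (fun t (x : ℕ → ℝ) => f t (x t))
    (iIndepFun_noise.comp f hf) (fun t => (hf t).comp (measurable_pi_apply t))]
  exact Finset.prod_congr rfl fun t _ => lintegral_noise_eval t (hf t)

theorem lintegral_noises_prod {N : ℕ} {f : Fin N → (ℕ → ℝ) → ℝ≥0∞} (hf : ∀ n, Measurable (f n)) :
    ∫⁻ x, ∏ n, f n (x n) ∂(noises N) = ∏ n, ∫⁻ a, f n a ∂noise := by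
  refine (lintegral_prod_eq_prod_lintegral_of_indepFun Finset.univ
    (fun n (x : Fin N → ℕ → ℝ) => f n (x n))
    (iIndepFun_pi (μ := fun _ : Fin N => noise) fun n => (hf n).aemeasurable)
    (fun n => (hf n).comp (measurable_pi_apply n))).trans ?_
  exact Finset.prod_congr rfl fun n _ => lintegral_noises_eval n (hf n)

/-! ### Shifting the mean as a change of measure -/

/-- The likelihood ratio of a mean shift `μ` in a standard normal observation `a`. -/
def lik (μ a : ℝ) : ℝ≥0∞ := ENNReal.ofReal (Real.exp (μ * a - μ ^ 2 / 2))

theorem measurable_lik (μ : ℝ) : Measurable (lik μ) := by unfold lik; fun_prop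

theorem gaussianReal_map_shift (μ : ℝ) :
    (gaussianReal 0 1).map (fun a => a + μ) = (gaussianReal 0 1).withDensity (lik μ) := by
  rw [gaussianReal_map_add_const, gaussianReal_of_var_ne_zero _ one_ne_zero,
    gaussianReal_of_var_ne_zero _ one_ne_zero,
    ← withDensity_mul _ (measurable_gaussianPDF _ _) (measurable_lik μ)]
  congr 1
  ext a
  simp only [gaussianPDF, gaussianPDFReal, lik, Pi.mul_apply]
  rw [← ENNReal.ofReal_mul (by positivity), mul_assoc (Real.sqrt _)⁻¹, ← Real.exp_add]
  congr 3
  simp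
  ring

/-- Shift the mean by `μ` at the times in `J`. -/
def shiftOn (μ : ℝ) (J : Finset ℕ) (x : ℕ → ℝ) : ℕ → ℝ :=
  fun t => x t + if t ∈ J then μ else 0

theorem measurable_shiftOn (μ : ℝ) (J : Finset ℕ) : Measurable (shiftOn μ J) := by
  unfold shiftOn; fun_prop

/-- Cameron–Martin for finitely many coordinates, checked on cylinders. Coordinates in `J` outside
the cylinder contribute the total mass 1 of a shifted Gaussian. -/
theorem noise_map_shiftOn (μ : ℝ) (J : Finset ℕ) :
    noise.map (shiftOn μ J) = noise.withDensity fun x => ∏ t ∈ J, lik μ (x t) := by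
  have h0 : ∀ t : ℕ, IsProbabilityMeasure
      ((gaussianReal 0 1).map fun a => a + if t ∈ J then μ else 0) := fun t =>
    Measure.isProbabilityMeasure_map (by fun_prop)
  have h1 : noise.map (shiftOn μ J) = Measure.infinitePi fun t : ℕ =>
      (gaussianReal 0 1).map fun a => a + if t ∈ J then μ else 0 :=
    Measure.infinitePi_map_pi (μ := fun _ : ℕ => gaussianReal 0 1)
      (f := fun t a => a + if t ∈ J then μ else 0) fun t => by fun_prop
  rw [h1]
  symm
  refine Measure.eq_infinitePi _ fun s B hB => ?_
  have hmB : MeasurableSet ((s : Set ℕ).pi B) := .pi s.countable_toSet fun _ _ => hB _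
  rw [withDensity_apply _ hmB, ← lintegral_indicator hmB]
  have h2 : ∀ x : ℕ → ℝ, ((s : Set ℕ).pi B).indicator (fun x => ∏ t ∈ J, lik μ (x t)) x =
      ∏ t ∈ s ∪ J, ((if t ∈ s then (B t).indicator 1 (x t) else 1) *
        (if t ∈ J then lik μ (x t) else 1)) := by
    intro x
    rw [Finset.prod_mul_distrib, Finset.prod_ite_mem, Finset.prod_ite_mem,
      Finset.inter_eq_right.2 Finset.subset_union_left,
      Finset.inter_eq_right.2 Finset.subset_union_right]
    by_cases hx : x ∈ (s : Set ℕ).pi B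
    · rw [Set.indicator_of_mem hx, Finset.prod_eq_one (s := s), one_mul]
      intro i hi
      simp [hx i hi]
    · rw [Set.indicator_of_notMem hx]
      simp only [Set.mem_pi, Finset.mem_coe, not_forall] at hx
      obtain ⟨i, hi, hxi⟩ := hx
      rw [Finset.prod_eq_zero hi (by simp [hxi]), zero_mul]
  simp_rw [h2]
  rw [lintegral_noise_prod (s ∪ J) (f := fun t a => (if t ∈ s then (B t).indicator 1 a else 1) *
        (if t ∈ J then lik μ a else 1))]
  · rw [← Finset.prod_subset (Finset.subset_union_left (s₁ := s) (s₂ := J))]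
    · refine Finset.prod_congr rfl fun t ht => ?_
      by_cases htJ : t ∈ J
      · simp only [ht, htJ, if_true]
        rw [gaussianReal_map_shift, withDensity_apply _ (hB t), ← lintegral_indicator (hB t)]
        congr 1
        ext a
        by_cases ha : a ∈ B t <;> simp [ha]
      · simp only [ht, htJ, if_true, if_false, mul_one, add_zero, Measure.map_id']
        rw [lintegral_indicator_one (hB t)]
    · intro t ht hts
      have htJ : t ∈ J := by simpa [hts] using ht
      simp only [hts, htJ, if_true, if_false, one_mul]
      rw [← setLIntegral_univ, ← withDensity_apply _ MeasurableSet.univ, ← gaussianReal_map_shift]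
      have := h0 t
      simp only [htJ, if_true] at this
      exact measure_univ
  · intro t
    refine Measurable.mul ?_ ?_
    · split_ifs
      · exact measurable_one.indicator (hB t)
      · fun_prop
    · split_ifs
      · exact measurable_lik μ
      · fun_prop

theorem lintegral_noises_map {N : ℕ} (μ : ℝ) (J : Fin N → Finset ℕ)
    {F : (Fin N → ℕ → ℝ) → ℝ≥0∞} (hF : Measurable F) :
    ∫⁻ x, F (fun n => shiftOn μ (J n) (x n)) ∂(noises N) =
      ∫⁻ x, (∏ n, ∏ t ∈ J n, lik μ (x n t)) * F x ∂(noises N) := by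
  have hm : ∀ n, Measurable fun x : ℕ → ℝ => ∏ t ∈ J n, lik μ (x t) := fun n =>
    Finset.measurable_prod _ fun t _ => (measurable_lik μ).comp (measurable_pi_apply t)
  have hm' : Measurable fun x : Fin N → ℕ → ℝ => ∏ n, ∏ t ∈ J n, lik μ (x n t) :=
    Finset.measurable_prod _ fun n _ => (hm n).comp (measurable_pi_apply n)
  have hs : Measurable fun (x : Fin N → ℕ → ℝ) n => shiftOn μ (J n) (x n) :=
    measurable_pi_lambda _ fun n => (measurable_shiftOn μ _).comp (measurable_pi_apply n)
  have hp : ∀ n, IsProbabilityMeasure (noise.map (shiftOn μ (J n))) := fun n =>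
    Measure.isProbabilityMeasure_map (measurable_shiftOn μ _).aemeasurable
  have h1 : (noises N).map (fun x n => shiftOn μ (J n) (x n)) =
      (noises N).withDensity fun x => ∏ n, ∏ t ∈ J n, lik μ (x n t) := by
    rw [noises, Measure.pi_map_pi fun n => (measurable_shiftOn μ _).aemeasurable]
    refine Measure.pi_eq fun B hB => ?_
    rw [withDensity_apply _ (.univ_pi hB), ← lintegral_indicator (.univ_pi hB)]
    have h2 : ∀ x : Fin N → ℕ → ℝ,
        (Set.univ.pi B).indicator (fun x => ∏ n, ∏ t ∈ J n, lik μ (x n t)) x =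
          ∏ n, (B n).indicator (fun y => ∏ t ∈ J n, lik μ (y t)) (x n) := by
      intro x
      by_cases hx : x ∈ Set.univ.pi B
      · rw [Set.indicator_of_mem hx]
        exact Finset.prod_congr rfl fun n _ => 
          (Set.indicator_of_mem (hx n trivial) fun y : ℕ → ℝ => ∏ t ∈ J n, lik μ (y t)).symm
      · rw [Set.indicator_of_notMem hx]
        simp only [Set.mem_pi, Set.mem_univ, true_imp_iff, not_forall] at hx
        obtain ⟨i, hxi⟩ := hx
        rw [Finset.prod_eq_zero (Finset.mem_univ i) (by simp [hxi])]
    simp_rw [h2]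
    refine (lintegral_noises_prod fun n => (hm n).indicator (hB n)).trans ?_
    refine Finset.prod_congr rfl fun n _ => ?_
    rw [noise_map_shiftOn, withDensity_apply _ (hB n), ← lintegral_indicator (hB n)]
  rw [← lintegral_map hF hs, h1, lintegral_withDensity_eq_lintegral_mul _ hm' hF]
  rfl

/-! ### The random set of affected streams -/

/-- Averaging over the affected set replaces each stream's factor by a two-point mixture, because
memberships are independent. -/
theorem lintegral_setBernoulli_prod {N : ℕ} (p : unitInterval) (f g : Fin N → ℝ≥0∞) :
    open Classical in
    ∫⁻ S, ∏ n, (if n ∈ S then f n else g n) ∂(setBernoulli (Set.univ : Set (Fin N)) p) =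
      ∏ n, (ENNReal.ofReal p * f n + ENNReal.ofReal (1 - p) * g n) := by
  classical
  rw [setBernoulli_eq_map, lintegral_map (.of_discrete) (by fun_prop), Measure.infinitePi_eq_pi]
  simp only [Set.mem_ofPred_eq, Set.mem_univ]
  refine (lintegral_prod_eq_prod_lintegral_of_indepFun Finset.univ _
    (iIndepFun_pi (μ := fun _ : Fin N => unitInterval.toNNReal p • Measure.dirac True +
      unitInterval.toNNReal (unitInterval.symm p) • Measure.dirac False)
      (X := fun n a => if a then f n else g n) fun n => Measurable.aemeasurable .of_discrete)
    (fun n => ?_)).trans ?_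
  · exact (Measurable.of_discrete (f := fun a : Prop => if a then f n else g n)).comp
      (measurable_pi_apply n)
  · refine Finset.prod_congr rfl fun n _ => ?_
    refine ((measurePreserving_eval (fun _ : Fin N => unitInterval.toNNReal p • Measure.dirac True +
      unitInterval.toNNReal (unitInterval.symm p) • Measure.dirac False) n).lintegral_comp
      (f := fun a : Prop => if a then f n else g n) .of_discrete).trans ?_
    have h : ∀ q : unitInterval, ((unitInterval.toNNReal q : NNReal) : ℝ≥0∞) =
        ENNReal.ofReal q := fun q => by
      rw [← ENNReal.ofReal_coe_nnreal]; rfl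
    rw [lintegral_add_measure, lintegral_smul_measure, lintegral_smul_measure, lintegral_dirac,
      lintegral_dirac]
    simp [ENNReal.smul_def, h]

/-! ### Pathwise properties of the CUSUM score -/

/-- The random walk whose reflection at zero is the CUSUM score. -/
def walk (μ₀ : ℝ) (x : ℕ → ℝ) (t : ℕ) : ℝ := ∑ i ∈ Finset.Icc 1 t, (μ₀ * x i - μ₀ ^ 2 / 2)

theorem walk_succ (μ₀ : ℝ) (x : ℕ → ℝ) (t : ℕ) :
    walk μ₀ x (t + 1) = walk μ₀ x t + (μ₀ * x (t + 1) - μ₀ ^ 2 / 2) := by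
  rw [walk, Finset.sum_Icc_succ_top (by omega), walk]

theorem measurable_walk (μ₀ : ℝ) (t : ℕ) : Measurable fun x => walk μ₀ x t := by
  unfold walk
  exact Finset.measurable_sum _ fun i _ => by fun_prop

theorem cusum_nonneg (μ₀ : ℝ) (x : ℕ → ℝ) (t : ℕ) : 0 ≤ cusum μ₀ x t := by
  cases t <;> simp [cusum]

theorem measurable_cusum (μ₀ : ℝ) (t : ℕ) : Measurable fun x => cusum μ₀ x t := by
  induction t with
  | zero => exact measurable_const
  | succ t ih => unfold cusum; fun_prop

theorem cusum_congr {μ₀ : ℝ} {x y : ℕ → ℝ} {t : ℕ} (h : ∀ i, 1 ≤ i → i ≤ t → x i = y i) :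
    cusum μ₀ x t = cusum μ₀ y t := by
  induction t with
  | zero => rfl
  | succ t ih =>
    rw [cusum, cusum, ih fun i h1 h2 => h i h1 (by omega), h (t + 1) (by omega) le_rfl]

theorem cusum_mono {μ₀ : ℝ} (hμ : 0 ≤ μ₀) {x y : ℕ → ℝ} {t : ℕ}
    (h : ∀ i, 1 ≤ i → i ≤ t → x i ≤ y i) : cusum μ₀ x t ≤ cusum μ₀ y t := by
  induction t with
  | zero => exact le_rfl
  | succ t ih =>
    have h1 := ih fun i h1 h2 => h i h1 (by omega)
    have h2 := mul_le_mul_of_nonneg_left (h (t + 1) (by omega) le_rfl) hμ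
    exact max_le_max (by linarith) le_rfl

theorem walk_le_cusum (μ₀ : ℝ) (x : ℕ → ℝ) (t : ℕ) : walk μ₀ x t ≤ cusum μ₀ x t := by
  induction t with
  | zero => simp [walk, cusum]
  | succ t ih =>
    rw [walk_succ, cusum]
    exact le_max_of_le_left (by linarith)

theorem cusum_splice_of_le {μ₀ : ℝ} {s t : ℕ} (h : t ≤ s) (x y : ℕ → ℝ) :
    cusum μ₀ (splice s x y) t = cusum μ₀ x t :=
  cusum_congr fun _ _ h2 => splice_of_le (h2.trans h) x y

/-- The past enters only through the score at time s carried along by the free walk. Hence the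
restarted score is a lower bound, and the two agree once the carried walk is nonpositive. -/
theorem cusum_splice (μ₀ : ℝ) (s j : ℕ) (x y : ℕ → ℝ) :
    cusum μ₀ (splice s x y) (s + j) = max (cusum μ₀ y j) (cusum μ₀ x s + walk μ₀ y j) := by
  induction j with
  | zero => simp [cusum, walk, cusum_splice_of_le le_rfl, cusum_nonneg]
  | succ j ih =>
    rw [← add_assoc, cusum, ih, walk_succ, cusum, add_assoc s j 1, splice_add (by omega)]
    rw [add_sub_assoc, max_add, max_right_comm, add_sub_assoc, add_assoc]

theorem cusum_le_cusum_splice (μ₀ : ℝ) (s j : ℕ) (x y : ℕ → ℝ) :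
    cusum μ₀ y j ≤ cusum μ₀ (splice s x y) (s + j) := by
  rw [cusum_splice]; exact le_max_left _ _

/-! ### Exponential moments -/

theorem lintegral_exp_mul_gaussian (a c : ℝ) :
    ∫⁻ x, ENNReal.ofReal (Real.exp (a * x + c)) ∂(gaussianReal 0 1) =
      ENNReal.ofReal (Real.exp (a ^ 2 / 2 + c)) := by
  have h := congrFun (mgf_fun_id_gaussianReal (μ := 0) (v := 1)) a
  have hi : Integrable (fun x : ℝ => Real.exp (a * x + c)) (gaussianReal 0 1) := by
    simp_rw [Real.exp_add]
    exact (integrable_exp_mul_gaussianReal a).mul_const _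
  rw [← ofReal_integral_eq_lintegral_ofReal hi (ae_of_all _ fun _ => (Real.exp_pos _).le)]
  simp_rw [Real.exp_add]
  rw [integral_mul_const]
  simp only [mgf] at h
  rw [h]
  simp

theorem lintegral_exp_sum (J : Finset ℕ) (a c : ℝ) :
    ∫⁻ x, ENNReal.ofReal (Real.exp (∑ i ∈ J, (a * x i + c))) ∂noise =
      ENNReal.ofReal (Real.exp (J.card * (a ^ 2 / 2 + c))) := by
  simp_rw [Real.exp_sum, ENNReal.ofReal_prod_of_nonneg fun i _ => (Real.exp_pos _).le]
  rw [lintegral_noise_prod J (f := fun _ x => ENNReal.ofReal (Real.exp (a * x + c)))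
    fun _ => by fun_prop]
  rw [Finset.prod_const, lintegral_exp_mul_gaussian, ← ENNReal.ofReal_pow (Real.exp_pos _).le,
    ← Real.exp_nat_mul]

/-- The factor by which `E exp (θ S_t)` shrinks in one step of the walk `S`. -/
def shrink (μ₀ θ : ℝ) : ℝ := Real.exp (-(θ * (1 - θ) * μ₀ ^ 2 / 2))

theorem shrink_pos (μ₀ θ : ℝ) : 0 < shrink μ₀ θ := Real.exp_pos _

theorem shrink_lt_one {μ₀ θ : ℝ} (hμ : 0 < μ₀) (h0 : 0 < θ) (h1 : θ < 1) : shrink μ₀ θ < 1 := by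
  rw [shrink, Real.exp_lt_one_iff]
  have : 0 < θ * (1 - θ) * μ₀ ^ 2 := by
    have : 0 < 1 - θ := by linarith
    positivity
  linarith

theorem lintegral_exp_walk (μ₀ θ : ℝ) (t : ℕ) :
    ∫⁻ x, ENNReal.ofReal (Real.exp (θ * walk μ₀ x t)) ∂noise =
      ENNReal.ofReal (shrink μ₀ θ ^ t) := by
  have h : ∀ x, θ * walk μ₀ x t =
      ∑ i ∈ Finset.Icc 1 t, (θ * μ₀ * x i + -(θ * μ₀ ^ 2 / 2)) := fun x => by
    rw [walk, Finset.mul_sum]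
    exact Finset.sum_congr rfl fun i _ => by ring
  simp_rw [h]
  rw [lintegral_exp_sum, shrink, ← Real.exp_nat_mul]
  congr 2
  simp
  ring_nf

theorem exp_cusum_splice_le (μ₀ θ : ℝ) (s j : ℕ) (x y : ℕ → ℝ) :
    ENNReal.ofReal (Real.exp (θ * cusum μ₀ (splice s x y) (s + j))) ≤
      ENNReal.ofReal (Real.exp (θ * cusum μ₀ y j)) +
        ENNReal.ofReal (Real.exp (θ * cusum μ₀ x s)) *
          ENNReal.ofReal (Real.exp (θ * walk μ₀ y j)) := by
  rw [← ENNReal.ofReal_mul (Real.exp_pos _).le, ← Real.exp_add, ← mul_add,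
    ← ENNReal.ofReal_add (Real.exp_pos _).le (Real.exp_pos _).le]
  refine ENNReal.ofReal_le_ofReal ?_
  rw [cusum_splice]
  rcases max_choice (cusum μ₀ y j) (cusum μ₀ x s + walk μ₀ y j) with h | h <;> rw [h]
  · linarith [Real.exp_pos (θ * (cusum μ₀ x s + walk μ₀ y j))]
  · linarith [Real.exp_pos (θ * cusum μ₀ y j)]

theorem lintegral_exp_cusum_add_le (μ₀ θ : ℝ) (s j : ℕ) :
    ∫⁻ x, ENNReal.ofReal (Real.exp (θ * cusum μ₀ x (s + j))) ∂noise ≤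
      ∫⁻ x, ENNReal.ofReal (Real.exp (θ * cusum μ₀ x j)) ∂noise +
        (∫⁻ x, ENNReal.ofReal (Real.exp (θ * cusum μ₀ x s)) ∂noise) *
          ENNReal.ofReal (shrink μ₀ θ ^ j) := by
  have hm : ∀ t, Measurable fun x => ENNReal.ofReal (Real.exp (θ * cusum μ₀ x t)) := fun t =>
    ((measurable_cusum μ₀ t).const_mul θ).exp.ennreal_ofReal
  have hw : Measurable fun x => ENNReal.ofReal (Real.exp (θ * walk μ₀ x j)) :=
    ((measurable_walk μ₀ j).const_mul θ).exp.ennreal_ofReal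
  rw [lintegral_splice s (hm (s + j))]
  calc _ ≤ ∫⁻ x, ∫⁻ y, (ENNReal.ofReal (Real.exp (θ * cusum μ₀ y j)) +
        ENNReal.ofReal (Real.exp (θ * cusum μ₀ x s)) *
          ENNReal.ofReal (Real.exp (θ * walk μ₀ y j))) ∂noise ∂noise :=
        lintegral_mono fun x => lintegral_mono fun y => exp_cusum_splice_le μ₀ θ s j x y
    _ = _ := by
        simp_rw [lintegral_add_left (hm j), lintegral_const_mul _ hw, lintegral_exp_walk]
        rw [lintegral_add_left measurable_const, lintegral_mul_const _ (hm s)]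
        simp

/-- With r = `shrink μ₀ θ` the recursion is a_{t+1} ≤ (1 + r) + r a_t. The bound B = 2/(1 - r)
satisfies B = 2 + rB, so it is preserved. -/
theorem lintegral_exp_cusum_le {μ₀ θ : ℝ} (hμ : 0 < μ₀) (h0 : 0 < θ) (h1 : θ < 1) (t : ℕ) :
    ∫⁻ x, ENNReal.ofReal (Real.exp (θ * cusum μ₀ x t)) ∂noise ≤
      ENNReal.ofReal (2 / (1 - shrink μ₀ θ)) := by
  have hr := shrink_lt_one hμ h0 h1
  have hr0 := shrink_pos μ₀ θ
  have hr' : 0 < 1 - shrink μ₀ θ := by linarith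
  induction t with
  | zero =>
    simp only [cusum, mul_zero, Real.exp_zero, ENNReal.ofReal_one, lintegral_const, measure_univ,
      mul_one]
    rw [← ENNReal.ofReal_one]
    refine ENNReal.ofReal_le_ofReal ?_
    rw [le_div_iff₀ hr']
    linarith
  | succ t ih =>
    refine (lintegral_exp_cusum_add_le μ₀ θ t 1).trans ?_
    have h2 : ∫⁻ x, ENNReal.ofReal (Real.exp (θ * cusum μ₀ x 1)) ∂noise ≤
        1 + ENNReal.ofReal (shrink μ₀ θ) := by
      have : ∀ x, ENNReal.ofReal (Real.exp (θ * cusum μ₀ x 1)) ≤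
          1 + ENNReal.ofReal (Real.exp (θ * walk μ₀ x 1)) := fun x => by
        rw [← ENNReal.ofReal_one, ← ENNReal.ofReal_add zero_le_one (Real.exp_pos _).le]
        refine ENNReal.ofReal_le_ofReal ?_
        have : cusum μ₀ x 1 = max (walk μ₀ x 1) 0 := by simp [cusum, walk]
        rw [this]
        rcases max_choice (walk μ₀ x 1) 0 with h | h <;> rw [h]
        · linarith
        · simp [(Real.exp_pos _).le]
      refine (lintegral_mono this).trans ?_
      rw [lintegral_add_left measurable_const, lintegral_exp_walk]
      simp
    refine (add_le_add h2 (mul_le_mul_left ih _)).trans ?_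
    rw [← ENNReal.ofReal_one, ← ENNReal.ofReal_add zero_le_one hr0.le,
      ← ENNReal.ofReal_mul (by positivity), ← ENNReal.ofReal_add (by positivity) (by positivity)]
    refine ENNReal.ofReal_le_ofReal ?_
    have : 2 / (1 - shrink μ₀ θ) = 2 + 2 / (1 - shrink μ₀ θ) * shrink μ₀ θ := by
      field_simp
      ring
    rw [pow_one]
    linarith

/-! ### The limit `ξ` -/

theorem integrable_exp_cusum {μ₀ θ : ℝ} (hμ : 0 < μ₀) (h0 : 0 < θ) (h1 : θ < 1) (t : ℕ) :
    Integrable (fun x => Real.exp (θ * cusum μ₀ x t)) noise := by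
  refine ⟨((measurable_cusum μ₀ t).const_mul θ).exp.aestronglyMeasurable, ?_⟩
  rw [hasFiniteIntegral_iff_ofReal (ae_of_all _ fun _ => (Real.exp_pos _).le)]
  exact (lintegral_exp_cusum_le hμ h0 h1 t).trans_lt ENNReal.ofReal_lt_top

/-- The mean of `exp (R_t / 2)` for the CUSUM score `R_t` of noise. -/
def halfMoment (μ₀ : ℝ) (t : ℕ) : ℝ := ∫ x, Real.exp (cusum μ₀ x t / 2) ∂noise

theorem integrable_exp_half_cusum {μ₀ : ℝ} (hμ : 0 < μ₀) (t : ℕ) :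
    Integrable (fun x => Real.exp (cusum μ₀ x t / 2)) noise := by
  have := integrable_exp_cusum (θ := 1 / 2) hμ (by norm_num) (by norm_num) t
  simpa only [one_div, inv_mul_eq_div] using this

theorem ofReal_halfMoment {μ₀ : ℝ} (hμ : 0 < μ₀) (t : ℕ) :
    ENNReal.ofReal (halfMoment μ₀ t) =
      ∫⁻ x, ENNReal.ofReal (Real.exp (1 / 2 * cusum μ₀ x t)) ∂noise := by
  rw [halfMoment, ofReal_integral_eq_lintegral_ofReal (integrable_exp_half_cusum hμ t)
    (ae_of_all _ fun _ => (Real.exp_pos _).le)]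
  simp only [one_div, inv_mul_eq_div]

theorem one_le_halfMoment {μ₀ : ℝ} (hμ : 0 < μ₀) (t : ℕ) : 1 ≤ halfMoment μ₀ t := by
  have : ∫ _, (1 : ℝ) ∂noise ≤ halfMoment μ₀ t := by
    refine integral_mono (integrable_const _) (integrable_exp_half_cusum hμ t) fun x => ?_
    exact Real.one_le_exp (div_nonneg (cusum_nonneg _ _ _) zero_le_two)
  simpa using this

theorem halfMoment_le {μ₀ : ℝ} (hμ : 0 < μ₀) (t : ℕ) :
    halfMoment μ₀ t ≤ 2 / (1 - shrink μ₀ (1 / 2)) := by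
  have h := lintegral_exp_cusum_le (θ := 1 / 2) hμ (by norm_num) (by norm_num) t
  rw [← ofReal_halfMoment hμ] at h
  have := shrink_lt_one (θ := 1 / 2) hμ (by norm_num) (by norm_num)
  exact (ENNReal.ofReal_le_ofReal_iff (div_nonneg zero_le_two (by linarith))).1 h

/-- Discarding the first observation and restarting at zero gives a smaller score with the law of
the score at the previous time. -/
theorem halfMoment_mono {μ₀ : ℝ} (hμ : 0 < μ₀) : Monotone (halfMoment μ₀) := by
  refine monotone_nat_of_le_succ fun t => ?_
  have hm : ∀ t, Measurable fun x => ENNReal.ofReal (Real.exp (1 / 2 * cusum μ₀ x t)) := fun t =>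
    ((measurable_cusum μ₀ t).const_mul _).exp.ennreal_ofReal
  rw [← ENNReal.ofReal_le_ofReal_iff (by linarith [one_le_halfMoment hμ (t + 1)]),
    ofReal_halfMoment hμ, ofReal_halfMoment hμ, add_comm, lintegral_splice 1 (hm (1 + t))]
  calc _ = ∫⁻ _, ∫⁻ y, ENNReal.ofReal (Real.exp (1 / 2 * cusum μ₀ y t)) ∂noise ∂noise := by simp
    _ ≤ _ := lintegral_mono fun x => lintegral_mono fun y => ENNReal.ofReal_le_ofReal
        (Real.exp_le_exp.2 (mul_le_mul_of_nonneg_left (cusum_le_cusum_splice μ₀ 1 t x y)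
          (by norm_num)))

theorem tendsto_halfMoment {μ₀ : ℝ} (hμ : 0 < μ₀) :
    Tendsto (halfMoment μ₀) atTop (𝓝 (xi μ₀)) := by
  have hb : BddAbove (Set.range (halfMoment μ₀)) :=
    ⟨2 / (1 - shrink μ₀ (1 / 2)), by rintro _ ⟨t, rfl⟩; exact halfMoment_le hμ t⟩
  exact tendsto_nhds_limUnder ⟨_, tendsto_atTop_ciSup (halfMoment_mono hμ) hb⟩

theorem halfMoment_le_xi {μ₀ : ℝ} (hμ : 0 < μ₀) (t : ℕ) : halfMoment μ₀ t ≤ xi μ₀ :=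
  (halfMoment_mono hμ).ge_of_tendsto (tendsto_halfMoment hμ) t

theorem one_le_xi {μ₀ : ℝ} (hμ : 0 < μ₀) : 1 ≤ xi μ₀ :=
  (one_le_halfMoment hμ 0).trans (halfMoment_le_xi hμ 0)

/-- Quantifies the convergence to ξ: split time s + t at s, so that the influence of the past decays
like `shrink`^t, and let s tend to infinity. -/
theorem xi_le {μ₀ : ℝ} (hμ : 0 < μ₀) (t : ℕ) :
    xi μ₀ ≤ halfMoment μ₀ t + 2 / (1 - shrink μ₀ (1 / 2)) * shrink μ₀ (1 / 2) ^ t := by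
  have hr := shrink_lt_one (θ := 1 / 2) hμ (by norm_num) (by norm_num)
  have hr0 := shrink_pos μ₀ (1 / 2)
  have hr' : 0 < 1 - shrink μ₀ (1 / 2) := by linarith
  have h1 := one_le_halfMoment hμ
  refine le_of_tendsto ((tendsto_halfMoment hμ).comp (tendsto_add_atTop_nat t))
    (Eventually.of_forall fun s => ?_)
  have h := lintegral_exp_cusum_add_le μ₀ (1 / 2) s t
  rw [← ofReal_halfMoment hμ, ← ofReal_halfMoment hμ, ← ofReal_halfMoment hμ,
    ← ENNReal.ofReal_mul (by linarith [h1 s]),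
    ← ENNReal.ofReal_add (by linarith [h1 t]) (mul_nonneg (by linarith [h1 s]) (by positivity)),
    ENNReal.ofReal_le_ofReal_iff (add_nonneg (by linarith [h1 t])
      (mul_nonneg (by linarith [h1 s]) (by positivity)))] at h
  have h2 : halfMoment μ₀ s * shrink μ₀ (1 / 2) ^ t ≤
      2 / (1 - shrink μ₀ (1 / 2)) * shrink μ₀ (1 / 2) ^ t :=
    mul_le_mul_of_nonneg_right (halfMoment_le hμ s) (by positivity)
  simp only [Function.comp]
  linarith

/-! ### The law without change -/

theorem law_top (N : ℕ) (μ : ℝ) (p : unitInterval) : law N μ p ⊤ = noises N := by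
  have : (fun ω : Set (Fin N) × (Fin N → ℕ → ℝ) => observe μ ⊤ ω.1 ω.2) = Prod.snd := by
    ext ω n t
    simp [observe]
  rw [law, this]
  exact measurePreserving_snd.map_eq

/-! ### The stopping rule -/

theorem one_add_pos {p₀ lam x : ℝ} (hl : 0 < lam) (h0 : 0 < p₀) (h1 : p₀ ≤ 1) :
    0 < 1 + p₀ * (lam * Real.exp x - 1) := by
  have : 0 < p₀ * (lam * Real.exp x) := by positivity
  linarith

theorem gM_mono {p₀ lam : ℝ} (hl : 0 < lam) (h0 : 0 < p₀) (h1 : p₀ ≤ 1) :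
    Monotone (gM p₀ lam) := by
  intro x y h
  refine Real.log_le_log (one_add_pos hl h0 h1) ?_
  have : Real.exp (x / 2) ≤ Real.exp (y / 2) := Real.exp_le_exp.2 (by linarith)
  gcongr

theorem measurable_gM (p₀ lam : ℝ) : Measurable (gM p₀ lam) := by unfold gM; fun_prop

/-- The sum of the transformed CUSUM scores. -/
def score {N : ℕ} (μ₀ lam p₀ : ℝ) (x : Fin N → ℕ → ℝ) (t : ℕ) : ℝ :=
  ∑ n, gM p₀ lam (cusum μ₀ (x n) t)

variable {N : ℕ} {μ₀ lam p₀ b : ℝ}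

theorem measurable_score (t : ℕ) :
    Measurable fun x : Fin N → ℕ → ℝ => score μ₀ lam p₀ x t :=
  Finset.measurable_sum _ fun n _ => (measurable_gM p₀ lam).comp
    ((measurable_cusum μ₀ t).comp (measurable_pi_apply n))

theorem score_le_score (hl : 0 < lam) (h0 : 0 < p₀) (h1 : p₀ ≤ 1) {x y : Fin N → ℕ → ℝ} {s t : ℕ}
    (h : ∀ n, cusum μ₀ (x n) s ≤ cusum μ₀ (y n) t) : score μ₀ lam p₀ x s ≤ score μ₀ lam p₀ y t :=
  Finset.sum_le_sum fun n _ => gM_mono hl h0 h1 (h n)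

/-- The event that the stopping rule has not stopped by time `s`. -/
def noCross (N : ℕ) (μ₀ lam p₀ b : ℝ) (s : ℕ) : Set (Fin N → ℕ → ℝ) :=
  {x | (s : ℕ∞) < meiTime μ₀ lam p₀ b x}

theorem mem_noCross {s : ℕ} {x : Fin N → ℕ → ℝ} :
    x ∈ noCross N μ₀ lam p₀ b s ↔ ∀ t, 1 ≤ t → t ≤ s → score μ₀ lam p₀ x t < b := by
  rw [noCross, Set.mem_ofPred_eq, ← ENat.add_one_le_iff (ENat.natCast_ne_top s), meiTime]
  simp only [le_iInf_iff]
  constructor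
  · intro h t h1 h2
    by_contra h3
    have := h t ⟨h1, not_lt.1 h3⟩
    norm_cast at this
    omega
  · rintro h t ⟨h1, h2⟩
    by_contra h3
    norm_cast at h3
    exact absurd (h t h1 (by omega)) (not_lt.2 h2)

theorem measurableSet_noCross (s : ℕ) : MeasurableSet (noCross N μ₀ lam p₀ b s) := by
  have : noCross N μ₀ lam p₀ b s =
      ⋂ t, ⋂ (_ : 1 ≤ t), ⋂ (_ : t ≤ s), {x | score μ₀ lam p₀ x t < b} := by
    ext x
    simp [mem_noCross]
  rw [this]
  exact .iInter fun t => .iInter fun _ => .iInter fun _ =>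
    measurableSet_lt (measurable_score t) measurable_const

theorem noCross_mono (hμ : 0 ≤ μ₀) (hl : 0 < lam) (h0 : 0 < p₀) (h1 : p₀ ≤ 1)
    {x y : Fin N → ℕ → ℝ} {s : ℕ} (h : ∀ n i, 1 ≤ i → i ≤ s → x n i ≤ y n i)
    (hy : y ∈ noCross N μ₀ lam p₀ b s) : x ∈ noCross N μ₀ lam p₀ b s := by
  rw [mem_noCross] at hy ⊢
  exact fun t ht hts => (score_le_score hl h0 h1 fun n =>
    cusum_mono hμ fun i hi hit => h n i hi (hit.trans hts)).trans_lt (hy t ht hts)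

theorem noCross_congr {x y : Fin N → ℕ → ℝ} {s : ℕ}
    (h : ∀ n i, 1 ≤ i → i ≤ s → x n i = y n i) :
    x ∈ noCross N μ₀ lam p₀ b s ↔ y ∈ noCross N μ₀ lam p₀ b s := by
  simp only [mem_noCross]
  refine forall_congr' fun t => forall_congr' fun _ => forall_congr' fun hts => ?_
  rw [score, score]
  simp_rw [fun n => cusum_congr (μ₀ := μ₀) (t := t) fun i hi hit => h n i hi (hit.trans hts)]

theorem noCross_antitone : Antitone (noCross N μ₀ lam p₀ b) := fun s t h x hx => by
  rw [mem_noCross] at hx ⊢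
  exact fun i h1 h2 => hx i h1 (h2.trans h)

theorem noCross_of_splice (hl : 0 < lam) (h0 : 0 < p₀) (h1 : p₀ ≤ 1)
    {x y : Fin N → ℕ → ℝ} {s k : ℕ} (h : spliceN s x y ∈ noCross N μ₀ lam p₀ b (s + k)) :
    x ∈ noCross N μ₀ lam p₀ b s ∧ y ∈ noCross N μ₀ lam p₀ b k := by
  refine ⟨(noCross_congr fun n i _ hi => splice_of_le hi _ _).1
    (noCross_antitone (Nat.le_add_right s k) h), ?_⟩
  rw [mem_noCross] at h ⊢
  exact fun t ht htk => (score_le_score hl h0 h1 fun n =>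
    cusum_le_cusum_splice μ₀ s t (x n) (y n)).trans_lt (h (s + t) (by omega) (by omega))

/-! ### Expectations as sums of tail probabilities -/

theorem enat_sub_eq_tsum (n : ℕ∞) (r : ℕ) :
    (n : ℝ≥0∞) - r = ∑' s : ℕ, if ((r + s : ℕ) : ℕ∞) < n then (1 : ℝ≥0∞) else 0 := by
  induction n using ENat.recTopCoe with
  | top => simp
  | coe n =>
    have : ∀ s : ℕ, (if ((r + s : ℕ) : ℕ∞) < (n : ℕ∞) then (1 : ℝ≥0∞) else 0) =
        if s ∈ Finset.range (n - r) then 1 else 0 := fun s => by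
      simp only [Nat.cast_lt, Finset.mem_range]
      congr 1
      exact propext ⟨fun h => by omega, fun h => by omega⟩
    simp_rw [this]
    rw [tsum_eq_sum (s := Finset.range (n - r)) fun s hs => by simp only [hs, if_false],
      Finset.sum_ite_mem]
    simp

theorem lintegral_meiTime_sub (P : Measure (Fin N → ℕ → ℝ)) (r : ℕ) :
    ∫⁻ x, ((meiTime μ₀ lam p₀ b x : ℝ≥0∞) - r) ∂P =
      ∑' s : ℕ, P (noCross N μ₀ lam p₀ b (r + s)) := by
  simp_rw [enat_sub_eq_tsum]
  have : ∀ (s : ℕ) (x : Fin N → ℕ → ℝ),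
      (if ((r + s : ℕ) : ℕ∞) < meiTime μ₀ lam p₀ b x then (1 : ℝ≥0∞) else 0) =
        (noCross N μ₀ lam p₀ b (r + s)).indicator 1 x := fun s x => by
    simp only [Set.indicator, noCross, Set.mem_ofPred_eq, Pi.one_apply]
    congr
  simp_rw [this]
  rw [lintegral_tsum fun s => (measurable_one.indicator (measurableSet_noCross _)).aemeasurable]
  exact tsum_congr fun s => lintegral_indicator_one (measurableSet_noCross _)

theorem ARL_eq_tsum :
    ARL (N := N) (meiTime μ₀ lam p₀ b) = ∑' s : ℕ, noises N (noCross N μ₀ lam p₀ b s) := by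
  have := lintegral_meiTime_sub (μ₀ := μ₀) (lam := lam) (p₀ := p₀) (b := b) (noises N) 0
  simp only [Nat.cast_zero, tsub_zero, zero_add] at this
  rw [ARL, law_top, this]

/-! ### Restarting the scores -/

theorem noises_le_mul (s : ℕ) {A B C : Set (Fin N → ℕ → ℝ)} (hA : MeasurableSet A)
    (h : ∀ x y, spliceN s x y ∈ A → x ∈ B ∧ y ∈ C) : noises N A ≤ noises N B * noises N C := by
  rw [← (measurePreserving_spliceN N s).measure_preimage hA.nullMeasurableSet,
    ← Measure.prod_prod]
  exact measure_mono fun z hz => h z.1 z.2 hz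

theorem law_apply (μ : ℝ) (p : unitInterval) (ν : ℕ∞) {A : Set (Fin N → ℕ → ℝ)}
    (hA : MeasurableSet A) :
    law N μ p ν A = ∫⁻ S, noises N {ε | observe μ ν S ε ∈ A} ∂(setBernoulli Set.univ p) := by
  rw [law, Measure.map_apply (measurable_observe N μ ν) hA, baseLaw,
    Measure.prod_apply (measurable_observe N μ ν hA)]
  rfl

theorem measurable_observe_right (μ : ℝ) (ν : ℕ∞) (S : Set (Fin N)) :
    Measurable fun ε : Fin N → ℕ → ℝ => observe μ ν S ε :=
  (measurable_observe N μ ν).comp measurable_prodMk_left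

theorem le_observe {μ : ℝ} (hμ : 0 ≤ μ) (ν : ℕ∞) (S : Set (Fin N)) (ε : Fin N → ℕ → ℝ) (n : Fin N)
    (t : ℕ) : ε n t ≤ observe μ ν S ε n t := by
  unfold observe
  split_ifs <;> linarith

theorem law_noCross_of_lt (μ : ℝ) (p : unitInterval) {ν s : ℕ} (h : s < ν) :
    law N μ p ν (noCross N μ₀ lam p₀ b s) = noises N (noCross N μ₀ lam p₀ b s) := by
  rw [law_apply _ _ _ (measurableSet_noCross s)]
  have : ∀ S, {ε | observe μ ν S ε ∈ noCross N μ₀ lam p₀ b s} = noCross N μ₀ lam p₀ b s := by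
    intro S
    ext ε
    rw [Set.mem_ofPred_eq]
    refine noCross_congr (x := observe μ ν S ε) (y := ε) fun n i _ hi => ?_
    have : ¬ ν ≤ i := by omega
    simp [observe, this]
  simp_rw [this]
  simp

/-- The positive shift is dropped after time r: lowering the observations and restarting the scores
both make survival easier. Summed over s, this bounds the remaining wait by the ARL without change.
-/
theorem law_noCross_add_le (hμ₀ : 0 ≤ μ₀) (hl : 0 < lam) (h0 : 0 < p₀) (h1 : p₀ ≤ 1) {μ : ℝ}
    (hμ : 0 ≤ μ) (p : unitInterval) (ν r s : ℕ) :
    law N μ p ν (noCross N μ₀ lam p₀ b (r + s)) ≤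
      law N μ p ν (noCross N μ₀ lam p₀ b r) * noises N (noCross N μ₀ lam p₀ b s) := by
  rw [law_apply _ _ _ (measurableSet_noCross _), law_apply _ _ _ (measurableSet_noCross _),
    ← lintegral_mul_const _ .of_discrete]
  refine lintegral_mono fun S => noises_le_mul r
    (measurable_observe_right μ ν S (measurableSet_noCross _)) fun x y h => ⟨?_, ?_⟩
  · rw [Set.mem_ofPred_eq]
    refine (noCross_congr (x := observe μ ν S (spliceN r x y)) (y := observe μ ν S x)
      fun n i _ hi => ?_).1 (noCross_antitone (Nat.le_add_right r s) h)
    simp [observe, spliceN, splice_of_le hi]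
  · refine (noCross_of_splice (x := x) (s := r) hl h0 h1 (noCross_mono hμ₀ hl h0 h1
      (fun n i _ _ => ?_) h)).2
    exact le_observe hμ ν S _ n i

theorem noises_noCross_add_le (hl : 0 < lam) (h0 : 0 < p₀) (h1 : p₀ ≤ 1) (r s : ℕ) :
    noises N (noCross N μ₀ lam p₀ b (r + s)) ≤
      noises N (noCross N μ₀ lam p₀ b r) * noises N (noCross N μ₀ lam p₀ b s) :=
  noises_le_mul r (measurableSet_noCross _) fun _ _ h => noCross_of_splice hl h0 h1 h

/-- The restart at s precedes the change, so the first factor sees pure noise. The restarted process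
has its change at time k, and only its last time j is retained. -/
theorem law_noCross_le_before (hl : 0 < lam) (h0 : 0 < p₀) (h1 : p₀ ≤ 1) (μ : ℝ)
    (p : unitInterval) {ν s k j : ℕ} (hν : s + k = ν) (hk : 1 ≤ k) (hj : 1 ≤ j) :
    law N μ p ν (noCross N μ₀ lam p₀ b (s + j)) ≤
      noises N (noCross N μ₀ lam p₀ b s) * law N μ p k {x | score μ₀ lam p₀ x j < b} := by
  have hm : MeasurableSet {x : Fin N → ℕ → ℝ | score μ₀ lam p₀ x j < b} :=
    measurableSet_lt (measurable_score j) measurable_const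
  rw [law_apply _ _ _ (measurableSet_noCross _), law_apply _ _ _ hm,
    ← lintegral_const_mul _ .of_discrete]
  refine lintegral_mono fun S => noises_le_mul s
    (measurable_observe_right μ ν S (measurableSet_noCross _)) fun x y h => ?_
  have h2 : spliceN s x (observe μ k S y) ∈ noCross N μ₀ lam p₀ b (s + j) := by
    refine (noCross_congr (x := observe μ ν S (spliceN s x y)) fun n i _ hi => ?_).1 h
    by_cases his : i ≤ s
    · have : ¬ ν ≤ i := by omega
      simp [observe, spliceN, splice_of_le his, this]
    · have h3 : ν ≤ i ↔ k ≤ i - s := by omega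
      have h4 : ((ν : ℕ∞) ≤ (i : ℕ∞)) ↔ ((k : ℕ∞) ≤ ((i - s : ℕ) : ℕ∞)) := by
        rw [Nat.cast_le, Nat.cast_le, h3]
      simp only [observe, spliceN, splice, his, if_false]
      congr 1
      classical exact if_congr (and_congr_left' h4) rfl rfl
  obtain ⟨h3, h4⟩ := noCross_of_splice hl h0 h1 h2
  exact ⟨h3, mem_noCross.1 h4 j hj le_rfl⟩

/-- Submultiplicativity gives γ = ∑ h(s) ≤ k + h(k)γ, which is the claim after rearrangement. -/
theorem noises_crossed_le (hl : 0 < lam) (h0 : 0 < p₀) (h1 : p₀ ≤ 1)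
    {γ : ℝ} (hγ : 1 ≤ γ) (hARL : ARL (N := N) (meiTime μ₀ lam p₀ b) = ENNReal.ofReal γ) (k : ℕ) :
    noises N (noCross N μ₀ lam p₀ b k)ᶜ ≤ ENNReal.ofReal (k / γ) := by
  set P := noises N (noCross N μ₀ lam p₀ b k) with hP
  have h : ENNReal.ofReal γ ≤ k + P * ENNReal.ofReal γ := by
    rw [← hARL, ARL_eq_tsum]
    refine (Summable.sum_add_tsum_nat_add' (k := k)
      (f := fun s => noises N (noCross N μ₀ lam p₀ b s)) ENNReal.summable).symm.le.trans ?_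
    refine add_le_add ?_ ?_
    · refine (Finset.sum_le_sum fun i _ => prob_le_one).trans ?_
      simp
    · rw [← ENNReal.tsum_mul_left]
      exact ENNReal.tsum_le_tsum fun s => by
        rw [add_comm]; exact noises_noCross_add_le hl h0 h1 k s
  have hPt : P ≠ ⊤ := measure_ne_top _ _
  rw [prob_compl_eq_one_sub (measurableSet_noCross k), ← hP, ← ENNReal.ofReal_toReal hPt,
    ← ENNReal.ofReal_one, ← ENNReal.ofReal_sub _ ENNReal.toReal_nonneg]
  refine ENNReal.ofReal_le_ofReal ?_
  rw [← ENNReal.ofReal_toReal hPt, ← ENNReal.ofReal_mul ENNReal.toReal_nonneg,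
    ← ENNReal.ofReal_natCast k, ← ENNReal.ofReal_add (by positivity) (by positivity),
    ENNReal.ofReal_le_ofReal_iff (by positivity)] at h
  rw [le_div_iff₀ (by linarith)]
  linarith

/-! ### The threshold -/

/-- Markov's inequality for the exponential of the score. The logarithm in g_M makes this
exponential a product of independent factors, each affine in exp(R_t/2), and the half moment is at
most ξ. -/
theorem noises_score_ge_le (hμ : 0 < μ₀) (hl : 0 < lam) (h0 : 0 < p₀) (h1 : p₀ ≤ 1) (t : ℕ) :
    noises N {x | b ≤ score μ₀ lam p₀ x t} ≤
      ENNReal.ofReal (Real.exp (N * Real.log (1 + p₀ * (lam * xi μ₀ - 1)) - b)) := by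
  have hpos : ∀ y : ℝ, 1 ≤ y → 0 < 1 + p₀ * (lam * y - 1) := fun y hy => by
    have : 0 < p₀ * (lam * y) := by positivity
    linarith
  have hf : Measurable fun x : ℕ → ℝ =>
      ENNReal.ofReal (1 + p₀ * (lam * Real.exp (cusum μ₀ x t / 2) - 1)) := by
    have := measurable_cusum μ₀ t
    fun_prop
  have hE : ∫⁻ x, ENNReal.ofReal (1 + p₀ * (lam * Real.exp (cusum μ₀ x t / 2) - 1)) ∂noise =
      ENNReal.ofReal (1 + p₀ * (lam * halfMoment μ₀ t - 1)) := by
    have hi := integrable_exp_half_cusum hμ t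
    have hi' : Integrable (fun x => 1 + p₀ * (lam * Real.exp (cusum μ₀ x t / 2) - 1)) noise :=
      (integrable_const 1).add (((hi.const_mul lam).sub (integrable_const 1)).const_mul p₀)
    rw [← ofReal_integral_eq_lintegral_ofReal hi' (ae_of_all _ fun x => (one_add_pos hl h0 h1).le)]
    have h2 : ∀ x, 1 + p₀ * (lam * Real.exp (cusum μ₀ x t / 2) - 1) =
        (1 - p₀) + p₀ * lam * Real.exp (cusum μ₀ x t / 2) := fun x => by ring
    simp_rw [h2]
    rw [integral_add (integrable_const _) (hi.const_mul _), integral_const_mul, ← halfMoment]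
    simp
    ring_nf
  calc noises N {x | b ≤ score μ₀ lam p₀ x t}
      ≤ ∫⁻ x, ENNReal.ofReal (Real.exp (-b)) *
          ∏ n, ENNReal.ofReal (1 + p₀ * (lam * Real.exp (cusum μ₀ (x n) t / 2) - 1))
            ∂(noises N) := by
        rw [← lintegral_indicator_one (measurableSet_le measurable_const (measurable_score t))]
        refine lintegral_mono fun x => ?_
        by_cases hx : b ≤ score μ₀ lam p₀ x t
        · rw [Set.indicator_of_mem (by exact hx), Pi.one_apply,
            ← ENNReal.ofReal_prod_of_nonneg fun n _ => (one_add_pos hl h0 h1).le,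
            ← ENNReal.ofReal_mul (Real.exp_pos _).le, ← ENNReal.ofReal_one]
          refine ENNReal.ofReal_le_ofReal ?_
          have : ∏ n, (1 + p₀ * (lam * Real.exp (cusum μ₀ (x n) t / 2) - 1)) =
              Real.exp (score μ₀ lam p₀ x t) := by
            rw [score, Real.exp_sum]
            exact Finset.prod_congr rfl fun n _ => (Real.exp_log (one_add_pos hl h0 h1)).symm
          rw [this, ← Real.exp_add]
          exact Real.one_le_exp (by linarith)
        · rw [Set.indicator_of_notMem (by exact hx)]
          exact zero_le
    _ = ENNReal.ofReal (Real.exp (-b)) *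
          ENNReal.ofReal (1 + p₀ * (lam * halfMoment μ₀ t - 1)) ^ N := by
        have hm : Measurable fun x : Fin N → ℕ → ℝ =>
            ∏ n, ENNReal.ofReal (1 + p₀ * (lam * Real.exp (cusum μ₀ (x n) t / 2) - 1)) :=
          Finset.measurable_prod _ fun n _ => hf.comp (measurable_pi_apply n)
        rw [lintegral_const_mul _ hm, lintegral_noises_prod fun _ => hf, hE]
        simp
    _ ≤ _ := by
        rw [← ENNReal.ofReal_pow (hpos _ (one_le_halfMoment hμ t)).le,
          ← ENNReal.ofReal_mul (Real.exp_pos _).le]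
        refine ENNReal.ofReal_le_ofReal ?_
        rw [sub_eq_add_neg _ b, add_comm _ (-b), Real.exp_add]
        refine mul_le_mul_of_nonneg_left ?_ (Real.exp_pos _).le
        rw [Real.exp_nat_mul, Real.exp_log (hpos _ (one_le_xi hμ))]
        have := halfMoment_le_xi hμ t
        exact pow_le_pow_left₀ (hpos _ (one_le_halfMoment hμ t)).le (by gcongr) _

theorem threshold_le (hμ : 0 < μ₀) (hl : 0 < lam) (h0 : 0 < p₀) (h1 : p₀ ≤ 1) {γ : ℝ}
    (hARL : ARL (N := N) (meiTime μ₀ lam p₀ b) = ENNReal.ofReal γ) :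
    b ≤ N * Real.log (1 + p₀ * (lam * xi μ₀ - 1)) + Real.log (4 * γ) := by
  set q := Real.exp (N * Real.log (1 + p₀ * (lam * xi μ₀ - 1)) - b) with hq
  have hq0 : 0 < q := Real.exp_pos _
  have hu : ∀ s : ℕ, noises N (noCross N μ₀ lam p₀ b s)ᶜ ≤ ENNReal.ofReal (s * q) := fun s => by
    have hsub : (noCross N μ₀ lam p₀ b s)ᶜ ⊆
        ⋃ t ∈ Finset.Icc 1 s, {x | b ≤ score μ₀ lam p₀ x t} := fun x hx => by
      simp only [Set.mem_compl_iff, mem_noCross, not_forall, not_lt] at hx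
      obtain ⟨t, ht1, ht2, ht⟩ := hx
      simp only [Set.mem_iUnion, Finset.mem_Icc]
      exact ⟨t, ⟨ht1, ht2⟩, ht⟩
    refine (measure_mono hsub).trans ((measure_biUnion_finset_le _ _).trans
      ((Finset.sum_le_sum fun t _ => noises_score_ge_le hμ hl h0 h1 t).trans ?_))
    rw [Finset.sum_const, Nat.card_Icc, nsmul_eq_mul, ENNReal.ofReal_mul (by positivity),
      ENNReal.ofReal_natCast]
    simp [hq]
  -- The union bound keeps survival at least 1/2 for s ≤ 1/(2q). Counting s = 0 gives more than
  -- 1/(2q) such times, so γ > 1/(4q); this is the source of the 4.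
  set M := ⌊1 / (2 * q)⌋₊ + 1 with hM
  have hhalf : ∀ s ∈ Finset.range M, ENNReal.ofReal (1 / 2) ≤ noises N (noCross N μ₀ lam p₀ b s) := by
    intro s hs
    have hs' : (s : ℝ) ≤ 1 / (2 * q) := by
      refine (Nat.le_floor_iff (by positivity)).1 ?_
      have := Finset.mem_range.1 hs
      omega
    have h2 : (s : ℝ) * q ≤ 1 / 2 := by
      rw [le_div_iff₀ (by positivity)] at hs'
      linarith
    have h3 := (hu s).trans (ENNReal.ofReal_le_ofReal h2)
    rw [prob_compl_eq_one_sub (measurableSet_noCross s), tsub_le_iff_left] at h3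
    have h4 : (1 : ℝ≥0∞) = ENNReal.ofReal (1 / 2) + ENNReal.ofReal (1 / 2) := by
      rw [← ENNReal.ofReal_add (by norm_num) (by norm_num)]
      norm_num
    rw [h4] at h3
    exact (ENNReal.add_le_add_iff_right ENNReal.ofReal_ne_top).1 h3
  have hγ : ENNReal.ofReal (M * (1 / 2)) ≤ ENNReal.ofReal γ := by
    rw [← hARL, ARL_eq_tsum]
    refine le_trans ?_ (ENNReal.sum_le_tsum (Finset.range M))
    refine le_trans ?_ (Finset.sum_le_sum hhalf)
    rw [Finset.sum_const, Finset.card_range, nsmul_eq_mul, ENNReal.ofReal_mul (by positivity),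
      ENNReal.ofReal_natCast]
  have hMpos : (0 : ℝ) < M * (1 / 2) := by rw [hM]; positivity
  have hγpos : 0 < γ := ENNReal.ofReal_pos.1 ((ENNReal.ofReal_pos.2 hMpos).trans_le hγ)
  have hγ' := (ENNReal.ofReal_le_ofReal_iff hγpos.le).1 hγ
  have hM' : 1 / (2 * q) < M := by rw [hM]; push_cast; exact Nat.lt_floor_add_one _
  have h5 : 1 / q ≤ 4 * γ := by
    have : 1 / q = 2 * (1 / (2 * q)) := by field_simp
    linarith
  have h6 := Real.log_le_log (by positivity) h5
  rw [one_div, Real.log_inv, hq, Real.log_exp] at h6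
  linarith

/-! ### Positive association -/

/-- A measure is associated if any two decreasing functions are positively correlated. -/
def Associated {α : Type*} [Preorder α] [MeasurableSpace α] (P : Measure α) : Prop :=
  ∀ f g : α → ℝ≥0∞, Antitone f → Antitone g → Measurable f → Measurable g →
    (∫⁻ x, f x ∂P) * ∫⁻ x, g x ∂P ≤ ∫⁻ x, f x * g x ∂P

theorem ennreal_rearrangement {a b c d : ℝ≥0∞} (hab : a ≤ b) (hcd : c ≤ d) :
    b * c + a * d ≤ b * d + a * c := by
  obtain ⟨e, rfl⟩ := exists_add_of_le hab
  obtain ⟨f, rfl⟩ := exists_add_of_le hcd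
  calc _ ≤ (a + e) * c + a * (c + f) + e * f := le_self_add
    _ = _ := by ring

/-- Chebyshev's inequality: on a linear order (f x - f y)(g x - g y) ≥ 0, integrated over an
independent pair. The rearranged form avoids subtraction in `ℝ≥0∞`. -/
theorem associated_of_linearOrder {α : Type*} [LinearOrder α] [MeasurableSpace α] (P : Measure α)
    [IsProbabilityMeasure P] : Associated P := by
  intro f g hf hg mf mg
  have h : ∫⁻ x, ∫⁻ y, (f x * g y + f y * g x) ∂P ∂P ≤
      ∫⁻ x, ∫⁻ y, (f x * g x + f y * g y) ∂P ∂P := by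
    refine lintegral_mono fun x => lintegral_mono fun y => ?_
    rcases le_total x y with h | h
    · exact ennreal_rearrangement (hf h) (hg h)
    · rw [add_comm (f x * g y), add_comm (f x * g x)]
      exact ennreal_rearrangement (hf h) (hg h)
  have e1 : ∀ x, ∫⁻ y, (f x * g y + f y * g x) ∂P =
      f x * ∫⁻ y, g y ∂P + (∫⁻ y, f y ∂P) * g x := fun x => by
    rw [lintegral_add_left (mg.const_mul _), lintegral_const_mul _ mg, lintegral_mul_const _ mf]
  have e2 : ∀ x, ∫⁻ y, (f x * g x + f y * g y) ∂P = f x * g x + ∫⁻ y, f y * g y ∂P := fun x => by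
    rw [lintegral_add_left measurable_const]
    simp
  simp_rw [e1, e2] at h
  have mfg : Measurable fun x => f x * g x := mf.mul mg
  rw [lintegral_add_left (mf.mul_const _), lintegral_add_left mfg,
    lintegral_mul_const _ mf, lintegral_const_mul _ mg] at h
  simp only [lintegral_const, measure_univ, mul_one, ← two_mul] at h
  exact (ENNReal.mul_le_mul_iff_right two_ne_zero ENNReal.ofNat_ne_top).1 h

theorem Associated.map {α β : Type*} [Preorder α] [MeasurableSpace α] [Preorder β]
    [MeasurableSpace β] {P : Measure α} (h : Associated P) {φ : α → β} (hφ : Monotone φ)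
    (mφ : Measurable φ) : Associated (P.map φ) := by
  intro f g hf hg mf mg
  have mfg : Measurable fun x => f x * g x := mf.mul mg
  rw [lintegral_map mf mφ, lintegral_map mg mφ, lintegral_map mfg mφ]
  exact h _ _ (hf.comp_monotone hφ) (hg.comp_monotone hφ) (mf.comp mφ) (mg.comp mφ)

theorem Associated.prod {α β : Type*} [Preorder α] [MeasurableSpace α] [Preorder β]
    [MeasurableSpace β] {P : Measure α} {Q : Measure β} [SFinite P] [SFinite Q]
    (hP : Associated P) (hQ : Associated Q) : Associated (P.prod Q) := by
  intro f g hf hg mf mg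
  have mfg : Measurable fun x => f x * g x := mf.mul mg
  rw [lintegral_prod _ mf.aemeasurable, lintegral_prod _ mg.aemeasurable,
    lintegral_prod _ mfg.aemeasurable]
  refine (hP (fun x => ∫⁻ y, f (x, y) ∂Q) (fun x => ∫⁻ y, g (x, y) ∂Q)
    (fun x y h => lintegral_mono fun z => hf (Prod.mk_le_mk.2 ⟨h, le_rfl⟩))
    (fun x y h => lintegral_mono fun z => hg (Prod.mk_le_mk.2 ⟨h, le_rfl⟩)) mf.lintegral_prod_right'
    mg.lintegral_prod_right').trans (lintegral_mono fun x => ?_)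
  exact hQ _ _ (fun y z h => hf ⟨le_rfl, h⟩) (fun y z h => hg ⟨le_rfl, h⟩)
    (mf.comp measurable_prodMk_left) (mg.comp measurable_prodMk_left)

theorem Associated.pi {α : Type*} [Preorder α] [MeasurableSpace α] {P : Measure α}
    [IsProbabilityMeasure P] (h : Associated P) (n : ℕ) :
    Associated (Measure.pi fun _ : Fin n => P) := by
  induction n with
  | zero =>
    intro f g _ _ _ _
    rw [Measure.pi_of_empty]
    simp
  | succ n ih =>
    have hp := (measurePreserving_piFinSuccAbove (fun _ : Fin (n + 1) => P) 0).symm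
    rw [← hp.map_eq]
    refine (h.prod ih).map ?_ hp.measurable
    intro x y hxy
    have h0 : ∀ z : α × (Fin n → α),
        (MeasurableEquiv.piFinSuccAbove (fun _ : Fin (n + 1) => α) 0).symm z =
          Fin.cons z.1 z.2 := fun z => by
      simp [MeasurableEquiv.piFinSuccAbove, Fin.insertNthEquiv]
    rw [h0, h0]
    intro i
    refine Fin.cases ?_ (fun i => ?_) i
    · exact hxy.1
    · exact hxy.2 i

/-- Set a stream to zero after time `s`. -/
def truncate (s : ℕ) (x : ℕ → ℝ) : ℕ → ℝ := fun t => if t < s + 1 then x t else 0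

theorem measurable_truncate (s : ℕ) : Measurable (truncate s) := by
  refine measurable_pi_lambda _ fun t => ?_
  unfold truncate
  split_ifs <;> fun_prop

/-- Reduces to a finite product of `s + 1` Gaussian coordinates, the unused time 0 among them;
padding with zeros is a monotone map. -/
theorem associated_noise_truncate (s : ℕ) : Associated (noise.map (truncate s)) := by
  have h1 : noise.map (fun x (i : Fin (s + 1)) => x i) =
      Measure.pi fun _ : Fin (s + 1) => gaussianReal 0 1 := by
    have := (iIndepFun_noise.precomp (g := fun i : Fin (s + 1) => (i : ℕ))
      Fin.val_injective).map_fun_eq_pi_map fun i => (measurable_pi_apply _).aemeasurable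
    refine this.trans ?_
    congr 1
    ext1 i
    exact (measurePreserving_eval_infinitePi (fun _ : ℕ => gaussianReal 0 1) i).map_eq
  have h2 : truncate s = (fun (z : Fin (s + 1) → ℝ) t => if h : t < s + 1 then z ⟨t, h⟩ else 0) ∘
      fun x (i : Fin (s + 1)) => x i := by
    ext x t
    simp [truncate]
  have hm : Measurable fun (z : Fin (s + 1) → ℝ) (t : ℕ) =>
      if h : t < s + 1 then z ⟨t, h⟩ else 0 := by
    refine measurable_pi_lambda _ fun t => ?_
    split_ifs <;> fun_prop
  rw [h2, ← Measure.map_map hm (by fun_prop), h1]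
  refine ((associated_of_linearOrder (gaussianReal 0 1)).pi (s + 1)).map ?_ hm
  intro x y h t
  dsimp only
  split_ifs
  · exact h _
  · exact le_rfl

/-- Harris' inequality for decreasing events. -/
theorem noises_mul_le_inter {N : ℕ} (s : ℕ) {A B : Set (Fin N → ℕ → ℝ)}
    (mA : MeasurableSet A) (mB : MeasurableSet B)
    (hA : ∀ x y : Fin N → ℕ → ℝ, (∀ n, ∀ i ≤ s, x n i ≤ y n i) → y ∈ A → x ∈ A)
    (hB : ∀ x y : Fin N → ℕ → ℝ, (∀ n, ∀ i ≤ s, x n i ≤ y n i) → y ∈ B → x ∈ B) :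
    noises N A * noises N B ≤ noises N (A ∩ B) := by
  have mt := measurable_truncate s
  have : IsProbabilityMeasure (noise.map (truncate s)) :=
    Measure.isProbabilityMeasure_map mt.aemeasurable
  have mT : Measurable fun (x : Fin N → ℕ → ℝ) n => truncate s (x n) :=
    measurable_pi_lambda _ fun n => mt.comp (measurable_pi_apply n)
  have h1 : (noises N).map (fun x n => truncate s (x n)) =
      Measure.pi fun _ : Fin N => noise.map (truncate s) :=
    Measure.pi_map_pi fun _ => mt.aemeasurable
  have h2 : Associated ((noises N).map fun x n => truncate s (x n)) :=
    h1 ▸ (associated_noise_truncate s).pi N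
  have h3 : ∀ C : Set (Fin N → ℕ → ℝ), MeasurableSet C →
      (∀ x y : Fin N → ℕ → ℝ, (∀ n, ∀ i ≤ s, x n i ≤ y n i) → y ∈ C → x ∈ C) →
      (noises N).map (fun x n => truncate s (x n)) C = noises N C := by
    intro C mC hC
    rw [Measure.map_apply mT mC]
    congr 1
    ext x
    exact ⟨hC _ _ fun n i hi => by simp [truncate, Nat.lt_succ_iff.2 hi],
      hC _ _ fun n i hi => by simp [truncate, Nat.lt_succ_iff.2 hi]⟩
  have h4 : ∀ C : Set (Fin N → ℕ → ℝ),
      (∀ x y : Fin N → ℕ → ℝ, (∀ n, ∀ i ≤ s, x n i ≤ y n i) → y ∈ C → x ∈ C) →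
      Antitone (C.indicator (1 : (Fin N → ℕ → ℝ) → ℝ≥0∞)) := by
    intro C hC x y hxy
    by_cases hy : y ∈ C
    · simp [hy, hC x y (fun n i _ => hxy n i) hy]
    · simp [hy]
  have h5 := h2 _ _ (h4 A hA) (h4 B hB) (measurable_one.indicator mA) (measurable_one.indicator mB)
  have h6 : ∀ x, A.indicator (1 : (Fin N → ℕ → ℝ) → ℝ≥0∞) x * B.indicator 1 x =
      (A ∩ B).indicator 1 x := fun x => by
    rw [Set.inter_indicator_one]; rfl
  simp_rw [h6] at h5
  rw [lintegral_indicator_one mA, lintegral_indicator_one mB, lintegral_indicator_one (mA.inter mB),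
    h3 A mA hA, h3 B mB hB,
    h3 _ (mA.inter mB) fun x y h hy => ⟨hA x y h hy.1, hB x y h hy.2⟩] at h5
  exact h5

/-! ### The hazard rate of the stopping rule -/

/-- Couple with the scores restarted at s. The two statistics agree unless some stream still carries
its past, i.e. its score at s plus the later walk is nonnegative. Markov's inequality at θ = 1/2 and
a union over the streams bound that event. -/
theorem noises_score_ge_le_add (hμ : 0 < μ₀) (s j : ℕ) :
    noises N {x | b ≤ score μ₀ lam p₀ x (s + j)} ≤
      noises N {x | b ≤ score μ₀ lam p₀ x j} +
        ENNReal.ofReal (N * (2 / (1 - shrink μ₀ (1 / 2)) * shrink μ₀ (1 / 2) ^ j)) := by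
  have hC : 0 ≤ 2 / (1 - shrink μ₀ (1 / 2)) := by
    have := shrink_lt_one (θ := 1 / 2) hμ (by norm_num) (by norm_num)
    exact div_nonneg zero_le_two (by linarith)
  have hms : ∀ t, MeasurableSet {x : Fin N → ℕ → ℝ | b ≤ score μ₀ lam p₀ x t} := fun t =>
    measurableSet_le measurable_const (measurable_score t)
  have hsub : (fun z : (Fin N → ℕ → ℝ) × (Fin N → ℕ → ℝ) => spliceN s z.1 z.2) ⁻¹'
      {x | b ≤ score μ₀ lam p₀ x (s + j)} ⊆
      Prod.snd ⁻¹' {x | b ≤ score μ₀ lam p₀ x j} ∪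
        ⋃ n, {z | 0 ≤ cusum μ₀ (z.1 n) s + walk μ₀ (z.2 n) j} := by
    rintro ⟨x, y⟩ h
    by_cases hn : ∃ n, 0 ≤ cusum μ₀ (x n) s + walk μ₀ (y n) j
    · exact Or.inr (Set.mem_iUnion.2 hn)
    · refine Or.inl ?_
      push Not at hn
      have : score μ₀ lam p₀ (spliceN s x y) (s + j) = score μ₀ lam p₀ y j := by
        refine Finset.sum_congr rfl fun n _ => ?_
        rw [spliceN, cusum_splice, max_eq_left ((hn n).le.trans (cusum_nonneg _ _ _))]
      rw [Set.mem_preimage, Set.mem_ofPred_eq, this] at h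
      exact h
  rw [← (measurePreserving_spliceN N s).measure_preimage (hms _).nullMeasurableSet]
  refine (measure_mono hsub).trans ((measure_union_le _ _).trans (add_le_add ?_ ?_))
  · rw [measurePreserving_snd.measure_preimage (hms j).nullMeasurableSet]
  · refine (measure_iUnion_fintype_le _ _).trans ?_
    have h1 : ∀ n : Fin N, ((noises N).prod (noises N))
        {z | 0 ≤ cusum μ₀ (z.1 n) s + walk μ₀ (z.2 n) j} ≤
          ENNReal.ofReal (2 / (1 - shrink μ₀ (1 / 2)) * shrink μ₀ (1 / 2) ^ j) := by
      intro n
      have m1 : Measurable fun x : ℕ → ℝ => ENNReal.ofReal (Real.exp (1 / 2 * cusum μ₀ x s)) :=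
        ((measurable_cusum μ₀ s).const_mul _).exp.ennreal_ofReal
      have m2 : Measurable fun x : ℕ → ℝ => ENNReal.ofReal (Real.exp (1 / 2 * walk μ₀ x j)) :=
        ((measurable_walk μ₀ j).const_mul _).exp.ennreal_ofReal
      have m3 : Measurable fun z : (Fin N → ℕ → ℝ) × (Fin N → ℕ → ℝ) =>
          cusum μ₀ (z.1 n) s + walk μ₀ (z.2 n) j :=
        ((measurable_cusum μ₀ s).comp ((measurable_pi_apply n).comp measurable_fst)).add
          ((measurable_walk μ₀ j).comp ((measurable_pi_apply n).comp measurable_snd))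
      rw [← lintegral_indicator_one (measurableSet_le measurable_const m3)]
      calc _ ≤ ∫⁻ z : (Fin N → ℕ → ℝ) × (Fin N → ℕ → ℝ),
            ENNReal.ofReal (Real.exp (1 / 2 * cusum μ₀ (z.1 n) s)) *
              ENNReal.ofReal (Real.exp (1 / 2 * walk μ₀ (z.2 n) j))
                ∂((noises N).prod (noises N)) := by
            refine lintegral_mono fun z => ?_
            by_cases hz : 0 ≤ cusum μ₀ (z.1 n) s + walk μ₀ (z.2 n) j
            · rw [Set.indicator_of_mem (by exact hz), Pi.one_apply,
                ← ENNReal.ofReal_mul (Real.exp_pos _).le, ← Real.exp_add, ← ENNReal.ofReal_one]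
              exact ENNReal.ofReal_le_ofReal (Real.one_le_exp (by linarith))
            · rw [Set.indicator_of_notMem (by exact hz)]
              exact zero_le
        _ = (∫⁻ x, ENNReal.ofReal (Real.exp (1 / 2 * cusum μ₀ x s)) ∂noise) *
              ∫⁻ x, ENNReal.ofReal (Real.exp (1 / 2 * walk μ₀ x j)) ∂noise := by
            rw [← lintegral_noises_eval n m1, ← lintegral_noises_eval n m2]
            have mn := measurable_pi_apply (X := fun _ : Fin N => ℕ → ℝ) n
            exact lintegral_prod_mul (m1.comp mn).aemeasurable (m2.comp mn).aemeasurable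
        _ ≤ _ := by
            rw [lintegral_exp_walk, ENNReal.ofReal_mul hC]
            gcongr
            exact lintegral_exp_cusum_le hμ (by norm_num) (by norm_num) s
    refine (Finset.sum_le_sum fun n _ => h1 n).trans ?_
    rw [ENNReal.ofReal_mul (Nat.cast_nonneg N)]
    simp

/-- A bound uniform in t. Up to L, crossing at t is part of crossing by L, of probability at most
L/γ. Beyond L, restart the scores L steps before t. -/
theorem noises_score_ge_le_of_ARL (hμ : 0 < μ₀) (hl : 0 < lam) (h0 : 0 < p₀) (h1 : p₀ ≤ 1)
    {γ : ℝ} (hγ : 1 ≤ γ) (hARL : ARL (N := N) (meiTime μ₀ lam p₀ b) = ENNReal.ofReal γ)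
    {t : ℕ} (ht : 1 ≤ t) {L : ℕ} (hL : 1 ≤ L) :
    noises N {x | b ≤ score μ₀ lam p₀ x t} ≤
      ENNReal.ofReal (L / γ + N * (2 / (1 - shrink μ₀ (1 / 2)) * shrink μ₀ (1 / 2) ^ L)) := by
  have hC : 0 ≤ 2 / (1 - shrink μ₀ (1 / 2)) := by
    have := shrink_lt_one (θ := 1 / 2) hμ (by norm_num) (by norm_num)
    exact div_nonneg zero_le_two (by linarith)
  have hr := shrink_pos μ₀ (1 / 2)
  have h2 : ∀ j, 1 ≤ j → j ≤ L →
      noises N {x | b ≤ score μ₀ lam p₀ x j} ≤ ENNReal.ofReal (L / γ) := by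
    intro j hj hjL
    refine (measure_mono fun x hx hc => ?_).trans (noises_crossed_le hl h0 h1 hγ hARL L)
    exact absurd (mem_noCross.1 hc j hj hjL) (not_lt.2 hx)
  rcases le_total t L with h | h
  · refine (h2 t ht h).trans (ENNReal.ofReal_le_ofReal ?_)
    have : 0 ≤ N * (2 / (1 - shrink μ₀ (1 / 2)) * shrink μ₀ (1 / 2) ^ L) := by positivity
    linarith
  · obtain ⟨s, rfl⟩ := Nat.exists_eq_add_of_le' h
    refine (noises_score_ge_le_add hμ s L).trans ?_
    rw [ENNReal.ofReal_add (by positivity) (by positivity)]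
    gcongr
    exact h2 L hL le_rfl

/-- Surviving to s and staying below b during the next k steps are both decreasing events in the
observations, hence positively correlated. By the union bound and `hk` the second has probability at
least 1/2. -/
theorem noises_noCross_le_two_mul (hμ : 0 < μ₀) (hl : 0 < lam) (h0 : 0 < p₀) (h1 : p₀ ≤ 1)
    {γ : ℝ} (hγ : 1 ≤ γ) (hARL : ARL (N := N) (meiTime μ₀ lam p₀ b) = ENNReal.ofReal γ)
    {k L : ℕ} (hL : 1 ≤ L)
    (hk : k * (L / γ + N * (2 / (1 - shrink μ₀ (1 / 2)) * shrink μ₀ (1 / 2) ^ L)) ≤ 1 / 2) (s : ℕ) :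
    noises N (noCross N μ₀ lam p₀ b s) ≤ 2 * noises N (noCross N μ₀ lam p₀ b (s + k)) := by
  set B : Set (Fin N → ℕ → ℝ) :=
    ⋂ t ∈ Finset.Ioc s (s + k), {x | score μ₀ lam p₀ x t < b} with hBdef
  have mB : MeasurableSet B := Finset.measurableSet_biInter _ fun t _ =>
    measurableSet_lt (measurable_score t) measurable_const
  have hBc : noises N Bᶜ ≤ ENNReal.ofReal (1 / 2) := by
    have hsub : Bᶜ ⊆ ⋃ t ∈ Finset.Ioc s (s + k), {x | b ≤ score μ₀ lam p₀ x t} := by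
      intro x hx
      simp only [hBdef, Set.mem_compl_iff, Set.mem_iInter, not_forall, Set.mem_ofPred_eq,
        not_lt] at hx
      obtain ⟨t, ht, hx⟩ := hx
      simp only [Set.mem_iUnion]
      exact ⟨t, ht, hx⟩
    refine (measure_mono hsub).trans ((measure_biUnion_finset_le _ _).trans
      ((Finset.sum_le_sum fun t ht => noises_score_ge_le_of_ARL hμ hl h0 h1 hγ hARL
        (by have := (Finset.mem_Ioc.1 ht).1; omega) hL).trans ?_))
    rw [Finset.sum_const, Nat.card_Ioc, add_tsub_cancel_left, nsmul_eq_mul,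
      ← ENNReal.ofReal_natCast, ← ENNReal.ofReal_mul (by positivity)]
    exact ENNReal.ofReal_le_ofReal hk
  have hB : ENNReal.ofReal (1 / 2) ≤ noises N B := by
    rw [prob_compl_eq_one_sub mB, tsub_le_iff_left] at hBc
    have h4 : (1 : ℝ≥0∞) = ENNReal.ofReal (1 / 2) + ENNReal.ofReal (1 / 2) := by
      rw [← ENNReal.ofReal_add (by norm_num) (by norm_num)]
      norm_num
    rw [h4] at hBc
    exact (ENNReal.add_le_add_iff_right ENNReal.ofReal_ne_top).1 hBc
  have hAB : noCross N μ₀ lam p₀ b s ∩ B ⊆ noCross N μ₀ lam p₀ b (s + k) := by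
    rintro x ⟨hx1, hx2⟩
    rw [mem_noCross] at hx1 ⊢
    intro t ht1 ht2
    by_cases hts : t ≤ s
    · exact hx1 t ht1 hts
    · simp only [hBdef, Set.mem_iInter] at hx2
      exact hx2 t (Finset.mem_Ioc.2 ⟨by omega, ht2⟩)
  have hH := noises_mul_le_inter (s + k) (measurableSet_noCross (μ₀ := μ₀) (lam := lam) (p₀ := p₀)
    (b := b) s) mB
    (fun x y h => noCross_mono hμ.le hl h0 h1 fun n i _ hi => h n i (by omega))
    (fun x y h hy => by
      simp only [hBdef, Set.mem_iInter] at hy ⊢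
      intro t ht
      exact (score_le_score hl h0 h1 fun n => cusum_mono hμ.le fun i _ hi =>
        h n i (by have := (Finset.mem_Ioc.1 ht).2; omega)).trans_lt (hy t ht))
  have h2 : (2 : ℝ≥0∞) * ENNReal.ofReal (1 / 2) = 1 := by
    rw [← ENNReal.ofReal_ofNat, ← ENNReal.ofReal_mul (by norm_num)]
    norm_num
  calc noises N (noCross N μ₀ lam p₀ b s)
      = 2 * (noises N (noCross N μ₀ lam p₀ b s) * ENNReal.ofReal (1 / 2)) := by
        rw [mul_left_comm, h2, mul_one]
    _ ≤ 2 * noises N (noCross N μ₀ lam p₀ b (s + k)) := by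
        gcongr
        exact (mul_le_mul_right hB _).trans (hH.trans (measure_mono hAB))

/-! ### Bounding the detection delay by the probability of a single event -/

theorem le_meiTime_iff {ν : ℕ} (hν : 1 ≤ ν) (x : Fin N → ℕ → ℝ) :
    (ν : ℕ∞) ≤ meiTime μ₀ lam p₀ b x ↔ x ∈ noCross N μ₀ lam p₀ b (ν - 1) := by
  rw [noCross, Set.mem_ofPred_eq, ← ENat.add_one_le_iff (ENat.natCast_ne_top _)]
  norm_cast
  rw [Nat.sub_add_cancel hν]

/-- Rewrites T - ν + 1 as T - (ν - 1), legitimate in truncated subtraction because T ≥ ν on the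
conditioning event. The right side can then be treated by tail sums. -/
theorem lintegral_cond_sub_add_one (P : Measure (Fin N → ℕ → ℝ)) {ν : ℕ} (hν : 1 ≤ ν) :
    ∫⁻ x, ((meiTime μ₀ lam p₀ b x : ℝ≥0∞) - (ν : ℝ≥0∞) + 1)
        ∂(P[|{x | (ν : ℕ∞) ≤ meiTime μ₀ lam p₀ b x}]) =
      (P (noCross N μ₀ lam p₀ b (ν - 1)))⁻¹ * ∫⁻ x in noCross N μ₀ lam p₀ b (ν - 1),
        ((meiTime μ₀ lam p₀ b x : ℝ≥0∞) - ((ν - 1 : ℕ) : ℝ≥0∞)) ∂P := by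
  have h1 : {x : Fin N → ℕ → ℝ | (ν : ℕ∞) ≤ meiTime μ₀ lam p₀ b x} =
      noCross N μ₀ lam p₀ b (ν - 1) := by
    ext x; exact le_meiTime_iff hν x
  rw [h1, ProbabilityTheory.cond, lintegral_smul_measure, smul_eq_mul]
  congr 1
  refine setLIntegral_congr_fun (measurableSet_noCross _) fun x hx => ?_
  have h2 : (ν : ℝ≥0∞) ≤ (meiTime μ₀ lam p₀ b x : ℝ≥0∞) := by
    have := ENat.toENNReal_le.2 ((le_meiTime_iff hν x).2 hx)
    simpa using this
  have h3 : (ν : ℝ≥0∞) = ((ν - 1 : ℕ) : ℝ≥0∞) + 1 := by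
    have : ν = (ν - 1) + 1 := by omega
    nth_rw 1 [this]
    push_cast
    rfl
  rw [h3] at h2 ⊢
  generalize (meiTime μ₀ lam p₀ b x : ℝ≥0∞) = T at h2
  obtain ⟨c, rfl⟩ := exists_add_of_le h2
  rw [ENNReal.add_sub_cancel_left (by finiteness), add_assoc,
    ENNReal.add_sub_cancel_left (by finiteness), add_comm]

theorem delay_le (hμ₀ : 0 ≤ μ₀) (hl : 0 < lam) (h0 : 0 < p₀) (h1 : p₀ ≤ 1) {μ : ℝ} (hμ : 0 ≤ μ)
    (p : unitInterval) {K : ℝ} {k m : ℕ} (hm : 1 ≤ m) (hK : (k : ℝ) < K)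
    (hhalf : ∀ s, noises N (noCross N μ₀ lam p₀ b s) ≤
      2 * noises N (noCross N μ₀ lam p₀ b (s + k))) :
    delay (N := N) μ p K (meiTime μ₀ lam p₀ b) ≤
      m + 2 * law N μ p (k + 1 : ℕ) {x | score μ₀ lam p₀ x (k + m) < b} *
        ARL (N := N) (meiTime μ₀ lam p₀ b) := by
  rw [delay]
  refine iSup_le fun ν => iSup_le fun ⟨hν, hKν⟩ => ?_
  rw [lintegral_cond_sub_add_one _ hν]
  -- The strict inequality `hK` is what gives k + 1 ≤ ν, so the restart time s = ν - (k + 1) exists;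
  -- it may be 0.
  have hkν : k + 1 ≤ ν := by
    have : (k : ℝ) < ν := hK.trans_le hKν
    exact_mod_cast this
  obtain ⟨s, rfl⟩ := Nat.exists_eq_add_of_le' hkν
  have hsub : s + (k + 1) - 1 = s + k := by omega
  rw [hsub]
  set P := law N μ p (s + (k + 1) : ℕ) with hP
  set E := noCross N μ₀ lam p₀ b (s + k) with hE
  set a := law N μ p (k + 1 : ℕ) {x : Fin N → ℕ → ℝ | score μ₀ lam p₀ x (k + m) < b} with ha
  have hPE : P E = noises N E := law_noCross_of_lt μ p (by omega)
  have h2 : ∫⁻ x in E, ((meiTime μ₀ lam p₀ b x : ℝ≥0∞) - ((s + k : ℕ) : ℝ≥0∞)) ∂P ≤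
      m * P E + 2 * P E * a * ARL (N := N) (meiTime μ₀ lam p₀ b) := by
    calc _ ≤ ∫⁻ x in E, (m + ((meiTime μ₀ lam p₀ b x : ℝ≥0∞) - ((s + (k + m) : ℕ) : ℝ≥0∞))) ∂P := by
          refine lintegral_mono fun x => ?_
          have : ((s + (k + m) : ℕ) : ℝ≥0∞) = ((s + k : ℕ) : ℝ≥0∞) + m := by push_cast; ring
          rw [this, ← tsub_tsub]
          exact le_add_tsub
      _ = m * P E + ∫⁻ x in E, ((meiTime μ₀ lam p₀ b x : ℝ≥0∞) - ((s + (k + m) : ℕ) : ℝ≥0∞)) ∂P := by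
          rw [lintegral_add_left measurable_const, setLIntegral_const]
      _ ≤ m * P E + P (noCross N μ₀ lam p₀ b (s + (k + m))) *
            ARL (N := N) (meiTime μ₀ lam p₀ b) := by
          gcongr
          refine (setLIntegral_le_lintegral _ _).trans ?_
          rw [lintegral_meiTime_sub, ARL_eq_tsum, ← ENNReal.tsum_mul_left]
          exact ENNReal.tsum_le_tsum fun i => law_noCross_add_le hμ₀ hl h0 h1 hμ p _ _ i
      -- Survival to s + k + m is split at s, and `hhalf` turns survival to s into twice survival to
      -- s + k, the event conditioned on.
      _ ≤ _ := by
          gcongr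
          refine (law_noCross_le_before hl h0 h1 μ p (s := s) rfl (by omega) (by omega)).trans ?_
          gcongr
          rw [hPE]
          exact hhalf s
  calc (P E)⁻¹ * _ ≤ (P E)⁻¹ * (m * P E + 2 * P E * a * ARL (N := N) (meiTime μ₀ lam p₀ b)) := by
        gcongr
    _ = (P E)⁻¹ * P E * (m + 2 * a * ARL (N := N) (meiTime μ₀ lam p₀ b)) := by ring
    _ ≤ 1 * (m + 2 * a * ARL (N := N) (meiTime μ₀ lam p₀ b)) := by
        gcongr
        exact ENNReal.inv_mul_le_one _
    _ = _ := one_mul _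

/-! ### A lower tail bound for the sum of the scores -/

/-- `exp (-g_M(x))`. -/
def expNeg (p₀ lam x : ℝ) : ℝ := (1 + p₀ * (lam * Real.exp (x / 2) - 1))⁻¹

theorem measurable_expNeg (p₀ lam : ℝ) : Measurable (expNeg p₀ lam) := by
  unfold expNeg; fun_prop

theorem expNeg_pos (hl : 0 < lam) (h0 : 0 < p₀) (h1 : p₀ ≤ 1) (x : ℝ) : 0 < expNeg p₀ lam x :=
  inv_pos.2 (one_add_pos hl h0 h1)

theorem exp_neg_gM (hl : 0 < lam) (h0 : 0 < p₀) (h1 : p₀ ≤ 1) (x : ℝ) :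
    Real.exp (-gM p₀ lam x) = expNeg p₀ lam x := by
  rw [Real.exp_neg, gM, Real.exp_log (one_add_pos hl h0 h1), expNeg]

theorem expNeg_antitone (hl : 0 < lam) (h0 : 0 < p₀) (h1 : p₀ ≤ 1) : Antitone (expNeg p₀ lam) :=
  fun x y h => by
    rw [← exp_neg_gM hl h0 h1, ← exp_neg_gM hl h0 h1]
    exact Real.exp_le_exp.2 (neg_le_neg (gM_mono hl h0 h1 h))

theorem expNeg_le (hl : 0 < lam) (h0 : 0 < p₀) (h1 : p₀ < 1) (x : ℝ) :
    expNeg p₀ lam x ≤ (1 - p₀)⁻¹ := by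
  refine inv_anti₀ (by linarith) ?_
  have : 0 < p₀ * (lam * Real.exp (x / 2)) := by positivity
  linarith

theorem integrable_expNeg_comp (hl : 0 < lam) (h0 : 0 < p₀) (h1 : p₀ < 1) {f : (ℕ → ℝ) → ℝ}
    (hf : Measurable f) : Integrable (fun x => expNeg p₀ lam (f x)) noise := by
  refine Integrable.of_bound ((measurable_expNeg p₀ lam).comp hf).aestronglyMeasurable (1 - p₀)⁻¹
    (ae_of_all _ fun x => ?_)
  rw [Real.norm_of_nonneg (expNeg_pos hl h0 h1.le _).le]
  exact expNeg_le hl h0 h1 _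

/-- Shift the mean by `μ` from time `ν` on. -/
def shiftFrom (μ : ℝ) (ν : ℕ) (x : ℕ → ℝ) : ℕ → ℝ := fun t => x t + if ν ≤ t then μ else 0

theorem measurable_shiftFrom (μ : ℝ) (ν : ℕ) : Measurable (shiftFrom μ ν) := by
  unfold shiftFrom; fun_prop

theorem observe_eq (μ : ℝ) (ν : ℕ) (S : Set (Fin N)) (ε : Fin N → ℕ → ℝ) (n : Fin N) :
    open Classical in
    observe μ ν S ε n = if n ∈ S then shiftFrom μ ν (ε n) else ε n := by
  classical
  ext t
  by_cases h : n ∈ S <;> simp [observe, shiftFrom, h]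

/-- An affected score is bounded below by dropping both the past and the reflection, which leaves a
Gaussian walk with explicit drift. -/
theorem cusum_shiftFrom_splice_ge (μ₀ μ : ℝ) (k m : ℕ) (x y : ℕ → ℝ) :
    walk μ₀ y m + μ₀ * μ * m ≤ cusum μ₀ (shiftFrom μ (k + 1) (splice k x y)) (k + m) := by
  have h1 : cusum μ₀ (shiftFrom μ (k + 1) (splice k x y)) (k + m) =
      cusum μ₀ (splice k x fun t => y t + μ) (k + m) := by
    refine cusum_congr fun i _ _ => ?_
    by_cases h : i ≤ k
    · simp [shiftFrom, splice, h, show ¬ (k + 1 ≤ i) by omega]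
    · simp [shiftFrom, splice, h, show k + 1 ≤ i by omega]
  rw [h1]
  refine le_trans ?_ ((walk_le_cusum _ _ _).trans (cusum_le_cusum_splice _ _ _ _ _))
  refine le_of_eq ?_
  rw [walk, walk]
  have : ∀ i, μ₀ * (y i + μ) - μ₀ ^ 2 / 2 = (μ₀ * y i - μ₀ ^ 2 / 2) + μ₀ * μ := fun i => by ring
  simp_rw [this]
  rw [Finset.sum_add_distrib]
  simp
  ring

/-- Chernoff's bound with exponent -1, which cancels the logarithm in g_M. Given the affected set
the expectation factorizes; averaging over that set gives the N-th power of the mixture (1 - p)e0 +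
p e1. -/
theorem law_score_lt_le (hl : 0 < lam) (h0 : 0 < p₀) (h1 : p₀ < 1) (μ : ℝ)
    (p : unitInterval) (k m : ℕ) :
    law N μ p (k + 1 : ℕ) {x | score μ₀ lam p₀ x (k + m) < b} ≤
      ENNReal.ofReal (Real.exp (b + N *
        ((∫ x, expNeg p₀ lam (cusum μ₀ x (k + m)) ∂noise) - 1 -
          p * ((∫ x, expNeg p₀ lam (cusum μ₀ x (k + m)) ∂noise) -
            ∫ x, expNeg p₀ lam (walk μ₀ x m + μ₀ * μ * m) ∂noise)))) := by
  classical
  have mc := measurable_cusum μ₀ (k + m)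
  have mw : Measurable fun x => walk μ₀ x m + μ₀ * μ * m := (measurable_walk μ₀ m).add_const _
  have ms : Measurable fun x => cusum μ₀ (shiftFrom μ (k + 1) x) (k + m) :=
    mc.comp (measurable_shiftFrom _ _)
  have me := measurable_expNeg p₀ lam
  have hpos := expNeg_pos hl h0 h1.le
  set e0 := ∫ x, expNeg p₀ lam (cusum μ₀ x (k + m)) ∂noise with he0
  set e1 := ∫ x, expNeg p₀ lam (walk μ₀ x m + μ₀ * μ * m) ∂noise with he1
  have e0nn : 0 ≤ e0 := integral_nonneg fun x => (hpos _).le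
  have e1nn : 0 ≤ e1 := integral_nonneg fun x => (hpos _).le
  have hE0 : ∫⁻ x, ENNReal.ofReal (expNeg p₀ lam (cusum μ₀ x (k + m))) ∂noise =
      ENNReal.ofReal e0 := by
    rw [he0, ofReal_integral_eq_lintegral_ofReal (integrable_expNeg_comp hl h0 h1 mc)
      (ae_of_all _ fun x => (hpos _).le)]
  have mes : Measurable fun x =>
      ENNReal.ofReal (expNeg p₀ lam (cusum μ₀ (shiftFrom μ (k + 1) x) (k + m))) :=
    (me.comp ms).ennreal_ofReal
  have hE1 : ∫⁻ x, ENNReal.ofReal (expNeg p₀ lam (cusum μ₀ (shiftFrom μ (k + 1) x) (k + m))) ∂noise ≤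
      ENNReal.ofReal e1 := by
    rw [he1, ofReal_integral_eq_lintegral_ofReal (integrable_expNeg_comp hl h0 h1 mw)
      (ae_of_all _ fun x => (hpos _).le), lintegral_splice k mes]
    refine (lintegral_mono fun x => lintegral_mono fun y => ENNReal.ofReal_le_ofReal
      (expNeg_antitone hl h0 h1.le (cusum_shiftFrom_splice_ge μ₀ μ k m x y))).trans ?_
    simp
  have hmA : MeasurableSet {x : Fin N → ℕ → ℝ | score μ₀ lam p₀ x (k + m) < b} :=
    measurableSet_lt (measurable_score _) measurable_const
  have hp0 : (0 : ℝ) ≤ p := p.2.1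
  have hp1 : (p : ℝ) ≤ 1 := p.2.2
  have hS : ∀ S : Set (Fin N),
      noises N {ε | observe μ (k + 1 : ℕ) S ε ∈ {x | score μ₀ lam p₀ x (k + m) < b}} ≤
        ENNReal.ofReal (Real.exp b) *
          ∏ n, if n ∈ S then ENNReal.ofReal e1 else ENNReal.ofReal e0 := by
    intro S
    set f : Fin N → (ℕ → ℝ) → ℝ≥0∞ := fun n x => ENNReal.ofReal
      (expNeg p₀ lam (cusum μ₀ (if n ∈ S then shiftFrom μ (k + 1) x else x) (k + m))) with hf
    have mf : ∀ n, Measurable (f n) := fun n => by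
      by_cases hn : n ∈ S
      · simp only [hf, hn, if_true]; exact (me.comp ms).ennreal_ofReal
      · simp only [hf, hn, if_false]; exact (me.comp mc).ennreal_ofReal
    have mfp : Measurable fun ε : Fin N → ℕ → ℝ => ∏ n, f n (ε n) :=
      Finset.measurable_prod _ fun n _ => (mf n).comp (measurable_pi_apply n)
    calc _ ≤ ∫⁻ ε, ENNReal.ofReal (Real.exp b) * ∏ n, f n (ε n) ∂(noises N) := by
          refine (lintegral_indicator_one
            (measurable_observe_right μ (k + 1 : ℕ) S hmA)).symm.le.trans ?_
          refine lintegral_mono fun ε => ?_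
          by_cases hε : score μ₀ lam p₀ (observe μ (k + 1 : ℕ) S ε) (k + m) < b
          · rw [Set.indicator_of_mem (by exact hε), Pi.one_apply,
              ← ENNReal.ofReal_prod_of_nonneg fun n _ => (hpos _).le,
              ← ENNReal.ofReal_mul (Real.exp_pos _).le, ← ENNReal.ofReal_one]
            refine ENNReal.ofReal_le_ofReal ?_
            simp_rw [← exp_neg_gM hl h0 h1.le]
            rw [← Real.exp_sum, ← Real.exp_add, Finset.sum_neg_distrib]
            refine Real.one_le_exp ?_
            rw [score] at hε
            simp_rw [observe_eq] at hε
            linarith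
          · rw [Set.indicator_of_notMem (by exact hε)]
            exact zero_le
      _ = ENNReal.ofReal (Real.exp b) * ∏ n, ∫⁻ x, f n x ∂noise := by
          rw [lintegral_const_mul _ mfp, lintegral_noises_prod mf]
      _ ≤ _ := by
          gcongr with n
          by_cases hn : n ∈ S
          · simp only [hf, hn, if_true]; exact hE1
          · simp only [hf, hn, if_false]; exact hE0.le
  rw [law_apply _ _ _ hmA]
  refine (lintegral_mono hS).trans ?_
  rw [lintegral_const_mul _ .of_discrete,
    lintegral_setBernoulli_prod p (fun _ : Fin N => ENNReal.ofReal e1) fun _ => ENNReal.ofReal e0,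
    Finset.prod_const, Finset.card_univ, Fintype.card_fin, ← ENNReal.ofReal_mul hp0,
    ← ENNReal.ofReal_mul (by linarith), ← ENNReal.ofReal_add (by positivity)
      (mul_nonneg (by linarith) e0nn), ← ENNReal.ofReal_pow (add_nonneg (by positivity)
      (mul_nonneg (by linarith) e0nn)), ← ENNReal.ofReal_mul (Real.exp_pos _).le, Real.exp_add,
      Real.exp_nat_mul]
  refine ENNReal.ofReal_le_ofReal (mul_le_mul_of_nonneg_left (pow_le_pow_left₀
    (add_nonneg (by positivity) (mul_nonneg (by linarith) e0nn)) ?_ _) (Real.exp_pos _).le)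
  have := Real.add_one_le_exp (e0 - 1 - p * (e0 - e1))
  linarith

/-! ### Gaussian lower bounds -/

theorem noise_map_sum (m : ℕ) :
    noise.map (fun x => ∑ i ∈ Finset.Icc 1 m, x i) = gaussianReal 0 m := by
  induction m with
  | zero => simp [Measure.map_const]
  | succ m ih =>
    have h1 : (fun x : ℕ → ℝ => ∑ i ∈ Finset.Icc 1 (m + 1), x i) =
        (fun x => ∑ i ∈ Finset.Icc 1 m, x i) + fun x => x (m + 1) := by
      ext x
      rw [Finset.sum_Icc_succ_top (by omega)]
      rfl
    have hind : IndepFun (fun x : ℕ → ℝ => ∑ i ∈ Finset.Icc 1 m, x i) (fun x => x (m + 1)) noise := by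
      have := iIndepFun_noise.indepFun_finsetSum_of_notMem (fun i => measurable_pi_apply i)
        (s := Finset.Icc 1 m) (i := m + 1) (by simp)
      convert this using 1
      ext x
      simp
    rw [h1, gaussianReal_add_gaussianReal_of_indepFun hind ih
      (measurePreserving_eval_infinitePi (fun _ : ℕ => gaussianReal 0 1) (m + 1)).map_eq]
    simp

theorem gaussianReal_Ici_ge {z : ℝ} (hz : 0 ≤ z) :
    ENNReal.ofReal ((Real.sqrt (2 * Real.pi))⁻¹ * Real.exp (-(z + 1) ^ 2 / 2)) ≤
      gaussianReal 0 1 (Set.Ici z) := by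
  calc _ = ∫⁻ _ in Set.Icc z (z + 1),
        ENNReal.ofReal ((Real.sqrt (2 * Real.pi))⁻¹ * Real.exp (-(z + 1) ^ 2 / 2)) := by
        simp
    _ ≤ ∫⁻ x in Set.Icc z (z + 1), gaussianPDF 0 1 x := by
        refine setLIntegral_mono (measurable_gaussianPDF 0 1) fun x hx => ?_
        rw [gaussianPDF, gaussianPDFReal]
        refine ENNReal.ofReal_le_ofReal ?_
        have h1 : x ^ 2 ≤ (z + 1) ^ 2 := pow_le_pow_left₀ (hz.trans hx.1) hx.2 2
        simp only [NNReal.coe_one, mul_one, sub_zero]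
        refine mul_le_mul_of_nonneg_left (Real.exp_le_exp.2 ?_) (by positivity)
        linarith
    _ = gaussianReal 0 1 (Set.Icc z (z + 1)) := (gaussianReal_apply 0 one_ne_zero _).symm
    _ ≤ _ := measure_mono Set.Icc_subset_Ici_self

/-- The shifted walk has drift μ₀μ - μ₀²/2 per step and standard deviation μ₀√m. Replacing the
standardized level by its absolute value only lowers the bound and avoids a sign condition. -/
theorem noise_walk_ge {m : ℕ} (hm : 1 ≤ m) (hμ₀ : 0 < μ₀) (μ x₀ : ℝ) :
    ENNReal.ofReal ((Real.sqrt (2 * Real.pi))⁻¹ * Real.exp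
      (-(|(x₀ - (μ₀ * μ - μ₀ ^ 2 / 2) * m) / (μ₀ * Real.sqrt m)| + 1) ^ 2 / 2)) ≤
      noise {x | x₀ ≤ walk μ₀ x m + μ₀ * μ * m} := by
  set z := (x₀ - (μ₀ * μ - μ₀ ^ 2 / 2) * m) / (μ₀ * Real.sqrt m) with hz
  have hsq : 0 < Real.sqrt m := Real.sqrt_pos.2 (by exact_mod_cast hm)
  refine (gaussianReal_Ici_ge (abs_nonneg z)).trans ?_
  have hms : Measurable fun x : ℕ → ℝ => ∑ i ∈ Finset.Icc 1 m, x i :=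
    Finset.measurable_sum _ fun i _ => measurable_pi_apply i
  have h1 : noise.map (fun x => (Real.sqrt m)⁻¹ * ∑ i ∈ Finset.Icc 1 m, x i) =
      gaussianReal 0 1 := by
    have := Measure.map_map (μ := noise) (measurable_const_mul (Real.sqrt m)⁻¹) hms
    rw [noise_map_sum, gaussianReal_map_const_mul] at this
    refine this.symm.trans ?_
    congr 1
    · simp
    · ext
      simp only [NNReal.coe_mul, NNReal.coe_mk, NNReal.coe_natCast, NNReal.coe_one]
      rw [inv_pow, Real.sq_sqrt (by positivity), inv_mul_cancel₀]
      have : (0 : ℝ) < m := by exact_mod_cast hm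
      exact this.ne'
  rw [← h1, Measure.map_apply (hms.const_mul _) measurableSet_Ici]
  refine measure_mono fun x hx => ?_
  have hx' : |z| ≤ (Real.sqrt m)⁻¹ * ∑ i ∈ Finset.Icc 1 m, x i := hx
  have h2 : z ≤ (Real.sqrt m)⁻¹ * ∑ i ∈ Finset.Icc 1 m, x i := (le_abs_self z).trans hx'
  rw [hz, div_le_iff₀ (by positivity)] at h2
  have h3 : (Real.sqrt m)⁻¹ * (∑ i ∈ Finset.Icc 1 m, x i) * (μ₀ * Real.sqrt m) =
      μ₀ * ∑ i ∈ Finset.Icc 1 m, x i := by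
    field_simp
  have h4 : walk μ₀ x m = μ₀ * ∑ i ∈ Finset.Icc 1 m, x i - m * (μ₀ ^ 2 / 2) := by
    rw [walk, Finset.sum_sub_distrib, ← Finset.mul_sum]
    simp
  rw [Set.mem_ofPred_eq, h4]
  linarith

/-! ### Bounds for the exponential moments of the transformed scores -/

/-- The error v²/(1 + v) is quadratic for small v but only linear for large v, so any power between
1 and 2 dominates it. Taking a < 2 later keeps the exponent a/2 of the CUSUM score below 1, where
its exponential moments are bounded. -/
theorem inv_one_add_le {v a : ℝ} (hv : -(1 / 2) ≤ v) (ha1 : 1 ≤ a) (ha2 : a ≤ 2) :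
    (1 + v)⁻¹ ≤ 1 - v + 2 * |v| ^ a := by
  have hpos : 0 < 1 + v := by linarith
  have h : (1 + v)⁻¹ = 1 - v + v ^ 2 / (1 + v) := by
    field_simp
    ring
  rw [h]
  refine add_le_add le_rfl ?_
  rw [div_le_iff₀ hpos]
  have h2 : 0 ≤ |v| ^ a := Real.rpow_nonneg (abs_nonneg v) a
  rcases le_total |v| 1 with hv1 | hv1
  · have h3 : v ^ 2 ≤ |v| ^ a := by
      rw [← sq_abs, ← Real.rpow_natCast]
      rcases (abs_nonneg v).eq_or_lt with h0 | h0
      · rw [← h0, Real.zero_rpow (by norm_num), Real.zero_rpow (by linarith)]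
      · exact Real.rpow_le_rpow_of_exponent_ge h0 hv1 (by simpa using ha2)
    nlinarith
  · have hv0 : 0 ≤ v := by
      by_contra h0
      rw [abs_of_neg (by linarith)] at hv1
      linarith
    rw [abs_of_nonneg hv0] at hv1 h2 ⊢
    have h3 : v ≤ v ^ a := by
      simpa using Real.rpow_le_rpow_of_exponent_le hv1 ha1
    nlinarith

/-- The constant in the error term of `integral_expNeg_cusum_le`. -/
def errConst (μ₀ lam a : ℝ) : ℝ := 4 * (lam + 1) ^ a / (1 - shrink μ₀ (a / 2))

theorem integral_expNeg_cusum_le (hμ₀ : 0 < μ₀) (hl : 0 < lam) (h0 : 0 < p₀) (h1 : p₀ ≤ 1 / 2)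
    {a : ℝ} (ha1 : 1 < a) (ha2 : a < 2) (t : ℕ) :
    ∫ x, expNeg p₀ lam (cusum μ₀ x t) ∂noise ≤
      1 - p₀ * (lam * halfMoment μ₀ t - 1) + errConst μ₀ lam a * p₀ ^ a := by
  have hi := integrable_exp_half_cusum hμ₀ t
  have hia := integrable_exp_cusum (θ := a / 2) hμ₀ (by linarith) (by linarith) t
  have hr := shrink_lt_one (θ := a / 2) hμ₀ (by linarith) (by linarith)
  have hA : ∫ x, Real.exp (a / 2 * cusum μ₀ x t) ∂noise ≤ 2 / (1 - shrink μ₀ (a / 2)) := by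
    rw [← ENNReal.ofReal_le_ofReal_iff (div_nonneg zero_le_two (by linarith)),
      ofReal_integral_eq_lintegral_ofReal hia (ae_of_all _ fun _ => (Real.exp_pos _).le)]
    exact lintegral_exp_cusum_le hμ₀ (by linarith) (by linarith) t
  have hpt : ∀ x, expNeg p₀ lam (cusum μ₀ x t) ≤ (1 + p₀) - p₀ * lam * Real.exp (cusum μ₀ x t / 2) +
      2 * (p₀ * (lam + 1)) ^ a * Real.exp (a / 2 * cusum μ₀ x t) := by
    intro x
    have hR := cusum_nonneg μ₀ x t
    set R := cusum μ₀ x t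
    have hexp : 1 ≤ Real.exp (R / 2) := Real.one_le_exp (by linarith)
    have hv : -(1 / 2) ≤ p₀ * (lam * Real.exp (R / 2) - 1) := by
      have : 0 < p₀ * (lam * Real.exp (R / 2)) := by positivity
      linarith
    refine (inv_one_add_le hv ha1.le ha2.le).trans ?_
    have habs : |p₀ * (lam * Real.exp (R / 2) - 1)| ≤ p₀ * (lam + 1) * Real.exp (R / 2) := by
      rw [abs_le]
      have h2 : 0 < p₀ * (lam * Real.exp (R / 2)) := by positivity
      have h3 : p₀ * 1 ≤ p₀ * Real.exp (R / 2) := mul_le_mul_of_nonneg_left hexp h0.le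
      constructor <;> linarith
    have hpow := Real.rpow_le_rpow (abs_nonneg _) habs (by linarith : 0 ≤ a)
    rw [Real.mul_rpow (by positivity) (Real.exp_pos _).le, ← Real.exp_mul] at hpow
    have : R / 2 * a = a / 2 * R := by ring
    rw [this] at hpow
    linarith
  have hint₁ : Integrable (fun x => (1 + p₀) - p₀ * lam * Real.exp (cusum μ₀ x t / 2)) noise :=
    (integrable_const _).sub (hi.const_mul _)
  have hint : Integrable (fun x => (1 + p₀) - p₀ * lam * Real.exp (cusum μ₀ x t / 2) +
      2 * (p₀ * (lam + 1)) ^ a * Real.exp (a / 2 * cusum μ₀ x t)) noise :=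
    hint₁.add (hia.const_mul _)
  refine (integral_mono (integrable_expNeg_comp hl h0 (by linarith) (measurable_cusum μ₀ t))
    hint hpt).trans ?_
  rw [integral_add hint₁ (hia.const_mul _),
    integral_sub (integrable_const _) (hi.const_mul _), integral_const_mul, integral_const_mul,
    ← halfMoment]
  have h5 : 2 * (p₀ * (lam + 1)) ^ a * ∫ x, Real.exp (a / 2 * cusum μ₀ x t) ∂noise ≤
      2 * (p₀ * (lam + 1)) ^ a * (2 / (1 - shrink μ₀ (a / 2))) :=
    mul_le_mul_of_nonneg_left hA (by positivity)
  have h6 : 2 * (p₀ * (lam + 1)) ^ a * (2 / (1 - shrink μ₀ (a / 2))) =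
      errConst μ₀ lam a * p₀ ^ a := by
    rw [errConst, Real.mul_rpow h0.le (by linarith)]
    ring
  simp only [integral_const, smul_eq_mul, probReal_univ, one_mul]
  linarith

theorem integral_expNeg_cusum_ge (hμ₀ : 0 < μ₀) (hl : 0 < lam) (h0 : 0 < p₀) (h1 : p₀ < 1) (t : ℕ) :
    1 - p₀ * lam * xi μ₀ ≤ ∫ x, expNeg p₀ lam (cusum μ₀ x t) ∂noise := by
  have hi := integrable_exp_half_cusum hμ₀ t
  have hpt : ∀ x, 1 - p₀ * lam * Real.exp (cusum μ₀ x t / 2) ≤ expNeg p₀ lam (cusum μ₀ x t) := by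
    intro x
    have hpos := one_add_pos (x := cusum μ₀ x t / 2) hl h0 h1.le
    rw [expNeg, ← one_div, le_div_iff₀ hpos]
    have h2 : 0 < p₀ * lam * Real.exp (cusum μ₀ x t / 2) := by positivity
    have h3 : 1 + p₀ * (lam * Real.exp (cusum μ₀ x t / 2) - 1) =
        1 - p₀ + p₀ * lam * Real.exp (cusum μ₀ x t / 2) := by ring
    rw [h3]
    generalize p₀ * lam * Real.exp (cusum μ₀ x t / 2) = u at h2
    -- (1 - u)(1 - p₀ + u) = 1 - p₀ + p₀²/4 - (u - p₀/2)² ≤ 1.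
    nlinarith [sq_nonneg (u - p₀ / 2)]
  have hint : Integrable (fun x => 1 - p₀ * lam * Real.exp (cusum μ₀ x t / 2)) noise :=
    (integrable_const _).sub (hi.const_mul _)
  refine le_trans ?_ (integral_mono hint
    (integrable_expNeg_comp hl h0 h1 (measurable_cusum μ₀ t)) hpt)
  rw [integral_sub (integrable_const _) (hi.const_mul _), integral_const_mul, ← halfMoment]
  have : p₀ * lam * halfMoment μ₀ t ≤ p₀ * lam * xi μ₀ :=
    mul_le_mul_of_nonneg_left (halfMoment_le_xi hμ₀ t) (by positivity)
  simp only [integral_const, smul_eq_mul, probReal_univ, one_mul]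
  linarith

/-- Only the event W ≥ x₀ is exploited; elsewhere the integrand is at most (1 - p₀)⁻¹ ≤ 1 + 2p₀. On
the event it is smaller by at least q/(1 + q). -/
theorem integral_expNeg_le_of_tail (hl : 0 < lam) (h0 : 0 < p₀) (h1 : p₀ ≤ 1 / 2)
    {W : (ℕ → ℝ) → ℝ} (hW : Measurable W) (x₀ : ℝ) {π : ℝ}
    (hπ : ENNReal.ofReal π ≤ noise {x | x₀ ≤ W x}) :
    ∫ x, expNeg p₀ lam (W x) ∂noise ≤ 1 + 2 * p₀ -
      π * (p₀ * lam * Real.exp (x₀ / 2) / (1 + p₀ * lam * Real.exp (x₀ / 2))) := by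
  have hm : MeasurableSet {x | x₀ ≤ W x} := measurableSet_le measurable_const hW
  set q := p₀ * lam * Real.exp (x₀ / 2) with hq
  have hq0 : 0 < q := by positivity
  have hpt : ∀ x, expNeg p₀ lam (W x) ≤
      (1 + 2 * p₀) - {x | x₀ ≤ W x}.indicator (fun _ => q / (1 + q)) x := by
    intro x
    have hinv : (1 - p₀)⁻¹ ≤ 1 + 2 * p₀ := by
      rw [inv_le_iff_one_le_mul₀ (by linarith)]
      nlinarith
    by_cases hx : x₀ ≤ W x
    · rw [Set.indicator_of_mem (by exact hx)]
      refine (expNeg_antitone hl h0 (by linarith) hx).trans ?_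
      have h2 : expNeg p₀ lam x₀ = (1 - p₀ + q)⁻¹ := by
        rw [expNeg, hq]; congr 1; ring
      have h3 : (1 - p₀)⁻¹ - (1 - p₀ + q)⁻¹ = q / ((1 - p₀) * (1 - p₀ + q)) := by
        have : 1 - p₀ ≠ 0 := by linarith
        have : 1 - p₀ + q ≠ 0 := by linarith
        field_simp
        ring
      have h4 : q / (1 + q) ≤ q / ((1 - p₀) * (1 - p₀ + q)) := by
        refine div_le_div_of_nonneg_left hq0.le (mul_pos (by linarith) (by linarith)) ?_
        nlinarith
      rw [h2]
      linarith
    · rw [Set.indicator_of_notMem (by exact hx), sub_zero]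
      exact (expNeg_le hl h0 (by linarith) _).trans hinv
  have hind : Integrable ({x | x₀ ≤ W x}.indicator fun _ => q / (1 + q)) noise :=
    (integrable_const _).indicator hm
  have hint : Integrable
      (fun x => (1 + 2 * p₀) - {x | x₀ ≤ W x}.indicator (fun _ => q / (1 + q)) x) noise :=
    (integrable_const _).sub hind
  refine (integral_mono (integrable_expNeg_comp hl h0 (by linarith) hW) hint hpt).trans ?_
  rw [integral_sub (integrable_const _) hind, integral_indicator hm]
  have h5 : π ≤ noise.real {x | x₀ ≤ W x} := by
    rw [Measure.real, ← ENNReal.ofReal_le_iff_le_toReal (measure_ne_top _ _)]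
    exact hπ
  simp only [integral_const, smul_eq_mul, probReal_univ, one_mul, measureReal_restrict_apply_univ]
  have := mul_le_mul_of_nonneg_right h5 (by positivity : 0 ≤ q / (1 + q))
  linarith

/-- The first-order term p₀(λξ - 1) of the threshold cancels that of the unaffected streams. What
remains is the convergence error in ξ, the order-a remainder, the loss in affected streams that stay
low, and the negative gain. -/
theorem law_score_lt_le_exp (hμ₀ : 0 < μ₀) (hl : 0 < lam) (h0 : 0 < p₀) (h1 : p₀ ≤ 1 / 2)
    {γ : ℝ} (hARL : ARL (N := N) (meiTime μ₀ lam p₀ b) = ENNReal.ofReal γ)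
    (μ : ℝ) (p : unitInterval) (k m : ℕ) {a : ℝ} (ha1 : 1 < a) (ha2 : a < 2) (x₀ : ℝ)
    {π : ℝ} (hπ : ENNReal.ofReal π ≤ noise {x | x₀ ≤ walk μ₀ x m + μ₀ * μ * m}) :
    law N μ p (k + 1 : ℕ) {x | score μ₀ lam p₀ x (k + m) < b} ≤
      ENNReal.ofReal (Real.exp (Real.log (4 * γ) + N *
        (p₀ * lam * (2 / (1 - shrink μ₀ (1 / 2)) * shrink μ₀ (1 / 2) ^ (k + m)) +
          errConst μ₀ lam a * p₀ ^ a + p * p₀ * (lam * xi μ₀ + 2) -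
          p * π * (p₀ * lam * Real.exp (x₀ / 2) / (1 + p₀ * lam * Real.exp (x₀ / 2)))))) := by
  refine (law_score_lt_le hl h0 (by linarith) μ p k m).trans
    (ENNReal.ofReal_le_ofReal (Real.exp_le_exp.2 ?_))
  have hb := threshold_le hμ₀ hl h0 (by linarith) hARL
  have hxi := one_le_xi hμ₀
  have hlog : Real.log (1 + p₀ * (lam * xi μ₀ - 1)) ≤ p₀ * (lam * xi μ₀ - 1) := by
    have hpos : 0 < 1 + p₀ * (lam * xi μ₀ - 1) := by
      have : 0 < p₀ * (lam * xi μ₀) := by positivity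
      linarith
    have := Real.log_le_sub_one_of_pos hpos
    linarith
  have hN : (0 : ℝ) ≤ N := Nat.cast_nonneg N
  have hp0 : (0 : ℝ) ≤ p := p.2.1
  have e0u := integral_expNeg_cusum_le hμ₀ hl h0 h1 ha1 ha2 (k + m)
  have e0l := integral_expNeg_cusum_ge hμ₀ hl h0 (by linarith) (k + m)
  have e1u := integral_expNeg_le_of_tail hl h0 h1
    ((measurable_walk μ₀ m).add_const (μ₀ * μ * m)) x₀ hπ
  set e0 := ∫ x, expNeg p₀ lam (cusum μ₀ x (k + m)) ∂noise
  set e1 := ∫ x, expNeg p₀ lam (walk μ₀ x m + μ₀ * μ * m) ∂noise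
  set q := p₀ * lam * Real.exp (x₀ / 2) / (1 + p₀ * lam * Real.exp (x₀ / 2))
  have hx := mul_le_mul_of_nonneg_left (xi_le hμ₀ (k + m)) (by positivity : 0 ≤ p₀ * lam)
  have hd : p * (π * q - p₀ * (lam * xi μ₀ + 2)) ≤ p * (e0 - e1) :=
    mul_le_mul_of_nonneg_left (by linarith) hp0
  have hNlog := mul_le_mul_of_nonneg_left hlog hN
  have hmain : p₀ * (lam * xi μ₀ - 1) + (e0 - 1 - p * (e0 - e1)) ≤
      p₀ * lam * (2 / (1 - shrink μ₀ (1 / 2)) * shrink μ₀ (1 / 2) ^ (k + m)) +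
          errConst μ₀ lam a * p₀ ^ a + p * p₀ * (lam * xi μ₀ + 2) - p * π * q := by
    linarith
  have := mul_le_mul_of_nonneg_left hmain hN
  linarith

/-! ### Moments of the likelihood ratio -/

/-- Factor out one power of 1 + x, then use Bernoulli's inequality and subadditivity of y ↦ y^{α-1}.
The term αx is isolated because it has mean zero for a centred likelihood ratio. -/
theorem one_add_rpow_le {x α : ℝ} (hx : -1 ≤ x) (h1 : 1 ≤ α) (h2 : α ≤ 2) :
    (1 + x) ^ α ≤ 1 + α * x + |x| ^ α := by
  have hber := rpow_one_add_le_one_add_mul_self hx (by linarith : 0 ≤ α - 1)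
    (by linarith : α - 1 ≤ 1)
  have hsplit : ∀ y : ℝ, 0 ≤ y → y ^ α = y * y ^ (α - 1) := fun y hy => by
    rcases hy.eq_or_lt with rfl | hy
    · rw [Real.zero_rpow (by linarith), zero_mul]
    · rw [Real.rpow_sub_one hy.ne']
      field_simp
  rw [hsplit (1 + x) (by linarith), hsplit |x| (abs_nonneg x)]
  rcases le_total 0 x with h | h
  · have hsub := Real.rpow_add_le_add_rpow zero_le_one h (by linarith : 0 ≤ α - 1)
      (by linarith : α - 1 ≤ 1)
    rw [Real.one_rpow] at hsub
    rw [abs_of_nonneg h]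
    have := mul_le_mul_of_nonneg_left hsub h
    linarith
  · have hsub := Real.rpow_add_le_add_rpow (by linarith : 0 ≤ 1 + x) (neg_nonneg.2 h)
      (by linarith : 0 ≤ α - 1) (by linarith : α - 1 ≤ 1)
    rw [show 1 + x + -x = 1 by ring, Real.one_rpow] at hsub
    rw [abs_of_nonpos h]
    have := mul_le_mul_of_nonneg_left hsub (neg_nonneg.2 h)
    linarith

theorem lintegral_mixture_rpow_le (μ : ℝ) {p α : ℝ} (hp0 : 0 ≤ p) (hp1 : p ≤ 1) (h1 : 1 ≤ α)
    (h2 : α ≤ 2) (m : ℕ) :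
    ∫⁻ x, ENNReal.ofReal ((1 + p * (Real.exp (walk μ x m) - 1)) ^ α) ∂noise ≤
      ENNReal.ofReal (1 + 2 * (p ^ α * Real.exp (α * (α - 1) * μ ^ 2 / 2 * m))) := by
  have hw := measurable_walk μ m
  -- The summand αp is moved to the left so that every term is nonnegative; since E Z = 1 it cancels
  -- after integration.
  have hpt : ∀ z : ℝ, 0 ≤ z →
      (1 + p * (z - 1)) ^ α + α * p ≤ α * p * z + (p ^ α * z ^ α + (1 + p ^ α)) := by
    intro z hz
    have hx : -1 ≤ p * (z - 1) := by nlinarith [mul_nonneg hp0 hz]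
    have h3 := one_add_rpow_le hx h1 h2
    have h4 : |p * (z - 1)| ^ α ≤ p ^ α * (z ^ α + 1) := by
      rw [abs_mul, abs_of_nonneg hp0, Real.mul_rpow hp0 (abs_nonneg _)]
      refine mul_le_mul_of_nonneg_left ?_ (Real.rpow_nonneg hp0 _)
      have hzα : 0 ≤ z ^ α := Real.rpow_nonneg hz _
      rcases le_total z 1 with h | h
      · have : |z - 1| ^ α ≤ 1 :=
          Real.rpow_le_one (abs_nonneg _) (abs_le.2 ⟨by linarith, by linarith⟩) (by linarith)
        linarith
      · have : |z - 1| ^ α ≤ z ^ α :=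
          Real.rpow_le_rpow (abs_nonneg _) (abs_le.2 ⟨by linarith, by linarith⟩) (by linarith)
        linarith
    linarith
  have hnn : ∀ x, 0 ≤ (1 + p * (Real.exp (walk μ x m) - 1)) ^ α := fun x => by
    refine Real.rpow_nonneg ?_ _
    have := mul_nonneg hp0 (Real.exp_pos (walk μ x m)).le
    linarith
  have hpα : 0 ≤ p ^ α := Real.rpow_nonneg hp0 _
  have hαp : 0 ≤ α * p := mul_nonneg (by linarith) hp0
  set B := Real.exp (α * (α - 1) * μ ^ 2 / 2 * m) with hB
  have hB1 : 1 ≤ B := Real.one_le_exp (by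
    have : 0 ≤ α - 1 := by linarith
    positivity)
  have hI1 : ∫⁻ x, ENNReal.ofReal (Real.exp (walk μ x m)) ∂noise = 1 := by
    have := lintegral_exp_walk μ 1 m
    simpa [shrink] using this
  have hIα : ∫⁻ x, ENNReal.ofReal (Real.exp (walk μ x m) ^ α) ∂noise = ENNReal.ofReal B := by
    have := lintegral_exp_walk μ α m
    rw [shrink, ← Real.exp_nat_mul] at this
    simp_rw [← Real.exp_mul, mul_comm (walk μ _ m) α]
    rw [this, hB]
    congr 2
    ring
  have hsum : ∫⁻ x, ENNReal.ofReal ((1 + p * (Real.exp (walk μ x m) - 1)) ^ α) ∂noise +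
      ENNReal.ofReal (α * p) ≤ ENNReal.ofReal (α * p) +
        (ENNReal.ofReal (p ^ α * B) + ENNReal.ofReal (1 + p ^ α)) := by
    calc _ = ∫⁻ x, ENNReal.ofReal ((1 + p * (Real.exp (walk μ x m) - 1)) ^ α + α * p) ∂noise := by
          simp_rw [ENNReal.ofReal_add (hnn _) hαp]
          rw [lintegral_add_right _ measurable_const]
          simp
      _ ≤ ∫⁻ x, (ENNReal.ofReal (α * p) * ENNReal.ofReal (Real.exp (walk μ x m)) +
            (ENNReal.ofReal (p ^ α) * ENNReal.ofReal (Real.exp (walk μ x m) ^ α) +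
              ENNReal.ofReal (1 + p ^ α))) ∂noise := by
          refine lintegral_mono fun x => ?_
          rw [← ENNReal.ofReal_mul hαp, ← ENNReal.ofReal_mul hpα,
            ← ENNReal.ofReal_add (by positivity) (by positivity),
            ← ENNReal.ofReal_add (by positivity) (by positivity)]
          exact ENNReal.ofReal_le_ofReal (hpt _ (Real.exp_pos _).le)
      _ = _ := by
          rw [lintegral_add_left (by fun_prop), lintegral_add_right _ measurable_const,
            lintegral_const_mul _ (by fun_prop), lintegral_const_mul _ (by fun_prop), hI1, hIα,
            ENNReal.ofReal_mul hpα]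
          simp
  rw [add_comm] at hsum
  refine ((ENNReal.add_le_add_iff_left ENNReal.ofReal_ne_top).1 hsum).trans ?_
  rw [← ENNReal.ofReal_add (by positivity) (by positivity)]
  refine ENNReal.ofReal_le_ofReal ?_
  have := mul_le_mul_of_nonneg_left hB1 hpα
  linarith

/-! ### Change of measure for the stopping rule -/

/-- The likelihood ratio, over the first `m` observations, of a change at the first observation in
a random set of streams. -/
def likRatio (μ p : ℝ) (m : ℕ) (y : Fin N → ℕ → ℝ) : ℝ :=
  ∏ n, (1 + p * (Real.exp (walk μ (y n) m) - 1))

theorem prod_lik (μ : ℝ) (m : ℕ) (x : ℕ → ℝ) :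
    ∏ t ∈ Finset.Icc 1 m, lik μ (x t) = ENNReal.ofReal (Real.exp (walk μ x m)) := by
  rw [walk, Real.exp_sum, ENNReal.ofReal_prod_of_nonneg fun i _ => (Real.exp_pos _).le]
  rfl

theorem measurable_exp_walk (μ : ℝ) (m : ℕ) :
    Measurable fun x => ENNReal.ofReal (Real.exp (walk μ x m)) :=
  (measurable_walk μ m).exp.ennreal_ofReal

/-- For a fixed affected set, the shift on the m observations after s is a density. Averaging over
the set, after exchanging integrals, gives `likRatio`, which depends only on the segment after s. -/
theorem law_eq_lintegral_likRatio (μ : ℝ) (p : unitInterval) (s m : ℕ)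
    {D : Set (Fin N → ℕ → ℝ)} (mD : MeasurableSet D)
    (hD : ∀ x y : Fin N → ℕ → ℝ, (∀ n i, 1 ≤ i → i ≤ s + m → x n i = y n i) → (x ∈ D ↔ y ∈ D)) :
    law N μ p (s + 1 : ℕ) D = ∫⁻ z, ENNReal.ofReal (likRatio μ p m z.2) *
      D.indicator 1 (spliceN s z.1 z.2) ∂((noises N).prod (noises N)) := by
  classical
  have mspl := (measurePreserving_spliceN N s).measurable
  have m1 : Measurable (D.indicator (1 : (Fin N → ℕ → ℝ) → ℝ≥0∞)) := measurable_one.indicator mD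
  have mw : ∀ n : Fin N, Measurable fun z : (Fin N → ℕ → ℝ) × (Fin N → ℕ → ℝ) =>
      ENNReal.ofReal (Real.exp (walk μ (z.2 n) m)) := fun n =>
    (measurable_exp_walk μ m).comp ((measurable_pi_apply n).comp measurable_snd)
  have mL : ∀ S : Set (Fin N), Measurable fun z : (Fin N → ℕ → ℝ) × (Fin N → ℕ → ℝ) =>
      (∏ n, if n ∈ S then ENNReal.ofReal (Real.exp (walk μ (z.2 n) m)) else 1) := fun S =>
    Finset.measurable_prod _ fun n _ => by
      by_cases h : n ∈ S <;> simp only [h, if_true, if_false]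
      · exact mw n
      · exact measurable_const
  have hS : ∀ S : Set (Fin N), noises N {ε | observe μ (s + 1 : ℕ) S ε ∈ D} =
      ∫⁻ z, (∏ n, if n ∈ S then ENNReal.ofReal (Real.exp (walk μ (z.2 n) m)) else 1) *
        D.indicator 1 (spliceN s z.1 z.2) ∂((noises N).prod (noises N)) := by
    intro S
    set J : Fin N → Finset ℕ := fun n => if n ∈ S then Finset.Icc 1 m else ∅ with hJ
    have hmo := measurable_observe_right μ (s + 1 : ℕ) S
    have h1 : ∀ x y : Fin N → ℕ → ℝ,
        D.indicator (1 : (Fin N → ℕ → ℝ) → ℝ≥0∞) (observe μ (s + 1 : ℕ) S (spliceN s x y)) =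
          D.indicator 1 (spliceN s x fun n => shiftOn μ (J n) (y n)) := by
      intro x y
      have : observe μ (s + 1 : ℕ) S (spliceN s x y) ∈ D ↔
          (spliceN s x fun n => shiftOn μ (J n) (y n)) ∈ D := by
        refine hD _ _ fun n i _ hi => ?_
        by_cases his : i ≤ s
        · have : ¬ (s + 1 ≤ i) := by omega
          rw [observe_eq]
          by_cases hn : n ∈ S <;> simp [hn, shiftFrom, spliceN, splice, his, this]
        · have h2 : s + 1 ≤ i := by omega
          have h3 : 1 ≤ i - s ∧ i - s ≤ m := by omega
          rw [observe_eq]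
          by_cases hn : n ∈ S <;>
            simp [hn, shiftFrom, shiftOn, spliceN, splice, his, h2, hJ, h3]
      by_cases h : observe μ (s + 1 : ℕ) S (spliceN s x y) ∈ D
      · rw [Set.indicator_of_mem h, Set.indicator_of_mem (this.1 h)]
        rfl
      · rw [Set.indicator_of_notMem h, Set.indicator_of_notMem (mt this.2 h)]
    have hJp : ∀ y : Fin N → ℕ → ℝ, ∏ n, ∏ t ∈ J n, lik μ (y n t) =
        ∏ n, if n ∈ S then ENNReal.ofReal (Real.exp (walk μ (y n) m)) else 1 := by
      intro y
      refine Finset.prod_congr rfl fun n _ => ?_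
      by_cases hn : n ∈ S <;> simp [hJ, hn, prod_lik]
    have m2 : Measurable fun ε : Fin N → ℕ → ℝ =>
        D.indicator (1 : (Fin N → ℕ → ℝ) → ℝ≥0∞) (observe μ (s + 1 : ℕ) S ε) := m1.comp hmo
    have m3 : Measurable fun z : (Fin N → ℕ → ℝ) × (Fin N → ℕ → ℝ) =>
        (∏ n, if n ∈ S then ENNReal.ofReal (Real.exp (walk μ (z.2 n) m)) else 1) *
        D.indicator (1 : (Fin N → ℕ → ℝ) → ℝ≥0∞) (spliceN s z.1 z.2) := (mL S).mul (m1.comp mspl)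
    calc _ = ∫⁻ ε, D.indicator (1 : (Fin N → ℕ → ℝ) → ℝ≥0∞) (observe μ (s + 1 : ℕ) S ε)
            ∂(noises N) := (lintegral_indicator_one (hmo mD)).symm
      _ = ∫⁻ x, ∫⁻ y, D.indicator (1 : (Fin N → ℕ → ℝ) → ℝ≥0∞)
            (spliceN s x fun n => shiftOn μ (J n) (y n)) ∂(noises N) ∂(noises N) := by
          rw [lintegral_spliceN s m2]
          simp_rw [h1]
      _ = ∫⁻ x, ∫⁻ y, (∏ n, if n ∈ S then ENNReal.ofReal (Real.exp (walk μ (y n) m)) else 1) *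
            D.indicator 1 (spliceN s x y) ∂(noises N) ∂(noises N) := by
          refine lintegral_congr fun x => ?_
          have m4 : Measurable fun y : Fin N → ℕ → ℝ =>
              D.indicator (1 : (Fin N → ℕ → ℝ) → ℝ≥0∞) (spliceN s x y) :=
            m1.comp (mspl.comp measurable_prodMk_left)
          rw [lintegral_noises_map μ J m4]
          simp_rw [hJp]
      _ = _ := by
          rw [lintegral_prod _ m3.aemeasurable]
  rw [law_apply _ _ _ mD]
  simp_rw [hS]
  rw [lintegral_lintegral_swap]
  · refine lintegral_congr fun z => ?_
    rw [lintegral_mul_const _ .of_discrete,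
      lintegral_setBernoulli_prod p (fun n => ENNReal.ofReal (Real.exp (walk μ (z.2 n) m)))
        fun _ => 1]
    congr 1
    have hp0 : (0 : ℝ) ≤ p := p.2.1
    have hp1 : (p : ℝ) ≤ 1 := p.2.2
    rw [likRatio, ENNReal.ofReal_prod_of_nonneg]
    · refine Finset.prod_congr rfl fun n _ => ?_
      rw [mul_one, ← ENNReal.ofReal_mul hp0, ← ENNReal.ofReal_add (by positivity) (by linarith)]
      congr 1
      ring
    · intro n _
      have := mul_nonneg hp0 (Real.exp_pos (walk μ (z.2 n) m)).le
      linarith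
  · refine Measurable.aemeasurable ?_
    refine Measurable.mul ?_ (m1.comp (mspl.comp measurable_snd))
    refine Finset.measurable_prod _ fun n _ => ?_
    refine Measurable.ite ?_ ((mw n).comp measurable_snd) measurable_const
    exact measurable_fst (MeasurableSet.of_discrete (s := {S : Set (Fin N) | n ∈ S}))

/-- The likelihood ratio is truncated at C: below C it costs a factor C, above C it is at most
C^{1-α} times its α-th power. In the second part E \ F is enlarged to E, which is independent of the
ratio, so the moment factors out. -/
theorem law_sdiff_le (μ : ℝ) (p : unitInterval) {α C : ℝ} (hα1 : 1 ≤ α) (hα2 : α ≤ 2) (hC : 0 < C)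
    (s m : ℕ) :
    law N μ p (s + 1 : ℕ) (noCross N μ₀ lam p₀ b s \ noCross N μ₀ lam p₀ b (s + m)) ≤
      ENNReal.ofReal C *
          noises N (noCross N μ₀ lam p₀ b s \ noCross N μ₀ lam p₀ b (s + m)) +
        ENNReal.ofReal (C ^ (1 - α) * Real.exp
          (N * (2 * ((p : ℝ) ^ α * Real.exp (α * (α - 1) * μ ^ 2 / 2 * m))))) *
          noises N (noCross N μ₀ lam p₀ b s) := by
  set E := noCross N μ₀ lam p₀ b s with hE
  set F := noCross N μ₀ lam p₀ b (s + m) with hF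
  have mE : MeasurableSet E := measurableSet_noCross _
  have mD : MeasurableSet (E \ F) := mE.diff (measurableSet_noCross _)
  have hp0 : (0 : ℝ) ≤ p := p.2.1
  have hp1 : (p : ℝ) ≤ 1 := p.2.2
  have mspl := (measurePreserving_spliceN N s).measurable
  have hfac : ∀ x : ℕ → ℝ, 0 ≤ 1 + p * (Real.exp (walk μ x m) - 1) := fun x => by
    have := mul_nonneg hp0 (Real.exp_pos (walk μ x m)).le
    linarith
  have hLR : ∀ y : Fin N → ℕ → ℝ, 0 ≤ likRatio μ p m y := fun y =>
    Finset.prod_nonneg fun n _ => hfac _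
  have mfac : Measurable fun x =>
      ENNReal.ofReal ((1 + p * (Real.exp (walk μ x m) - 1)) ^ α) := by
    have := measurable_walk μ m
    fun_prop
  have mpow : Measurable fun y : Fin N → ℕ → ℝ =>
      ∏ n, ENNReal.ofReal ((1 + p * (Real.exp (walk μ (y n) m) - 1)) ^ α) :=
    Finset.measurable_prod _ fun n _ => mfac.comp (measurable_pi_apply n)
  have m1 : Measurable ((E \ F).indicator (1 : (Fin N → ℕ → ℝ) → ℝ≥0∞)) :=
    measurable_one.indicator mD
  have mE1 : Measurable (E.indicator (1 : (Fin N → ℕ → ℝ) → ℝ≥0∞)) := measurable_one.indicator mE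
  have htr : ∀ r : ℝ, 0 ≤ r → r ≤ C + C ^ (1 - α) * r ^ α := by
    intro r hr
    have h2 : 0 ≤ C ^ (1 - α) * r ^ α := by positivity
    rcases le_total r C with h | h
    · linarith
    · have hr' : 0 < r := hC.trans_le h
      have h3 : r ^ (1 - α) ≤ C ^ (1 - α) := Real.rpow_le_rpow_of_nonpos hC h (by linarith)
      have h4 := mul_le_mul_of_nonneg_right h3 (Real.rpow_nonneg hr α)
      rw [← Real.rpow_add hr', sub_add_cancel, Real.rpow_one] at h4
      linarith
  rw [law_eq_lintegral_likRatio μ p s m mD]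
  · calc _ ≤ ∫⁻ z, (ENNReal.ofReal C * (E \ F).indicator 1 (spliceN s z.1 z.2) +
          E.indicator 1 z.1 * (ENNReal.ofReal (C ^ (1 - α)) *
            ∏ n, ENNReal.ofReal ((1 + p * (Real.exp (walk μ (z.2 n) m) - 1)) ^ α)))
              ∂((noises N).prod (noises N)) := by
          refine lintegral_mono fun z => ?_
          by_cases hz : spliceN s z.1 z.2 ∈ E \ F
          · have hz1 : z.1 ∈ E :=
              (noCross_congr fun n i _ hi => splice_of_le hi _ _).1 hz.1
            rw [Set.indicator_of_mem hz, Set.indicator_of_mem hz1]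
            simp only [Pi.one_apply, mul_one, one_mul]
            rw [← ENNReal.ofReal_prod_of_nonneg fun n _ => Real.rpow_nonneg (hfac _) _,
              ← ENNReal.ofReal_mul (by positivity), ← ENNReal.ofReal_add hC.le
                (mul_nonneg (by positivity) (Finset.prod_nonneg fun n _ =>
                  Real.rpow_nonneg (hfac _) _)),
              Real.finsetProd_rpow _ _ fun n _ => hfac _]
            exact ENNReal.ofReal_le_ofReal (htr _ (hLR _))
          · rw [Set.indicator_of_notMem hz, mul_zero]
            exact zero_le
      _ = ENNReal.ofReal C * noises N (E \ F) + noises N E * (ENNReal.ofReal (C ^ (1 - α)) *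
            (∫⁻ x, ENNReal.ofReal ((1 + p * (Real.exp (walk μ x m) - 1)) ^ α) ∂noise) ^ N) := by
          have mA : Measurable fun z : (Fin N → ℕ → ℝ) × (Fin N → ℕ → ℝ) =>
              ENNReal.ofReal C * (E \ F).indicator 1 (spliceN s z.1 z.2) :=
            (m1.comp mspl).const_mul _
          have mB : Measurable fun z : (Fin N → ℕ → ℝ) × (Fin N → ℕ → ℝ) =>
              (E \ F).indicator (1 : (Fin N → ℕ → ℝ) → ℝ≥0∞) (spliceN s z.1 z.2) := m1.comp mspl
          rw [lintegral_add_left mA, lintegral_const_mul _ mB]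
          congr 1
          · rw [(measurePreserving_spliceN N s).lintegral_comp m1, lintegral_indicator_one mD]
          · refine (lintegral_prod_mul mE1.aemeasurable
              (mpow.const_mul (ENNReal.ofReal (C ^ (1 - α)))).aemeasurable).trans ?_
            rw [lintegral_indicator_one mE, lintegral_const_mul _ mpow,
              lintegral_noises_prod fun _ => mfac]
            simp
      _ ≤ _ := by
          refine add_le_add le_rfl ?_
          rw [mul_comm, ENNReal.ofReal_mul (by positivity)]
          gcongr
          refine (pow_le_pow_left₀ zero_le
            (lintegral_mixture_rpow_le μ hp0 hp1 hα1 hα2 m) N).trans ?_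
          rw [← ENNReal.ofReal_pow (by positivity), Real.exp_nat_mul]
          refine ENNReal.ofReal_le_ofReal (pow_le_pow_left₀ (by positivity) ?_ N)
          have := Real.add_one_le_exp (2 * ((p : ℝ) ^ α * Real.exp (α * (α - 1) * μ ^ 2 / 2 * m)))
          linarith
  · intro x y h
    have h1 : x ∈ E ↔ y ∈ E := noCross_congr fun n i hi his => h n i hi (by omega)
    have h2 : x ∈ F ↔ y ∈ F := noCross_congr h
    simp only [Set.mem_sdiff, h1, h2]

/-! ### A lower bound for the detection delay -/

/-- Otherwise h(s + m) ≤ (1 - q)h(s) for all s ≥ s₀. The tail sum G then satisfies G ≤ m + (1 - q)G,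
so γ ≤ s₀ + m/q. -/
theorem exists_small_hazard {γ : ℝ} (hARL : ARL (N := N) (meiTime μ₀ lam p₀ b) = ENNReal.ofReal γ)
    {s₀ m : ℕ} {q : ℝ} (hq0 : 0 < q) (hq1 : q < 1) (hγ : s₀ + m / q < γ) :
    ∃ s, s₀ ≤ s ∧ ENNReal.ofReal (1 - q) * noises N (noCross N μ₀ lam p₀ b s) <
      noises N (noCross N μ₀ lam p₀ b (s + m)) := by
  by_contra! hcon
  set h : ℕ → ℝ≥0∞ := fun s => noises N (noCross N μ₀ lam p₀ b s) with hh
  set G := ∑' i, h (s₀ + i) with hG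
  have h1 : ENNReal.ofReal γ ≤ s₀ + G := by
    rw [← hARL, ARL_eq_tsum]
    refine (Summable.sum_add_tsum_nat_add' (k := s₀) (f := h) ENNReal.summable).symm.le.trans ?_
    refine add_le_add ?_ (le_of_eq (tsum_congr fun i => by rw [add_comm]))
    refine (Finset.sum_le_sum fun i _ => prob_le_one).trans ?_
    simp
  have h2 : G ≤ m + ENNReal.ofReal (1 - q) * G := by
    refine (Summable.sum_add_tsum_nat_add' (k := m) (f := fun i => h (s₀ + i))
      ENNReal.summable).symm.le.trans ?_
    refine add_le_add ?_ ?_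
    · refine (Finset.sum_le_sum fun i _ => prob_le_one).trans ?_
      simp
    · rw [hG, ← ENNReal.tsum_mul_left]
      refine ENNReal.tsum_le_tsum fun i => ?_
      rw [← add_assoc]
      exact hcon (s₀ + i) (by omega)
  have hGfin : G ≠ ⊤ := by
    have : G ≤ ENNReal.ofReal γ := by
      rw [← hARL, ARL_eq_tsum]
      exact (ENNReal.tsum_comp_le_tsum_of_injective (add_right_injective s₀) h)
    exact (this.trans_lt ENNReal.ofReal_lt_top).ne
  rw [← ENNReal.ofReal_toReal hGfin] at h1 h2
  rw [← ENNReal.ofReal_natCast, ← ENNReal.ofReal_add (by positivity) ENNReal.toReal_nonneg,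
    ENNReal.ofReal_le_ofReal_iff (by positivity)] at h1
  rw [← ENNReal.ofReal_natCast, ← ENNReal.ofReal_mul (by linarith), ← ENNReal.ofReal_add
    (by positivity) (mul_nonneg (by linarith) ENNReal.toReal_nonneg),
    ENNReal.ofReal_le_ofReal_iff (add_nonneg (by positivity)
      (mul_nonneg (by linarith) ENNReal.toReal_nonneg))] at h2
  have h3 : G.toReal ≤ m / q := by
    rw [le_div_iff₀ hq0]
    linarith
  linarith

/-- The change is placed at ν = s + 1, at the start of a window of small hazard. Change of measure
shows that the window is still likely to be survived under P_ν, and then the delay is at least m. -/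
theorem le_delay (μ : ℝ) (p : unitInterval) {γ : ℝ}
    (hARL : ARL (N := N) (meiTime μ₀ lam p₀ b) = ENNReal.ofReal γ) {K : ℝ}
    {s₀ m : ℕ} (hK : K ≤ s₀) {q : ℝ} (hq0 : 0 < q) (hq1 : q < 1) (hγ : s₀ + m / q < γ)
    {α C : ℝ} (hα1 : 1 ≤ α) (hα2 : α ≤ 2) (hC : 0 < C) :
    m * (1 - ENNReal.ofReal (C * q + C ^ (1 - α) * Real.exp
          (N * (2 * ((p : ℝ) ^ α * Real.exp (α * (α - 1) * μ ^ 2 / 2 * m)))))) ≤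
      delay (N := N) μ p K (meiTime μ₀ lam p₀ b) := by
  obtain ⟨s, hs, hlt⟩ := exists_small_hazard hARL hq0 hq1 hγ
  set M := C ^ (1 - α) * Real.exp
    (N * (2 * ((p : ℝ) ^ α * Real.exp (α * (α - 1) * μ ^ 2 / 2 * m)))) with hM
  have hM0 : 0 ≤ M := by positivity
  set E := noCross N μ₀ lam p₀ b s with hE
  set F := noCross N μ₀ lam p₀ b (s + m) with hF
  set P := law N μ p (s + 1 : ℕ) with hP
  have mE : MeasurableSet E := measurableSet_noCross _
  have mF : MeasurableSet F := measurableSet_noCross _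
  have hFE : F ⊆ E := noCross_antitone (Nat.le_add_right s m)
  have hPE : P E = noises N E := law_noCross_of_lt μ p (by omega)
  -- The strict inequality in `hlt` excludes a null conditioning event.
  have hE0 : P E ≠ 0 := by
    rw [hPE]
    intro h0
    rw [h0, mul_zero] at hlt
    exact absurd (measure_mono hFE) (not_le.2 (h0 ▸ hlt))
  have hD : P (E \ F) ≤ ENNReal.ofReal (C * q + M) * P E := by
    refine (law_sdiff_le μ p hα1 hα2 hC s m).trans ?_
    rw [ENNReal.ofReal_add (by positivity) hM0, add_mul, hPE]
    refine add_le_add ?_ le_rfl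
    rw [ENNReal.ofReal_mul hC.le, mul_assoc]
    gcongr
    rw [measure_sdiff hFE mF.nullMeasurableSet (measure_ne_top _ _), tsub_le_iff_right]
    have : noises N E = ENNReal.ofReal q * noises N E + ENNReal.ofReal (1 - q) * noises N E := by
      rw [← add_mul, ← ENNReal.ofReal_add hq0.le (by linarith)]
      simp
    nth_rw 1 [this]
    gcongr
  have hPF : P E * (1 - ENNReal.ofReal (C * q + M)) ≤ P F := by
    rw [ENNReal.mul_sub fun _ _ => measure_ne_top _ _, mul_one, tsub_le_iff_right, mul_comm]
    calc P E = P (F ∪ E \ F) := by rw [Set.union_sdiff_cancel hFE]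
      _ ≤ P F + P (E \ F) := measure_union_le _ _
      _ ≤ _ := by gcongr
  rw [delay]
  refine le_trans ?_ (le_iSup₂ (f := fun (ν : ℕ) (_ : 1 ≤ ν ∧ K ≤ (ν : ℝ)) =>
    ∫⁻ x, ((meiTime μ₀ lam p₀ b x : ℝ≥0∞) - (ν : ℝ≥0∞) + 1)
      ∂((law N μ p ν)[|{x | (ν : ℕ∞) ≤ meiTime μ₀ lam p₀ b x}])) (s + 1) ⟨by omega, ?_⟩)
  · rw [lintegral_cond_sub_add_one _ (by omega), Nat.add_sub_cancel]
    have hint : m * P F ≤ ∫⁻ x in E, ((meiTime μ₀ lam p₀ b x : ℝ≥0∞) - (s : ℝ≥0∞)) ∂P := by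
      refine le_trans ?_ (lintegral_mono_set hFE)
      rw [← setLIntegral_const]
      refine setLIntegral_mono' mF fun x hx => ?_
      have h1 : ((s + m : ℕ) : ℝ≥0∞) ≤ (meiTime μ₀ lam p₀ b x : ℝ≥0∞) := by
        have := ENat.toENNReal_le.2 (le_of_lt hx)
        simpa using this
      refine ENNReal.le_sub_of_add_le_left (by finiteness) ?_
      exact_mod_cast h1
    calc _ = (P E)⁻¹ * P E * (m * (1 - ENNReal.ofReal (C * q + M))) := by
          rw [ENNReal.inv_mul_cancel hE0 (measure_ne_top _ _), one_mul]
      _ = (P E)⁻¹ * (m * (P E * (1 - ENNReal.ofReal (C * q + M)))) := by ring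
      _ ≤ (P E)⁻¹ * (m * P F) := by gcongr
      _ ≤ _ := by gcongr
  · refine hK.trans ?_
    push_cast
    have : (s₀ : ℝ) ≤ s := by exact_mod_cast hs
    linarith

/-! ### Elementary asymptotics -/

theorem tendsto_log_natCast : Tendsto (fun N : ℕ => Real.log N) atTop atTop :=
  Real.tendsto_log_atTop.comp tendsto_natCast_atTop_atTop

theorem eventually_mul_rpow_le {e e' : ℝ} (h : e < e') (C : ℝ) {c : ℝ} (hc : 0 < c) :
    ∀ᶠ N : ℕ in atTop, C * (N : ℝ) ^ e ≤ c * (N : ℝ) ^ e' := by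
  have h1 := ((tendsto_rpow_atTop (sub_pos.2 h)).comp
    (tendsto_natCast_atTop_atTop (R := ℝ))).eventually_ge_atTop (C / c)
  filter_upwards [h1, eventually_gt_atTop 0] with N hN hN0
  have hX : (0 : ℝ) < N := by exact_mod_cast hN0
  have h2 : (N : ℝ) ^ e' = (N : ℝ) ^ e * (N : ℝ) ^ (e' - e) := by
    rw [← Real.rpow_add hX]; ring_nf
  simp only [Function.comp] at hN
  rw [div_le_iff₀ hc] at hN
  have h3 := mul_le_mul_of_nonneg_right hN (Real.rpow_nonneg hX.le e)
  rw [h2]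
  linarith

theorem eventually_log_le_rpow {e : ℝ} (h : 0 < e) (C : ℝ) {c : ℝ} (hc : 0 < c) :
    ∀ᶠ N : ℕ in atTop, C * Real.log N ≤ c * (N : ℝ) ^ e := by
  have h1 : Tendsto (fun N : ℕ => Real.log N / (N : ℝ) ^ e) atTop (𝓝 0) :=
    ((isLittleO_log_rpow_atTop h).tendsto_div_nhds_zero).comp tendsto_natCast_atTop_atTop
  have h2 : Tendsto (fun N : ℕ => C * (Real.log N / (N : ℝ) ^ e)) atTop (𝓝 0) := by
    simpa using h1.const_mul C
  filter_upwards [h2.eventually_le_const hc, eventually_gt_atTop 0] with N hN hN0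
  have hX : (0 : ℝ) < (N : ℝ) ^ e := Real.rpow_pos_of_pos (by exact_mod_cast hN0) e
  rwa [← mul_div_assoc, div_le_iff₀ hX] at hN

theorem tendsto_ceil_mul_log {M : ℝ} (hM : 0 ≤ M) :
    Tendsto (fun N : ℕ => (⌈M * Real.log N⌉₊ : ℝ) / Real.log N) atTop (𝓝 M) :=
  (tendsto_nat_ceil_mul_div_atTop hM).comp tendsto_log_natCast

theorem tendsto_floor_mul_log {M : ℝ} (hM : 0 ≤ M) :
    Tendsto (fun N : ℕ => (⌊M * Real.log N⌋₊ : ℝ) / Real.log N) atTop (𝓝 M) :=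
  (tendsto_nat_floor_mul_div_atTop hM).comp tendsto_log_natCast

/-- The asymptotic regime for the fraction `p` of affected streams, the average run length `γ` and
the parameter `p₀` of the stopping rule. -/
structure Regime (ζ β c : ℝ) (p : ℕ → unitInterval) (γ p₀ : ℕ → ℝ) : Prop where
  one_le : ∀ᶠ N : ℕ in atTop, 1 ≤ γ N
  log_le : ∀ᶠ N : ℕ in atTop, Real.log (γ N) ≤ 2 * (N : ℝ) ^ ζ
  le_log : ∀ᶠ N : ℕ in atTop, 1 / 2 * (N : ℝ) ^ ζ ≤ Real.log (γ N)
  p_le : ∀ᶠ N : ℕ in atTop, (p N : ℝ) ≤ 2 * (N : ℝ) ^ (-β)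
  le_p : ∀ᶠ N : ℕ in atTop, 1 / 2 * (N : ℝ) ^ (-β) ≤ (p N : ℝ)
  p₀_le : ∀ᶠ N : ℕ in atTop, p₀ N ≤ 2 * c * (N : ℝ) ^ ((ζ - 1) / 2)
  le_p₀ : ∀ᶠ N : ℕ in atTop, 1 / 2 * c * (N : ℝ) ^ ((ζ - 1) / 2) ≤ p₀ N

theorem eventually_le_of_isEquivalent {u v : ℕ → ℝ} (h : u ~[atTop] v)
    (hv : ∀ᶠ N in atTop, 0 < v N) :
    (∀ᶠ N in atTop, u N ≤ 2 * v N) ∧ ∀ᶠ N in atTop, 1 / 2 * v N ≤ u N := by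
  have h1 := (isEquivalent_iff_tendsto_one (hv.mono fun N hN => hN.ne')).1 h
  constructor
  · filter_upwards [hv, h1.eventually_le_const (by norm_num : (1 : ℝ) < 2)] with N hN h2
    rwa [Pi.div_apply, div_le_iff₀ hN] at h2
  · filter_upwards [hv, h1.eventually_const_le (by norm_num : (1 / 2 : ℝ) < 1)] with N hN h2
    rwa [Pi.div_apply, le_div_iff₀ hN] at h2

theorem Regime.of_isEquivalent {ζ β c : ℝ} {p : ℕ → unitInterval} {γ p₀ : ℕ → ℝ} (hc : 0 < c)
    (hγ : (fun N : ℕ => Real.log (γ N)) ~[atTop] fun N : ℕ => (N : ℝ) ^ ζ)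
    (hp : (fun N : ℕ => (p N : ℝ)) ~[atTop] fun N : ℕ => (N : ℝ) ^ (-β))
    (h1 : ∀ᶠ N : ℕ in atTop, 1 ≤ γ N)
    (hp₀ : ∀ᶠ N : ℕ in atTop, p₀ N = c * Real.sqrt (Real.log (γ N) / N)) :
    Regime ζ β c p γ p₀ := by
  have hpos : ∀ e : ℝ, ∀ᶠ N : ℕ in atTop, 0 < (N : ℝ) ^ e := fun e => by
    filter_upwards [eventually_gt_atTop 0] with N hN
    exact Real.rpow_pos_of_pos (by exact_mod_cast hN) e
  obtain ⟨g1, g2⟩ := eventually_le_of_isEquivalent hγ (hpos ζ)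
  obtain ⟨q1, q2⟩ := eventually_le_of_isEquivalent hp (hpos (-β))
  have hsq : ∀ N : ℕ, 0 < N → (N : ℝ) ^ ζ / N = ((N : ℝ) ^ ((ζ - 1) / 2)) ^ 2 := fun N hN => by
    have hX : (0 : ℝ) < N := by exact_mod_cast hN
    rw [← Real.rpow_natCast, ← Real.rpow_mul hX.le, ← Real.rpow_sub_one hX.ne']
    congr 1
    push_cast
    ring
  refine ⟨h1, g1, g2, q1, q2, ?_, ?_⟩
  · filter_upwards [g1, hp₀, eventually_gt_atTop 0, hpos ((ζ - 1) / 2)] with N hg h hN hr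
    have hX : (0 : ℝ) < N := by exact_mod_cast hN
    rw [h, mul_comm 2 c, mul_assoc]
    refine mul_le_mul_of_nonneg_left (Real.sqrt_le_iff.2 ⟨by positivity, ?_⟩) hc.le
    rw [mul_pow, ← hsq N hN, ← mul_div_assoc]
    have : 0 ≤ (N : ℝ) ^ ζ := Real.rpow_nonneg hX.le _
    gcongr
    linarith
  · filter_upwards [g2, hp₀, eventually_gt_atTop 0, hpos ((ζ - 1) / 2)] with N hg h hN hr
    have hX : (0 : ℝ) < N := by exact_mod_cast hN
    rw [h, mul_comm (1 / 2) c, mul_assoc]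
    refine mul_le_mul_of_nonneg_left (Real.le_sqrt_of_sq_le ?_) hc.le
    rw [mul_pow, ← hsq N hN, ← mul_div_assoc]
    have : 0 ≤ (N : ℝ) ^ ζ := Real.rpow_nonneg hX.le _
    gcongr
    linarith

section
variable {ζ β c : ℝ} {p : ℕ → unitInterval} {γ p₀ : ℕ → ℝ}

theorem Regime.eventually_log_le (h : Regime ζ β c p γ p₀) (hζ : 0 < ζ) (C : ℝ) {c' : ℝ}
    (hc' : 0 < c') : ∀ᶠ N : ℕ in atTop, C * Real.log N ≤ c' * Real.log (γ N) := by
  filter_upwards [h.le_log, eventually_log_le_rpow hζ C (by positivity : 0 < c' * (1 / 2))]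
    with N h1 h2
  have := mul_le_mul_of_nonneg_left h1 hc'.le
  linarith

theorem shrink_half_pow_le {μ₀ s X : ℝ} {n : ℕ} (hX : 0 < X)
    (h : s * Real.log X ≤ n * (μ₀ ^ 2 / 8)) : shrink μ₀ (1 / 2) ^ n ≤ X ^ (-s) := by
  rw [shrink, ← Real.exp_nat_mul, Real.rpow_def_of_pos hX]
  refine Real.exp_le_exp.2 ?_
  linarith

theorem Regime.eventually_hazard_le (h : Regime ζ β c p γ p₀) (hζ : 0 < ζ) {μ₀ κ : ℝ}
    (hμ₀ : 0 < μ₀) (hκ : 0 < κ) :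
    ∀ᶠ N : ℕ in atTop, ∃ L : ℕ, 1 ≤ L ∧
      ((⌈κ * Real.log N⌉₊ - 1 : ℕ) : ℝ) * (L / γ N +
        N * (2 / (1 - shrink μ₀ (1 / 2)) * shrink μ₀ (1 / 2) ^ L)) ≤ 1 / 2 := by
  set C := 2 / (1 - shrink μ₀ (1 / 2)) with hC
  have hC0 : 0 < C := div_pos two_pos (by
    have := shrink_lt_one (θ := 1 / 2) hμ₀ (by norm_num) (by norm_num)
    linarith)
  have hlim : Tendsto (fun N : ℕ => κ * (16 / μ₀ ^ 2) * (Real.log N ^ 2 / N) +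
      κ * (1 + C) * (Real.log N ^ 1 / N)) atTop (𝓝 (κ * (16 / μ₀ ^ 2) * 0 + κ * (1 + C) * 0)) := by
    have h1 : ∀ n : ℕ, Tendsto (fun N : ℕ => Real.log N ^ n / N) atTop (𝓝 0) := fun n =>
      ((Real.isLittleO_pow_log_id_atTop (n := n)).tendsto_div_nhds_zero).comp
        tendsto_natCast_atTop_atTop
    exact ((h1 2).const_mul _).add ((h1 1).const_mul _)
  rw [mul_zero, mul_zero, add_zero] at hlim
  filter_upwards [hlim.eventually_le_const (by norm_num : (0 : ℝ) < 1 / 2), h.one_le,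
    h.eventually_log_le hζ 2 one_pos, tendsto_log_natCast.eventually_gt_atTop 0,
    eventually_gt_atTop 0] with N hN hγ hγ2 hlog hN0
  have hX : (0 : ℝ) < N := by exact_mod_cast hN0
  have hX1 : (1 : ℝ) ≤ N := by exact_mod_cast hN0
  -- Since `shrink μ₀ (1/2)` = exp(-μ₀²/8), this L gives `shrink`^L ≤ N^{-2}, enough to absorb the
  -- factor N from the union over streams.
  refine ⟨⌈16 / μ₀ ^ 2 * Real.log N⌉₊, Nat.one_le_ceil_iff.2 (by positivity), ?_⟩
  set L := ⌈16 / μ₀ ^ 2 * Real.log N⌉₊ with hL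
  have hL1 : 16 / μ₀ ^ 2 * Real.log N ≤ L := Nat.le_ceil _
  have hL2 : (L : ℝ) ≤ 16 / μ₀ ^ 2 * Real.log N + 1 := (Nat.ceil_lt_add_one (by positivity)).le
  have hk : ((⌈κ * Real.log N⌉₊ - 1 : ℕ) : ℝ) ≤ κ * Real.log N := by
    have h1 : 1 ≤ ⌈κ * Real.log N⌉₊ := Nat.one_le_ceil_iff.2 (by positivity)
    rw [Nat.cast_sub h1]
    have := (Nat.ceil_lt_add_one (by positivity : 0 ≤ κ * Real.log N)).le
    push_cast
    linarith
  have hr : shrink μ₀ (1 / 2) ^ L ≤ (N : ℝ) ^ (-2 : ℝ) := by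
    refine shrink_half_pow_le hX ?_
    have : 2 * Real.log N = 16 / μ₀ ^ 2 * Real.log N * (μ₀ ^ 2 / 8) := by field_simp; norm_num
    rw [this]
    gcongr
  have hγN : (N : ℝ) ≤ γ N := by
    rw [one_mul] at hγ2
    have h1 : Real.log N ≤ Real.log (γ N) := by linarith
    exact (Real.log_le_log_iff hX (by linarith)).1 h1
  have h1 : L / γ N ≤ L / N := by gcongr
  have h2 : N * (C * shrink μ₀ (1 / 2) ^ L) ≤ C / N := by
    calc N * (C * shrink μ₀ (1 / 2) ^ L) ≤ N * (C * (N : ℝ) ^ (-2 : ℝ)) := by gcongr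
      _ = C / N := by
        rw [Real.rpow_neg hX.le, Real.rpow_ofNat]
        field_simp
  calc _ ≤ κ * Real.log N * ((16 / μ₀ ^ 2 * Real.log N + 1) / N + C / N) := by
        have hr0 := shrink_pos μ₀ (1 / 2)
        have hγ0 : 0 < γ N := by linarith
        refine mul_le_mul hk (add_le_add (h1.trans (by gcongr)) h2) (by positivity) (by positivity)
    _ = _ := by ring
    _ ≤ _ := hN

/-- After division by log N the Gaussian exponent converges to the one in `hv`. The added 1, the
prefactor and the rounding of M log N disappear in the limit, and the strict inequality absorbs
them. -/
theorem eventually_rpow_le_gaussian {μ μ₀ M y v : ℝ} (hμ₀ : 0 < μ₀) (hM : 0 < M)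
    (hv : ((y - (μ₀ * μ - μ₀ ^ 2 / 2) * M) / (μ₀ * Real.sqrt M)) ^ 2 / 2 < v) :
    ∀ᶠ N : ℕ in atTop, (N : ℝ) ^ (-v) ≤ (Real.sqrt (2 * Real.pi))⁻¹ * Real.exp
      (-(|(y * Real.log N - (μ₀ * μ - μ₀ ^ 2 / 2) * (⌈M * Real.log N⌉₊ : ℝ)) /
        (μ₀ * Real.sqrt (⌈M * Real.log N⌉₊ : ℝ))| + 1) ^ 2 / 2) := by
  set d := μ₀ * μ - μ₀ ^ 2 / 2 with hd
  set z := (y - d * M) / (μ₀ * Real.sqrt M) with hz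
  have hsM : 0 < Real.sqrt M := Real.sqrt_pos.2 hM
  have hinv : Tendsto (fun N : ℕ => 1 / Real.sqrt (Real.log N)) atTop (𝓝 0) := by
    simp only [one_div]
    exact (Real.tendsto_sqrt_atTop.comp tendsto_log_natCast).inv_tendsto_atTop
  have hinv' : Tendsto (fun N : ℕ => Real.log (Real.sqrt (2 * Real.pi)) / Real.log N) atTop (𝓝 0) :=
    tendsto_const_nhds.div_atTop tendsto_log_natCast
  have hm := tendsto_ceil_mul_log hM.le
  have hz' : Tendsto (fun N : ℕ => (y - d * ((⌈M * Real.log N⌉₊ : ℝ) / Real.log N)) /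
      (μ₀ * Real.sqrt ((⌈M * Real.log N⌉₊ : ℝ) / Real.log N))) atTop (𝓝 z) :=
    (tendsto_const_nhds.sub (hm.const_mul d)).div
      ((Real.continuous_sqrt.tendsto _ |>.comp hm).const_mul μ₀) (by positivity)
  have hlim : Tendsto (fun N : ℕ => (|(y - d * ((⌈M * Real.log N⌉₊ : ℝ) / Real.log N)) /
      (μ₀ * Real.sqrt ((⌈M * Real.log N⌉₊ : ℝ) / Real.log N))| + 1 / Real.sqrt (Real.log N)) ^ 2 / 2 +
      Real.log (Real.sqrt (2 * Real.pi)) / Real.log N) atTop (𝓝 ((|z| + 0) ^ 2 / 2 + 0)) :=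
    (((hz'.abs.add hinv).pow 2).div_const 2).add hinv'
  rw [add_zero, add_zero, sq_abs] at hlim
  filter_upwards [hlim.eventually_le_const hv, tendsto_log_natCast.eventually_gt_atTop 0,
    eventually_gt_atTop 0] with N hN hlog hN0
  have hX : (0 : ℝ) < N := by exact_mod_cast hN0
  have hsl : 0 < Real.sqrt (Real.log N) := Real.sqrt_pos.2 hlog
  set m := (⌈M * Real.log N⌉₊ : ℝ) with hmdef
  have hm0 : 0 < m := by
    rw [hmdef]
    exact_mod_cast Nat.ceil_pos.2 (by positivity)
  have hsm : 0 < Real.sqrt m := Real.sqrt_pos.2 hm0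
  have hzz : (y - d * (m / Real.log N)) / (μ₀ * Real.sqrt (m / Real.log N)) =
      (y * Real.log N - d * m) / (μ₀ * Real.sqrt m) / Real.sqrt (Real.log N) := by
    rw [Real.sqrt_div hm0.le]
    have : y - d * (m / Real.log N) = (y * Real.log N - d * m) / Real.log N := by field_simp
    rw [this]
    field_simp
    rw [Real.sq_sqrt hlog.le]
    ring
  set w := (y * Real.log N - d * m) / (μ₀ * Real.sqrt m) with hw
  rw [hzz, abs_div, abs_of_pos hsl, ← add_div, div_pow, Real.sq_sqrt hlog.le] at hN
  rw [Real.rpow_def_of_pos hX, ← Real.exp_log (inv_pos.2 (by positivity :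
    0 < Real.sqrt (2 * Real.pi))), ← Real.exp_add, Real.log_inv]
  refine Real.exp_le_exp.2 ?_
  have h2 : ((|w| + 1) ^ 2 / Real.log N / 2 + Real.log (Real.sqrt (2 * Real.pi)) / Real.log N) *
      Real.log N = (|w| + 1) ^ 2 / 2 + Real.log (Real.sqrt (2 * Real.pi)) := by
    field_simp
  have h3 := mul_le_mul_of_nonneg_right hN hlog.le
  rw [h2] at h3
  linarith

end

section
variable {ζ β c : ℝ} {p : ℕ → unitInterval} {γ p₀ : ℕ → ℝ}

/-! ### Asymptotic upper bound for the delay -/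

/-- The gain has order at least N^{e5}, and five positive contributions are each at most a fifth of
it. `hrate` makes the error in ξ of order at most N^ζ, and `hy` keeps p₀ exp((y log N)/2) bounded,
so the denominator in the gain is harmless. -/
theorem Regime.eventually_exponent_le (h : Regime ζ β c p γ p₀) (hζ0 : 0 < ζ) (hζ1 : ζ < 1)
    (hc : 0 < c) (hβ : (1 - ζ) / 2 < β) {μ₀ lam κ M y v : ℝ} (hμ₀ : 0 < μ₀) (hl : 0 < lam)
    (hκ : 0 < κ) (hy : y ≤ 1 - ζ)
    (hrate : (1 - ζ) / 2 < (κ + M) * (μ₀ ^ 2 / 8))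
    (hgain : ζ < 1 - β - (1 - ζ) / 2 + y / 2 - v) {a : ℝ} (ha0 : 0 ≤ a)
    (ha : 1 + a * ((ζ - 1) / 2) < 1 - β - (1 - ζ) / 2 + y / 2 - v) :
    ∀ᶠ N : ℕ in atTop, ∀ π : ℝ, (N : ℝ) ^ (-v) ≤ π →
      Real.log (4 * γ N) + N *
        (p₀ N * lam * (2 / (1 - shrink μ₀ (1 / 2)) *
            shrink μ₀ (1 / 2) ^ (⌈κ * Real.log N⌉₊ - 1 + ⌈M * Real.log N⌉₊)) +
          errConst μ₀ lam a * p₀ N ^ a + p N * p₀ N * (lam * xi μ₀ + 2) -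
          p N * π * (p₀ N * lam * Real.exp (y * Real.log N / 2) /
            (1 + p₀ N * lam * Real.exp (y * Real.log N / 2)))) +
        Real.log (γ N) + Real.log 2 ≤ 0 := by
  set C := 2 / (1 - shrink μ₀ (1 / 2)) with hC
  have hC0 : 0 < C := div_pos two_pos (by
    have := shrink_lt_one (θ := 1 / 2) hμ₀ (by norm_num) (by norm_num)
    linarith)
  set D := |errConst μ₀ lam a| with hD
  have hxi := one_le_xi hμ₀
  set e5 := 1 - β - (1 - ζ) / 2 + y / 2 - v with he5
  set c5 := 1 / 2 * (1 / 2 * c * lam / (1 + 2 * c * lam)) with hc5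
  have hc5pos : 0 < c5 := by positivity
  have hc5' : 0 < c5 / 5 := by positivity
  have l0 := eventually_mul_rpow_le (by linarith : (0 : ℝ) < e5)
    (Real.log 4 + Real.log 2) hc5'
  have l1 := eventually_mul_rpow_le hgain 4 hc5'
  have l2 := eventually_mul_rpow_le hgain (2 * c * lam * C) hc5'
  have l3 := eventually_mul_rpow_le ha (D * (2 * c) ^ a) hc5'
  have l4 := eventually_mul_rpow_le (e := 1 - β + (ζ - 1) / 2) (by linarith : _ < e5)
    (2 * (2 * c) * (lam * xi μ₀ + 2)) hc5'
  have hrate' := (tendsto_log_natCast.const_mul_atTop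
    (by linarith : 0 < (κ + M) * (μ₀ ^ 2 / 8) - (1 - ζ) / 2)).eventually_ge_atTop (μ₀ ^ 2 / 8)
  filter_upwards [l0, l1, l2, l3, l4, hrate', h.one_le, h.log_le, h.p_le, h.le_p, h.p₀_le, h.le_p₀,
    tendsto_log_natCast.eventually_gt_atTop 0, eventually_gt_atTop 0]
    with N l0 l1 l2 l3 l4 hr hγ hlogγ hp1 hp2 hq1 hq2 hlog hN0 π hπ
  have hX : (0 : ℝ) < N := by exact_mod_cast hN0
  set X : ℝ := (N : ℝ) with hXdef
  have hpos : ∀ e : ℝ, 0 < X ^ e := fun e => Real.rpow_pos_of_pos hX e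
  have hadd : ∀ e f : ℝ, X ^ e * X ^ f = X ^ (e + f) := fun e f => (Real.rpow_add hX e f).symm
  have hXe : ∀ e : ℝ, X * X ^ e = X ^ (1 + e) := fun e => by
    rw [Real.rpow_add hX, Real.rpow_one]
  have hp00 : 0 < p₀ N := lt_of_lt_of_le (by have := hpos ((ζ - 1) / 2); positivity) hq2
  have hpN0 : (0 : ℝ) ≤ p N := (p N).2.1
  have hlog4 : Real.log (4 * γ N) = Real.log 4 + Real.log (γ N) :=
    Real.log_mul (by norm_num) (by linarith)
  rw [Real.rpow_zero, mul_one] at l0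
  have hshr : shrink μ₀ (1 / 2) ^ (⌈κ * Real.log X⌉₊ - 1 + ⌈M * Real.log X⌉₊) ≤
      X ^ (-((1 - ζ) / 2)) := by
    refine shrink_half_pow_le hX ?_
    have h1 : 1 ≤ ⌈κ * Real.log X⌉₊ := Nat.one_le_ceil_iff.2 (by positivity)
    rw [Nat.cast_add, Nat.cast_sub h1]
    have h2 := Nat.le_ceil (κ * Real.log X)
    have h3 := Nat.le_ceil (M * Real.log X)
    have h4 : (κ * Real.log X - 1 + M * Real.log X) * (μ₀ ^ 2 / 8) ≤
      ((⌈κ * Real.log X⌉₊ : ℝ) - (1 : ℕ) + ⌈M * Real.log X⌉₊) * (μ₀ ^ 2 / 8) := by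
      gcongr
      simp
    refine le_trans ?_ h4
    linarith
  set R := shrink μ₀ (1 / 2) ^ (⌈κ * Real.log X⌉₊ - 1 + ⌈M * Real.log X⌉₊) with hR
  have hR0 : 0 ≤ R := pow_nonneg (shrink_pos _ _).le _
  have hπ0 : 0 ≤ π := (hpos _).le.trans hπ
  have t2 : X * (p₀ N * lam * (C * R)) ≤ c5 / 5 * X ^ e5 := by
    refine le_trans ?_ l2
    calc X * (p₀ N * lam * (C * R)) ≤
          X * (2 * c * X ^ ((ζ - 1) / 2) * lam * (C * X ^ (-((1 - ζ) / 2)))) := by gcongr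
      _ = 2 * c * lam * C * (X * (X ^ ((ζ - 1) / 2) * X ^ (-((1 - ζ) / 2)))) := by ring
      _ = 2 * c * lam * C * X ^ ζ := by rw [hadd, hXe]; ring_nf
  have t3 : X * (errConst μ₀ lam a * p₀ N ^ a) ≤ c5 / 5 * X ^ e5 := by
    refine le_trans ?_ l3
    calc X * (errConst μ₀ lam a * p₀ N ^ a) ≤ X * (D * (2 * c * X ^ ((ζ - 1) / 2)) ^ a) := by
          have h1 : p₀ N ^ a ≤ (2 * c * X ^ ((ζ - 1) / 2)) ^ a := Real.rpow_le_rpow hp00.le hq1 ha0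
          have h2 : errConst μ₀ lam a ≤ D := le_abs_self _
          have h3 : 0 ≤ p₀ N ^ a := Real.rpow_nonneg hp00.le _
          have h4 : 0 ≤ D := abs_nonneg _
          gcongr
      _ = D * (2 * c) ^ a * X ^ (1 + a * ((ζ - 1) / 2)) := by
          rw [Real.mul_rpow (by positivity) (hpos _).le, ← Real.rpow_mul hX.le, ← hXe,
            mul_comm a ((ζ - 1) / 2)]
          ring
  have t4 : X * (p N * p₀ N * (lam * xi μ₀ + 2)) ≤ c5 / 5 * X ^ e5 := by
    refine le_trans ?_ l4
    calc X * (p N * p₀ N * (lam * xi μ₀ + 2)) ≤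
          X * (2 * X ^ (-β) * (2 * c * X ^ ((ζ - 1) / 2)) * (lam * xi μ₀ + 2)) := by
          have : 0 < lam * xi μ₀ + 2 := by positivity
          gcongr
      _ = 2 * (2 * c) * (lam * xi μ₀ + 2) * (X * (X ^ (-β) * X ^ ((ζ - 1) / 2))) := by ring
      _ = _ := by rw [hadd, hXe]; ring_nf
  have hexp : Real.exp (y * Real.log X / 2) = X ^ (y / 2) := by
    rw [Real.rpow_def_of_pos hX]; ring_nf
  have t5 : c5 * X ^ e5 ≤ X * (p N * π * (p₀ N * lam * Real.exp (y * Real.log X / 2) /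
      (1 + p₀ N * lam * Real.exp (y * Real.log X / 2)))) := by
    rw [hexp]
    have hX1 : 1 ≤ X := by rw [hXdef]; exact_mod_cast hN0
    have hqu : p₀ N * lam * X ^ (y / 2) ≤ 2 * c * lam := by
      calc p₀ N * lam * X ^ (y / 2) ≤ 2 * c * X ^ ((ζ - 1) / 2) * lam * X ^ (y / 2) := by
            have := hpos (y / 2)
            gcongr
        _ = 2 * c * lam * X ^ ((ζ - 1) / 2 + y / 2) := by rw [← hadd]; ring
        _ ≤ 2 * c * lam * 1 := by
            gcongr
            exact Real.rpow_le_one_of_one_le_of_nonpos hX1 (by linarith)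
        _ = _ := mul_one _
    have hy0 := hpos (y / 2)
    have hz0 := hpos ((ζ - 1) / 2)
    have hb0 := hpos (-β)
    have hv0 := hpos (-v)
    calc c5 * X ^ e5 = X * (1 / 2 * X ^ (-β) * X ^ (-v) *
          (1 / 2 * c * X ^ ((ζ - 1) / 2) * lam * X ^ (y / 2) / (1 + 2 * c * lam))) := by
          have : X ^ e5 = X * (X ^ (-β) * X ^ (-v) * (X ^ ((ζ - 1) / 2) * X ^ (y / 2))) := by
            rw [hadd, hadd, hadd, hXe]
            congr 1
            rw [he5]; ring
          rw [this, hc5]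
          ring
      _ ≤ _ := by
          gcongr
  have hsum : X * (p₀ N * lam * (C * R) + errConst μ₀ lam a * p₀ N ^ a +
      p N * p₀ N * (lam * xi μ₀ + 2) - p N * π * (p₀ N * lam * Real.exp (y * Real.log X / 2) /
      (1 + p₀ N * lam * Real.exp (y * Real.log X / 2)))) =
      X * (p₀ N * lam * (C * R)) + X * (errConst μ₀ lam a * p₀ N ^ a) +
      X * (p N * p₀ N * (lam * xi μ₀ + 2)) - X * (p N * π * (p₀ N * lam *
      Real.exp (y * Real.log X / 2) / (1 + p₀ N * lam * Real.exp (y * Real.log X / 2)))) := by ring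
  rw [hsum, hlog4]
  linarith

theorem Regime.eventually_delay_le (h : Regime ζ β c p γ p₀) (hζ0 : 0 < ζ) (hζ1 : ζ < 1)
    (hc : 0 < c) (hβ : (1 - ζ) / 2 < β) {μ μ₀ lam : ℝ} (hμ : 0 ≤ μ) (hμ₀ : 0 < μ₀) (hl : 0 < lam)
    {b : ℕ → ℝ}
    (hARL : ∀ᶠ N : ℕ in atTop,
      ARL (N := N) (meiTime μ₀ lam (p₀ N) (b N)) = ENNReal.ofReal (γ N))
    {κ M y : ℝ} (hκ : 0 < κ) (hM : 0 < M) (hy : y ≤ 1 - ζ)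
    (hrate : (1 - ζ) / 2 < (κ + M) * (μ₀ ^ 2 / 8))
    (hgain : ζ < 1 - β - (1 - ζ) / 2 + y / 2 -
      ((y - (μ₀ * μ - μ₀ ^ 2 / 2) * M) / (μ₀ * Real.sqrt M)) ^ 2 / 2) :
    ∀ᶠ N : ℕ in atTop, delay (N := N) μ (p N) (κ * Real.log N) (meiTime μ₀ lam (p₀ N) (b N)) ≤
      ENNReal.ofReal ((⌈M * Real.log N⌉₊ : ℝ) + 1) := by
  obtain ⟨v, hv1, hv2⟩ : ∃ v, ((y - (μ₀ * μ - μ₀ ^ 2 / 2) * M) / (μ₀ * Real.sqrt M)) ^ 2 / 2 < v ∧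
      v < 1 - β - (1 - ζ) / 2 + y / 2 - ζ := exists_between (by linarith)
  -- At a = 2 the remainder N p₀^a would have exponent exactly ζ; the slack η allows a slightly
  -- smaller a.
  obtain ⟨a, ha1, ha2, ha3⟩ : ∃ a : ℝ, 1 < a ∧ a < 2 ∧
      1 + a * ((ζ - 1) / 2) < 1 - β - (1 - ζ) / 2 + y / 2 - v := by
    set η := 1 - β - (1 - ζ) / 2 + y / 2 - v - ζ with hη
    have hη0 : 0 < η := by linarith
    refine ⟨2 - min (1 / 2) η, by linarith [min_le_left (1 / 2) η], ?_, ?_⟩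
    · have : 0 < min (1 / 2) η := lt_min (by norm_num) hη0
      linarith
    · have h1 : min (1 / 2) η * ((1 - ζ) / 2) ≤ η * ((1 - ζ) / 2) := by
        have : 0 ≤ (1 - ζ) / 2 := by linarith
        gcongr
        exact min_le_right _ _
      have h2 : η * ((1 - ζ) / 2) < η * 1 := by
        gcongr
        linarith
      nlinarith
  have hsmall := eventually_mul_rpow_le (e := (ζ - 1) / 2) (e' := 0) (by linarith) (2 * c)
    (by norm_num : (0 : ℝ) < 1 / 2)
  filter_upwards [h.eventually_exponent_le hζ0 hζ1 hc hβ hμ₀ hl hκ hy hrate (by linarith)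
      (by linarith) ha3, h.eventually_hazard_le hζ0 hμ₀ hκ, eventually_rpow_le_gaussian hμ₀ hM hv1,
    hARL, h.one_le, h.p₀_le, h.le_p₀, hsmall, tendsto_log_natCast.eventually_gt_atTop 0,
    eventually_gt_atTop 0] with N hE ⟨L, hL1, hL2⟩ hgauss hA hγ hq1 hq2 hs hlog hN0
  have hX : (0 : ℝ) < N := by exact_mod_cast hN0
  have hp00 : 0 < p₀ N :=
    lt_of_lt_of_le (by have := Real.rpow_pos_of_pos hX ((ζ - 1) / 2); positivity) hq2
  rw [Real.rpow_zero, mul_one] at hs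
  have hp0h : p₀ N ≤ 1 / 2 := hq1.trans hs
  have hceil : 1 ≤ ⌈κ * Real.log N⌉₊ := Nat.one_le_ceil_iff.2 (by positivity)
  have hm1 : 1 ≤ ⌈M * Real.log N⌉₊ := Nat.one_le_ceil_iff.2 (by positivity)
  have hk : ((⌈κ * Real.log N⌉₊ - 1 : ℕ) : ℝ) < κ * Real.log N := by
    rw [Nat.cast_sub hceil]
    have := Nat.ceil_lt_add_one (by positivity : 0 ≤ κ * Real.log N)
    push_cast
    linarith
  have hhalf := noises_noCross_le_two_mul hμ₀ hl hp00 (by linarith) hγ hA hL1 hL2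
  have htail := noise_walk_ge hm1 hμ₀ μ (y * Real.log N)
  refine (delay_le hμ₀.le hl hp00 (by linarith) hμ (p N) hm1 hk hhalf).trans ?_
  have hlaw := law_score_lt_le_exp hμ₀ hl hp00 hp0h hA μ (p N) (⌈κ * Real.log N⌉₊ - 1)
    ⌈M * Real.log N⌉₊ ha1 ha2 (y * Real.log N) htail
  have hE' := hE _ hgauss
  rw [ENNReal.ofReal_add (by positivity) zero_le_one, ENNReal.ofReal_natCast, ENNReal.ofReal_one]
  refine add_le_add le_rfl ?_
  rw [hA]
  refine (mul_le_mul_left (mul_le_mul_right hlaw 2) _).trans ?_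
  rw [← ENNReal.ofReal_ofNat, ← ENNReal.ofReal_mul (by norm_num),
    ← ENNReal.ofReal_mul (by positivity), ← ENNReal.ofReal_one]
  refine ENNReal.ofReal_le_ofReal ?_
  nth_rw 2 [← Real.exp_log (by linarith : 0 < γ N)]
  rw [← Real.exp_log (by norm_num : (0 : ℝ) < 2), ← Real.exp_add, ← Real.exp_add,
    Real.exp_le_one_iff, Real.exp_log (by norm_num : (0 : ℝ) < 2)]
  linarith

/-! ### Asymptotic lower bound for the delay -/

theorem Regime.eventually_le_delay (h : Regime ζ β c p γ p₀) (hζ0 : 0 < ζ)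
    {μ μ₀ lam : ℝ} {b : ℕ → ℝ}
    (hARL : ∀ᶠ N : ℕ in atTop,
      ARL (N := N) (meiTime μ₀ lam (p₀ N) (b N)) = ENNReal.ofReal (γ N))
    {κ M α : ℝ} (hκ : 0 < κ) (hM : 0 < M) (hα1 : 1 < α) (hα2 : α ≤ 2)
    (hα : 1 - α * β + α * (α - 1) * μ ^ 2 / 2 * M < ζ) :
    ∃ δ : ℕ → ℝ, Tendsto δ atTop (𝓝 0) ∧ ∀ᶠ N : ℕ in atTop,
      ENNReal.ofReal ((⌊M * Real.log N⌋₊ : ℝ) * (1 - δ N)) ≤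
        delay (N := N) μ (p N) (κ * Real.log N) (meiTime μ₀ lam (p₀ N) (b N)) := by
  have hlogγ : Tendsto (fun N => Real.log (γ N)) atTop atTop := by
    refine tendsto_atTop_mono' _ ?_ tendsto_log_natCast
    filter_upwards [h.eventually_log_le hζ0 1 one_pos] with N hN
    linarith
  -- C = γ^{1/2} and q = γ^{-3/4} make Cq tend to 0, keep m/q well below γ, and leave a factor
  -- γ^{-(α-1)/2} to beat the moment, which by `hα` is eventually at most γ^{(α-1)/4}.
  set C : ℕ → ℝ := fun N => Real.exp (Real.log (γ N) / 2) with hC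
  set q : ℕ → ℝ := fun N => Real.exp (-(3 / 4 * Real.log (γ N))) with hq
  set J : ℕ → ℝ := fun N => N * (2 * ((p N : ℝ) ^ α *
    Real.exp (α * (α - 1) * μ ^ 2 / 2 * (⌊M * Real.log N⌋₊ : ℝ)))) with hJ
  refine ⟨fun N => C N * q N + C N ^ (1 - α) * Real.exp (J N), ?_, ?_⟩
  · have h1 : Tendsto (fun N => C N * q N) atTop (𝓝 0) := by
      have : ∀ N, C N * q N = Real.exp (-(1 / 4 * Real.log (γ N))) := fun N => by
        rw [hC, hq, ← Real.exp_add]; ring_nf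
      simp_rw [this]
      exact Real.tendsto_exp_neg_atTop_nhds_zero.comp (hlogγ.const_mul_atTop (by norm_num))
    have h2 : Tendsto (fun N => C N ^ (1 - α) * Real.exp (J N)) atTop (𝓝 0) := by
      have h3 : Tendsto (fun N => Real.exp (-((α - 1) / 4 * Real.log (γ N)))) atTop (𝓝 0) :=
        Real.tendsto_exp_neg_atTop_nhds_zero.comp (hlogγ.const_mul_atTop (by linarith))
      refine squeeze_zero' (Eventually.of_forall fun N => by positivity) ?_ h3
      filter_upwards [eventually_mul_rpow_le hα (2 * 2 ^ α)
        (by linarith : 0 < (α - 1) / 4 * (1 / 2)), h.le_log, h.p_le,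
        tendsto_log_natCast.eventually_gt_atTop 0, eventually_gt_atTop 0] with N hN hle hp hlog hN0
      have hX : (0 : ℝ) < N := by exact_mod_cast hN0
      have hJle : J N ≤ (α - 1) / 4 * Real.log (γ N) := by
        have h4 : J N ≤ 2 * 2 ^ α * (N : ℝ) ^ (1 - α * β + α * (α - 1) * μ ^ 2 / 2 * M) := by
          have h5 : Real.exp (α * (α - 1) * μ ^ 2 / 2 * (⌊M * Real.log N⌋₊ : ℝ)) ≤
              (N : ℝ) ^ (α * (α - 1) * μ ^ 2 / 2 * M) := by
            rw [Real.rpow_def_of_pos hX]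
            refine Real.exp_le_exp.2 ?_
            have h6 := Nat.floor_le (by positivity : 0 ≤ M * Real.log N)
            have h7 : 0 ≤ α * (α - 1) * μ ^ 2 / 2 := by
              have : 0 ≤ α - 1 := by linarith
              positivity
            have := mul_le_mul_of_nonneg_left h6 h7
            linarith
          have h6 : (p N : ℝ) ^ α ≤ 2 ^ α * (N : ℝ) ^ (-(α * β)) := by
            refine (Real.rpow_le_rpow (p N).2.1 hp (by linarith)).trans ?_
            rw [Real.mul_rpow two_pos.le (Real.rpow_nonneg hX.le _), ← Real.rpow_mul hX.le]
            refine le_of_eq ?_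
            ring_nf
          calc J N ≤ N * (2 * ((2 ^ α * (N : ℝ) ^ (-(α * β))) *
                (N : ℝ) ^ (α * (α - 1) * μ ^ 2 / 2 * M))) := by
                have h9 : 0 ≤ (p N : ℝ) ^ α := Real.rpow_nonneg (p N).2.1 _
                have h8 : 0 ≤ (N : ℝ) ^ (-(α * β)) := Real.rpow_nonneg hX.le _
                change (N : ℝ) * (2 * ((p N : ℝ) ^ α *
                  Real.exp (α * (α - 1) * μ ^ 2 / 2 * (⌊M * Real.log N⌋₊ : ℝ)))) ≤ _
                gcongr
            _ = _ := by
                rw [Real.rpow_add hX, sub_eq_add_neg 1 (α * β), Real.rpow_add hX, Real.rpow_one]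
                ring
        have h5 := mul_le_mul_of_nonneg_left hle (by linarith : 0 ≤ (α - 1) / 4)
        linarith
      have : C N ^ (1 - α) = Real.exp (-((α - 1) / 2 * Real.log (γ N))) := by
        rw [hC, ← Real.exp_mul]
        ring_nf
      rw [this, ← Real.exp_add]
      refine Real.exp_le_exp.2 ?_
      linarith
    simpa using h1.add h2
  · have hlin := h.eventually_log_le hζ0 8 one_pos
    have hfour := eventually_log_le_rpow (e := 1) one_pos (κ + M)
      (by norm_num : (0 : ℝ) < 1 / 4)
    filter_upwards [hARL, h.one_le, hlin, hfour, tendsto_log_natCast.eventually_gt_atTop 0,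
      eventually_gt_atTop 4] with N hA hγ h8 h4 hlog hN0
    have hX : (4 : ℝ) < N := by exact_mod_cast hN0
    have hX0 : (0 : ℝ) < N := by linarith
    have hγ0 : 0 < γ N := by linarith
    have hC0 : 0 < C N := Real.exp_pos _
    have hlogγ0 : 0 < Real.log (γ N) := by linarith
    have hq1 : q N < 1 := by
      rw [hq, Real.exp_lt_one_iff]
      linarith
    have hqinv : 1 / q N = Real.exp (3 / 4 * Real.log (γ N)) := by
      rw [hq, one_div, ← Real.exp_neg, neg_neg]
    have hγe : γ N = Real.exp (3 / 4 * Real.log (γ N)) * Real.exp (1 / 4 * Real.log (γ N)) := by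
      rw [← Real.exp_add]
      nth_rw 1 [← Real.exp_log hγ0]
      ring_nf
    have hroot : (N : ℝ) ≤ Real.exp (1 / 4 * Real.log (γ N)) := by
      rw [← Real.log_le_iff_le_exp hX0]
      linarith
    have hbig : 1 ≤ Real.exp (3 / 4 * Real.log (γ N)) := Real.one_le_exp (by linarith)
    have hfl : (⌊M * Real.log N⌋₊ : ℝ) ≤ M * Real.log N := Nat.floor_le (by positivity)
    have hce := Nat.ceil_lt_add_one (by positivity : 0 ≤ κ * Real.log N)
    have hγN : (⌈κ * Real.log N⌉₊ : ℝ) + (⌊M * Real.log N⌋₊ : ℝ) / q N < γ N := by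
      rw [div_eq_mul_one_div, hqinv]
      refine lt_of_lt_of_eq ?_ hγe.symm
      set B := Real.exp (3 / 4 * Real.log (γ N))
      rw [Real.rpow_one] at h4
      have i1 : (⌈κ * Real.log N⌉₊ : ℝ) ≤ (κ * Real.log N + 1) * B := by
        refine hce.le.trans ?_
        have : 0 ≤ κ * Real.log N + 1 := by positivity
        nlinarith
      have i2 : (⌊M * Real.log N⌋₊ : ℝ) * B ≤ M * Real.log N * B := by gcongr
      have i3 : (κ * Real.log N + 1) * B + M * Real.log N * B < B * N := by
        have : (κ * Real.log N + 1) * B + M * Real.log N * B = ((κ + M) * Real.log N + 1) * B := by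
          ring
        rw [this, mul_comm B]
        gcongr
        linarith
      have i4 : B * N ≤ B * Real.exp (1 / 4 * Real.log (γ N)) := by gcongr
      linarith
    have := le_delay (μ := μ) (p := p N) hA (Nat.le_ceil (κ * Real.log N)) (Real.exp_pos _) hq1 hγN
      hα1.le hα2 hC0
    refine le_trans ?_ this
    rw [ENNReal.ofReal_mul (by positivity), ENNReal.ofReal_natCast,
      ENNReal.ofReal_sub _ (by positivity), ENNReal.ofReal_one]

/-! ### From bounds to the limit -/

theorem tendsto_div_log_of_bounds {f : ℕ → ℝ≥0∞} {M₀ M₁ : ℝ} (h0 : 0 < M₀) (h1 : M₀ < M₁)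
    (hl : ∀ M, 0 < M → M < M₀ → ∃ δ : ℕ → ℝ, Tendsto δ atTop (𝓝 0) ∧
      ∀ᶠ N : ℕ in atTop, ENNReal.ofReal ((⌊M * Real.log N⌋₊ : ℝ) * (1 - δ N)) ≤ f N)
    (hu : ∀ M, M₀ < M → M < M₁ →
      ∀ᶠ N : ℕ in atTop, f N ≤ ENNReal.ofReal ((⌈M * Real.log N⌉₊ : ℝ) + 1)) :
    Tendsto (fun N : ℕ => f N / ENNReal.ofReal (Real.log N)) atTop (𝓝 (ENNReal.ofReal M₀)) := by
  refine tendsto_order.2 ⟨fun a ha => ?_, fun a ha => ?_⟩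
  · have hat : a ≠ ⊤ := (ha.trans ENNReal.ofReal_lt_top).ne
    rw [← ENNReal.ofReal_toReal hat, ENNReal.ofReal_lt_ofReal_iff h0] at ha
    obtain ⟨M, hM1, hM2⟩ := exists_between ha
    have hM0 : 0 < M := ENNReal.toReal_nonneg.trans_lt hM1
    obtain ⟨δ, hδ, hf⟩ := hl M hM0 hM2
    have hlim := (tendsto_floor_mul_log hM0.le).mul (hδ.const_sub 1)
    rw [sub_zero, mul_one] at hlim
    filter_upwards [hf, hlim.eventually_const_lt hM1, tendsto_log_natCast.eventually_gt_atTop 0]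
      with N hN hlt hlog
    rw [ENNReal.lt_div_iff_mul_lt (Or.inl (by simpa using hlog)) (Or.inl ENNReal.ofReal_ne_top),
      ← ENNReal.ofReal_toReal hat, ← ENNReal.ofReal_mul ENNReal.toReal_nonneg]
    refine lt_of_lt_of_le ?_ hN
    have h3 : a.toReal * Real.log N < (⌊M * Real.log N⌋₊ : ℝ) * (1 - δ N) := by
      rw [div_mul_eq_mul_div, lt_div_iff₀ hlog] at hlt
      exact hlt
    have h4 : 0 ≤ a.toReal * Real.log N := mul_nonneg ENNReal.toReal_nonneg hlog.le
    exact (ENNReal.ofReal_lt_ofReal_iff (h4.trans_lt h3)).2 h3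
  · obtain ⟨M, hM1, hM2, hM3⟩ : ∃ M, M₀ < M ∧ M < M₁ ∧ ENNReal.ofReal M < a := by
      rcases eq_or_ne a ⊤ with rfl | hat
      · obtain ⟨M, hM1, hM2⟩ := exists_between h1
        exact ⟨M, hM1, hM2, ENNReal.ofReal_lt_top⟩
      · rw [← ENNReal.ofReal_toReal hat] at ha ⊢
        have ha' := (ENNReal.ofReal_lt_ofReal_iff_of_nonneg h0.le).1 ha
        obtain ⟨M, hM1, hM2⟩ := exists_between (lt_min h1 ha')
        refine ⟨M, hM1, hM2.trans_le (min_le_left _ _), ?_⟩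
        exact (ENNReal.ofReal_lt_ofReal_iff (h0.trans ha')).2 (hM2.trans_le (min_le_right _ _))
    have hlim : Tendsto (fun N : ℕ => ENNReal.ofReal ((⌈M * Real.log N⌉₊ : ℝ) / Real.log N +
        1 / Real.log N)) atTop (𝓝 (ENNReal.ofReal (M + 0))) :=
      (ENNReal.continuous_ofReal.tendsto _).comp ((tendsto_ceil_mul_log (h0.trans hM1).le).add
        (tendsto_const_nhds.div_atTop tendsto_log_natCast))
    rw [add_zero] at hlim
    filter_upwards [hu M hM1 hM2, hlim.eventually_lt_const hM3,
      tendsto_log_natCast.eventually_gt_atTop 0] with N hN hlt hlog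
    refine lt_of_le_of_lt ?_ hlt
    rw [← add_div, ENNReal.ofReal_div_of_pos hlog]
    gcongr

/-! ### The exponents at the detection boundary -/

/-- With μ₀ = 2μ the post-change drift of the walk vanishes, so v = 2r²/(Mμ²), where r = β - (1 -
ζ)/2. At level 4r the gain exponent exceeds ζ exactly when v < r, i.e. when M > 2r/μ². -/
theorem gain_of_moderate {ζ β μ M : ℝ} (hμ : 0 < μ) (hβ : (1 - ζ) / 2 < β)
    (hM : 2 / μ ^ 2 * (β - (1 - ζ) / 2) < M) :
    ζ < 1 - β - (1 - ζ) / 2 + 4 * (β - (1 - ζ) / 2) / 2 -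
      ((4 * (β - (1 - ζ) / 2) - (2 * μ * μ - (2 * μ) ^ 2 / 2) * M) /
        (2 * μ * Real.sqrt M)) ^ 2 / 2 := by
  set r := β - (1 - ζ) / 2 with hr
  have hr0 : 0 < r := by linarith
  have hM0 : 0 < M := lt_trans (by positivity) hM
  have h1 : 2 * r < M * μ ^ 2 := by
    rwa [div_mul_eq_mul_div, div_lt_iff₀ (by positivity)] at hM
  have h2 : ((4 * r - (2 * μ * μ - (2 * μ) ^ 2 / 2) * M) / (2 * μ * Real.sqrt M)) ^ 2 / 2 =
      2 * r * r / (M * μ ^ 2) := by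
    rw [div_pow, mul_pow _ (Real.sqrt M), Real.sq_sqrt hM0.le]
    field_simp
    ring
  have h3 : 2 * r * r / (M * μ ^ 2) < r := by
    rw [div_lt_iff₀ (by positivity)]
    nlinarith
  rw [h2]
  linarith

/-- Put M = M₀(1 + e). The claim becomes (2B - e(A - 2B))² < 4B²(1 + e), i.e. e(A - 2B)² < 4B(A - B)
for e > 0. This holds for small e only, and `hM'` is a convenient sufficient bound. -/
theorem gain_of_sparse {A B μ M : ℝ} (hμ : 0 < μ) (hB : 0 < B) (hAB : 2 * B < A)
    (hM : 2 / μ ^ 2 * (A - B) ^ 2 < M)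
    (hM' : M < 2 / μ ^ 2 * (A - B) ^ 2 * (1 + 4 * B * (A - B) / A ^ 2)) :
    ((A ^ 2 - (μ * (A / (A - B)) * μ - (μ * (A / (A - B))) ^ 2 / 2) * M) /
      (μ * (A / (A - B)) * Real.sqrt M)) ^ 2 / 2 < B ^ 2 := by
  have hr : 0 < A - B := by linarith
  have hA : 0 < A := by linarith
  set M₀ := 2 / μ ^ 2 * (A - B) ^ 2 with hM₀
  have hM₀0 : 0 < M₀ := by positivity
  obtain ⟨e, rfl⟩ : ∃ e, M = M₀ * (1 + e) := ⟨M / M₀ - 1, by field_simp; ring⟩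
  have he0 : 0 < e := by
    by_contra hcon
    nlinarith
  have he1 : e < 4 * B * (A - B) / A ^ 2 := by
    have := lt_of_mul_lt_mul_left hM' hM₀0.le
    linarith
  rw [lt_div_iff₀ (by positivity)] at he1
  have hM1 : 0 ≤ M₀ * (1 + e) := by positivity
  rw [div_pow, mul_pow _ (Real.sqrt _), Real.sq_sqrt hM1, div_div, div_lt_iff₀ (by positivity)]
  have h1 : A ^ 2 - (μ * (A / (A - B)) * μ - (μ * (A / (A - B))) ^ 2 / 2) * (M₀ * (1 + e)) =
      A * (2 * B - e * (A - 2 * B)) := by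
    rw [hM₀]
    field_simp
    ring
  have h2 : B ^ 2 * ((μ * (A / (A - B))) ^ 2 * (M₀ * (1 + e)) * 2) =
      A ^ 2 * (4 * B ^ 2 * (1 + e)) := by
    rw [hM₀]
    field_simp
    ring
  rw [h1, h2, mul_pow]
  refine mul_lt_mul_of_pos_left ?_ (by positivity)
  have h3 : e * (A - 2 * B) ^ 2 < 4 * B * (A - B) := by
    refine lt_of_le_of_lt ?_ he1
    gcongr
    · linarith
  nlinarith

end

end MultiStream

end

/-! ### Conclusion: matching the exponents at the detection boundary -/

theorem theorem3 :
    -- the limit defining `ξ` exists, and the bound on the threshold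
    (∀ μ₀ : ℝ, 0 < μ₀ →
      (∀ (N : ℕ) (n : Fin N) (μ : ℝ) (p : unitInterval),
        (∀ t : ℕ, Integrable (fun x => Real.exp (MultiStream.cusum μ₀ (x n) t / 2))
          (MultiStream.law N μ p ⊤)) ∧
        Tendsto (fun t : ℕ =>
            ∫ x, Real.exp (MultiStream.cusum μ₀ (x n) t / 2) ∂(MultiStream.law N μ p ⊤))
          atTop (𝓝 (MultiStream.xi μ₀))) ∧
      ∀ (N : ℕ) (lam p₀ b γ : ℝ), 0 < lam → 0 < p₀ → p₀ ≤ 1 →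
        MultiStream.ARL (N := N) (MultiStream.meiTime μ₀ lam p₀ b) = ENNReal.ofReal γ →
        b ≤ N * Real.log (1 + p₀ * (lam * MultiStream.xi μ₀ - 1)) + Real.log (4 * γ)) ∧
    -- the asymptotic detection delay
    (∀ (μ μ₀ lam c β ζ : ℝ) (p : ℕ → unitInterval) (γ p₀ b : ℕ → ℝ),
      0 < μ → 0 < lam → 0 < c → 0 < ζ → ζ < 1 →
      (fun N : ℕ => Real.log (γ N)) ~[atTop] (fun N : ℕ => (N : ℝ) ^ ζ) →
      (fun N : ℕ => (p N : ℝ)) ~[atTop] (fun N : ℕ => (N : ℝ) ^ (-β)) →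
      (∀ᶠ N : ℕ in atTop, 1 ≤ γ N) →
      (∀ᶠ N : ℕ in atTop, p₀ N = c * Real.sqrt (Real.log (γ N) / N)) →
      (∀ᶠ N : ℕ in atTop,
        MultiStream.ARL (N := N) (MultiStream.meiTime μ₀ lam (p₀ N) (b N))
          = ENNReal.ofReal (γ N)) →
      ((1 - ζ) / 2 < β → β ≤ 3 * (1 - ζ) / 4 → μ₀ = 2 * μ →
        Tendsto (fun N : ℕ =>
            MultiStream.delay (N := N) μ (p N) (2 / μ ^ 2 * (1 - ζ - β) * Real.log N)
              (MultiStream.meiTime μ₀ lam (p₀ N) (b N)) / ENNReal.ofReal (Real.log N))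
          atTop (𝓝 (ENNReal.ofReal (2 / μ ^ 2 * MultiStream.rho β ζ)))) ∧
      (3 * (1 - ζ) / 4 < β → β < 1 - ζ → μ₀ = μ * Real.sqrt ((1 - ζ) / MultiStream.rho β ζ) →
        Tendsto (fun N : ℕ =>
            MultiStream.delay (N := N) μ (p N) (2 / μ ^ 2 * MultiStream.rho β ζ * Real.log N)
              (MultiStream.meiTime μ₀ lam (p₀ N) (b N)) / ENNReal.ofReal (Real.log N))
          atTop (𝓝 (ENNReal.ofReal (2 / μ ^ 2 * MultiStream.rho β ζ))))) := by
  refine ⟨fun μ₀ hμ₀ => ⟨fun N n μ p => ?_, fun N lam p₀ b γ hl h0 h1 hARL =>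
    MultiStream.threshold_le hμ₀ hl h0 h1 hARL⟩, ?_⟩
  · have hmp := measurePreserving_eval (fun _ : Fin N => MultiStream.noise) n
    have hint : ∀ t : ℕ, Integrable (fun x => Real.exp (MultiStream.cusum μ₀ x t / 2))
        MultiStream.noise := MultiStream.integrable_exp_half_cusum hμ₀
    rw [MultiStream.law_top]
    refine ⟨fun t => hmp.integrable_comp_of_integrable (hint t), ?_⟩
    refine (MultiStream.tendsto_halfMoment hμ₀).congr fun t => ?_
    have h := (hint t).aestronglyMeasurable
    rw [← hmp.map_eq] at h
    have h2 := integral_map hmp.measurable.aemeasurable h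
    rw [hmp.map_eq] at h2
    exact h2
  · intro μ μ₀ lam c β ζ p γ p₀ b hμ hl hc hζ0 hζ1 hγ hp h1 hp₀ hARL
    have hreg := MultiStream.Regime.of_isEquivalent hc hγ hp h1 hp₀
    have hμ2 : 0 < 2 / μ ^ 2 := by positivity
    refine ⟨fun hβ hβ' hμ₀ => ?_, fun hβ hβ' hμ₀ => ?_⟩
    · subst hμ₀
      rw [MultiStream.rho, if_pos hβ']
      have hκ : 0 < 2 / μ ^ 2 * (1 - ζ - β) := mul_pos hμ2 (by linarith)
      have hM₀ : 0 < 2 / μ ^ 2 * (β - (1 - ζ) / 2) := mul_pos hμ2 (by linarith)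
      refine MultiStream.tendsto_div_log_of_bounds hM₀ (lt_add_one _) (fun M hM hM' => ?_)
        (fun M hM hM' => ?_)
      -- Second moment: 1 - 2β + μ²M < ζ is exactly M < 2ρ/μ².
      · refine hreg.eventually_le_delay (α := 2) hζ0 hARL hκ hM one_lt_two le_rfl ?_
        rw [div_mul_eq_mul_div, lt_div_iff₀ (by positivity)] at hM'
        linarith
      -- The level y = 4ρ is at most 1 - ζ precisely when β ≤ 3(1 - ζ)/4. The constant in K_N plus
      -- 2ρ/μ² equals (1 - ζ)/μ², the borderline of the rate condition.
      · refine hreg.eventually_delay_le hζ0 hζ1 hc hβ hμ.le (by positivity) hl hARL hκ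
          (hM₀.trans hM) (y := 4 * (β - (1 - ζ) / 2)) (by linarith) ?_
          (MultiStream.gain_of_moderate hμ hβ hM)
        have h2 : 2 / μ ^ 2 * (1 - ζ - β) * μ ^ 2 = 2 * (1 - ζ - β) := by field_simp
        rw [div_mul_eq_mul_div, div_lt_iff₀ (by positivity)] at hM
        linarith
    · obtain ⟨A, hA0, hA⟩ : ∃ A : ℝ, 0 < A ∧ A ^ 2 = 1 - ζ :=
        ⟨Real.sqrt (1 - ζ), Real.sqrt_pos.2 (by linarith), Real.sq_sqrt (by linarith)⟩
      obtain ⟨B, hB0, hB⟩ : ∃ B : ℝ, 0 < B ∧ B ^ 2 = 1 - ζ - β :=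
        ⟨Real.sqrt (1 - ζ - β), Real.sqrt_pos.2 (by linarith), Real.sq_sqrt (by linarith)⟩
      -- This is the boundary β > 3(1 - ζ)/4; it is also what makes α = A/(A - B) less than 2.
      have hAB : 2 * B < A := by
        refine lt_of_pow_lt_pow_left₀ 2 hA0.le ?_
        linarith
      have hr : 0 < A - B := by linarith
      have hρ : MultiStream.rho β ζ = (A - B) ^ 2 := by
        rw [MultiStream.rho, if_neg hβ.not_ge, ← hB, ← hA, Real.sqrt_sq hA0.le,
          Real.sqrt_sq hB0.le]
      rw [hρ, ← hA, ← div_pow, Real.sqrt_sq (by positivity)] at hμ₀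
      subst hμ₀
      rw [hρ]
      have hM₀ : 0 < 2 / μ ^ 2 * (A - B) ^ 2 := by positivity
      refine MultiStream.tendsto_div_log_of_bounds hM₀
        (M₁ := 2 / μ ^ 2 * (A - B) ^ 2 * (1 + 4 * B * (A - B) / A ^ 2))
        (lt_mul_of_one_lt_right hM₀ (lt_add_of_pos_right _ (by positivity)))
        (fun M hM hM' => ?_) (fun M hM hM' => ?_)
      -- For this α, αβ = A(A + B), and α(α - 1)μ²M/2 equals AB at M = 2ρ/μ², so the moment exponent
      -- there is 1 - A² = ζ.
      · refine hreg.eventually_le_delay (α := A / (A - B)) hζ0 hARL hM₀ hM ?_ ?_ ?_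
        · rw [one_lt_div hr]
          linarith
        · rw [div_le_iff₀ hr]
          linarith
        · have h2 : A / (A - B) * (A / (A - B) - 1) * μ ^ 2 / 2 * M < A * B := by
            calc A / (A - B) * (A / (A - B) - 1) * μ ^ 2 / 2 * M
                = A * B * μ ^ 2 / (2 * (A - B) ^ 2) * M := by
                  field_simp
                  ring
              _ < A * B * μ ^ 2 / (2 * (A - B) ^ 2) * (2 / μ ^ 2 * (A - B) ^ 2) := by gcongr
              _ = A * B := by field_simp
          have h3 : A / (A - B) * β = A * (A + B) := by
            rw [show β = A ^ 2 - B ^ 2 by linarith]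
            field_simp
            ring
          rw [h3]
          linarith
      -- Here y takes its maximal value 1 - ζ. The pre-change and post-change times each contribute
      -- A²/4 or more to the rate, and strictness comes from M > 2ρ/μ².
      · refine hreg.eventually_delay_le hζ0 hζ1 hc (by linarith) hμ.le (by positivity) hl hARL hM₀
          (hM₀.trans hM) (y := A ^ 2) hA.le ?_ ?_
        · have h2 : 2 / μ ^ 2 * (A - B) ^ 2 * ((μ * (A / (A - B))) ^ 2 / 8) = A ^ 2 / 4 := by
            field_simp
            ring
          have h3 := mul_lt_mul_of_pos_right hM
            (by positivity : 0 < (μ * (A / (A - B))) ^ 2 / 8)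
          rw [add_mul]
          linarith
        · have := MultiStream.gain_of_sparse hμ hB0 hAB hM hM'
          linarith
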